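/- Let $0\le k<n$ be integers. Call an element $\omega\in\Lambda^k(\mathbb R^n)$ a simple $k$-vector if $\omega=c\,v_1\wedge\dots\wedge v_k$ with $c\in\mathbb R$ and $v_i\in\mathbb R^n$ (so for $k=0$ the simple $0$-vectors are the real numbers). The space $\Lambda^k(\mathbb R^n)$ carries the inner product with $(u_1\wedge\dots\wedge u_k)\cdot(v_1\wedge\dots\wedge v_k)=\det(u_i\cdot v_j)$, and $\hat\Lambda^k_u$ is the set of simple $k$-vectors of unit length. For $\omega\in\hat\Lambda^k_u$ let $[\omega]$ be the span of the factors $v_1,\dots,v_k$ of $\omega$ and let $U_\omega$ be the set of unit vectors of $[\omega]^\perp$. For $p\in\mathbb R^n$, $\omega\in\hat\Lambda^k_u$ and $r>0$ let $$D(p,\omega,r)=\{p+\xi u: u\in U_\omega,\ 0\le\xi<r\},\qquad \partial D(p,\omega,r)=\{p+ru:u\in U_\omega\}.$$ Let $\mathcal H^d$ be the $d$-dimensional Hausdorff measure, normalized so that it is Lebesgue measure on $\mathbb R^d$; on triples $(p,\omega,r)\in\mathbb R^n\times\Lambda^k(\mathbb R^n)\times\mathbb R$ it is taken with respect to the Euclidean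 product metric. For $M,\Omega\subseteq\mathbb R^n$ and $\sigma\in\mathbb R$ put $$\mathrm{Meas}^k_\sigma(M,\Omega)=\int_{\mathcal D_\Omega(M)} r^{k-n-\sigma}\,d\mathcal H^{n+k(n-k)+1}(p,\omega,r)\in[0,\infty],$$ where $\mathcal D_\Omega(M)$ is the set of all $(p,\omega,r)$ with $p\in\mathbb R^n$, $\omega\in\hat\Lambda^k_u$, $r>0$, such that $D(p,\omega,r)\cap M$ is finite with an odd number of points and $\partial D(p,\omega,r)\cap\Omega\ne\emptyset$. **Theorem.** Let $M\subset\mathbb R^n$ be a bounded smooth $k$-manifold whose boundary is a $(k-1)$-manifold. That is, $M$ is bounded, its closure $\overline M$ is a $C^\infty$ embedded $k$-dimensional submanifold with (possibly empty) boundary of $\mathbb R^n$, and $M$ contains all interior points of $\overline M$ (boundary points of $\overline M$ may or may not belong to $M$). Let $\Omega$ be a bounded open set with $M\subseteq\Omega$. Then $\mathcal H^k(M)<\infty$, $\mathrm{Meas}^k_\sigma(M,\Omega)<\infty$ for all $\sigma\in(0,1)$, and $$\lim_{\sigma\uparrow1}(1-\sigma)\,\mathrm{Meas}^k_\sigma(M,\Omega)=\frac{4\,\pi^{\frac{(n+2)(k+1)}2}\,\Gamma\!\left(\frac{n-k+1}2\right)}{\sqrt\pi\;\Gamma\!\left(\frac{n+1}2\right)(n-k)}\;\prod_{i=1}^{k+1}\frac{\Gamma\!\left(\frac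 i2\right)}{\pi^i\,\Gamma\!\left(\frac{n-i+1}2\right)}\;\mathcal H^k(M).$$ -/

import Mathlib

open MeasureTheory Set Filter Topology
open scoped ContDiff ENNReal

noncomputable section

namespace FracMeas

/-- Euclidean `n`-space. -/
abbrev E (n : ℕ) : Type := EuclideanSpace ℝ (Fin n)

/-- The space of `k`-vectors of `ℝⁿ`. Mathlib equips it with the inner product determined by
`⟪u₁ ∧ ⋯ ∧ u_k, v₁ ∧ ⋯ ∧ v_k⟫ = det (uᵢ · vⱼ)`. -/
abbrev KVec (n k : ℕ) : Type := ⋀[ℝ]^k (E n)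

instance kVecMeasurableSpace (n k : ℕ) : MeasurableSpace (KVec n k) := borel _

instance kVecBorelSpace (n k : ℕ) : BorelSpace (KVec n k) := ⟨rfl⟩

/-- `v₁ ∧ ⋯ ∧ v_k`. -/
def wedge {n k : ℕ} (v : Fin k → E n) : KVec n k := exteriorPower.ιMulti ℝ k v

/-- Simple `k`-vectors. The scalar factor only matters for `k = 0`: the simple `0`-vectors are
all the real numbers, so that the unit ones are `1` and `-1`. -/
def IsSimple {n k : ℕ} (w : KVec n k) : Prop := ∃ (c : ℝ) (v : Fin k → E n), w = c • wedge v

/-- The set of unit simple `k`-vectors, i.e. of oriented `k`-dimensional subspaces of `ℝⁿ`. -/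
def unitSimple (n k : ℕ) : Set (KVec n k) := {w | IsSimple w ∧ ‖w‖ = 1}

/-- The subspace `[w]` spanned by the factors of a simple `k`-vector `w`; for `w ≠ 0` it does not
depend on the factorization, see `plane_smul_wedge`. -/
def plane {n k : ℕ} (w : KVec n k) : Submodule ℝ (E n) :=
  Submodule.span ℝ {x | ∃ (c : ℝ) (v : Fin k → E n), w = c • wedge v ∧ x ∈ range v}

theorem wedge_ne_zero_iff {n k : ℕ} (v : Fin k → E n) :
    wedge v ≠ 0 ↔ LinearIndependent ℝ v := by
  rw [← Matrix.det_gram_ne_zero_iff_linearIndependent (𝕜 := ℝ), ← exteriorPower.inner_ιMulti_self,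
    inner_self_ne_zero]
  rfl

theorem wedge_cons_eq_zero {n k : ℕ} (x : E n) {c d : ℝ} {u v : Fin k → E n}
    (h : c • wedge u = d • wedge v) (hd : d ≠ 0) (hx : x ∈ range u) :
    wedge (Fin.cons x v : Fin (k + 1) → E n) = 0 := by
  obtain ⟨i, rfl⟩ := hx
  have key : ∀ w : Fin k → E n, ((wedge (Fin.cons (u i) w : Fin (k + 1) → E n) : KVec n (k + 1)) :
      ExteriorAlgebra ℝ (E n)) = ExteriorAlgebra.ι ℝ (u i) * (wedge w : KVec n k) := by
    intro w
    simp only [wedge, exteriorPower.ιMulti_apply_coe, ExteriorAlgebra.ιMulti_succ_apply,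
      Fin.cons_zero]
    rfl
  have hu : wedge (Fin.cons (u i) u : Fin (k + 1) → E n) = 0 := by
    refine (exteriorPower.ιMulti ℝ (k + 1)).map_eq_zero_of_eq _ (i := 0) (j := i.succ) ?_
      (Fin.succ_ne_zero i).symm
    simp
  have hv : wedge v = (d⁻¹ * c) • wedge u := by
    rw [mul_smul, h, smul_smul, inv_mul_cancel₀ hd, one_smul]
  apply Subtype.ext
  rw [key, hv, Submodule.coe_smul, mul_smul_comm, ← key, hu]
  simp

/-- The subspace `[w]` is spanned by the factors of any factorization of `w ≠ 0`. -/
theorem plane_smul_wedge {n k : ℕ} {c : ℝ} {v : Fin k → E n} (h : c • wedge v ≠ 0) :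
    plane (c • wedge v) = Submodule.span ℝ (range v) := by
  apply le_antisymm
  · rw [plane, Submodule.span_le]
    rintro x ⟨d, u, hu, hx⟩
    by_contra hxv
    have hv : LinearIndependent ℝ v := (wedge_ne_zero_iff v).1 (fun h0 => h (by rw [h0, smul_zero]))
    have hc : c ≠ 0 := fun h0 => h (by rw [h0, zero_smul])
    exact (wedge_ne_zero_iff _).2 (linearIndependent_finCons.2 ⟨hv, hxv⟩)
      (wedge_cons_eq_zero x hu.symm hc hx)
  · exact Submodule.span_mono fun x hx => ⟨c, v, rfl, hx⟩

/-- The set of unit vectors orthogonal to `[w]`. -/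
def unitNormals {n k : ℕ} (w : KVec n k) : Set (E n) := {u | u ∈ (plane w)ᗮ ∧ ‖u‖ = 1}

/-- The (relatively open) `(n - k)`-disk with center `p` and radius `r` orthogonal to `[w]`. -/
def disk {n k : ℕ} (p : E n) (w : KVec n k) (r : ℝ) : Set (E n) :=
  {x | ∃ u ∈ unitNormals w, ∃ t ∈ Ico (0 : ℝ) r, x = p + t • u}

/-- The boundary of the disk `disk p w r`. -/
def diskBoundary {n k : ℕ} (p : E n) (w : KVec n k) (r : ℝ) : Set (E n) :=
  {x | ∃ u ∈ unitNormals w, x = p + r • u}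

/-- The space of all triples `(p, w, r)`, with the Euclidean product metric. -/
abbrev Triple (n k : ℕ) : Type := WithLp 2 (E n × WithLp 2 (KVec n k × ℝ))

/-- The center of a triple. -/
def Triple.center {n k : ℕ} (d : Triple n k) : E n := d.fst

/-- The `k`-vector of a triple. -/
def Triple.normal {n k : ℕ} (d : Triple n k) : KVec n k := d.snd.fst

/-- The radius of a triple. -/
def Triple.radius {n k : ℕ} (d : Triple n k) : ℝ := d.snd.snd

/-- The set of triples representing oriented disks that meet `M` in an odd (finite) number of
points and whose boundary meets `Ω`. -/
def oddDisks (n k : ℕ) (M Ω : Set (E n)) : Set (Triple n k) :=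
  {d | d.normal ∈ unitSimple n k ∧ 0 < d.radius ∧
    (disk d.center d.normal d.radius ∩ M).Finite ∧
    Odd (disk d.center d.normal d.radius ∩ M).ncard ∧
    (diskBoundary d.center d.normal d.radius ∩ Ω).Nonempty}

/-- The `k`-dimensional `σ`-measure of `M` relative to `Ω`. Here `μHE[d]` is the `d`-dimensional
Hausdorff measure normalized so as to agree with Lebesgue measure on `ℝᵈ`. -/
def meas (n k : ℕ) (σ : ℝ) (M Ω : Set (E n)) : ℝ≥0∞ :=
  ∫⁻ d in oddDisks n k M Ω, ENNReal.ofReal (d.radius ^ ((k : ℝ) - n - σ))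
    ∂(μHE[n + k * (n - k) + 1] : Measure (Triple n k))

/-- `φ` is a smooth chart of `ℝⁿ` around `z`. -/
def IsSmoothChartAt {n : ℕ} (φ : OpenPartialHomeomorph (E n) (E n)) (z : E n) : Prop :=
  z ∈ φ.source ∧ ContDiffOn ℝ ∞ φ φ.source ∧ ContDiffOn ℝ ∞ φ.symm φ.target

/-- Near `z`, the set `X` is a smoothly embedded `k`-manifold without boundary: some smooth chart
maps it to the coordinate plane on which all but the first `k` coordinates vanish. -/
def IsInteriorPoint {n : ℕ} (k : ℕ) (X : Set (E n)) (z : E n) : Prop :=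
  ∃ φ : OpenPartialHomeomorph (E n) (E n), IsSmoothChartAt φ z ∧
    ∀ x ∈ φ.source, x ∈ X ↔ ∀ i : Fin n, k ≤ (i : ℕ) → φ x i = 0

/-- Near `z`, the set `X` is a smoothly embedded `k`-manifold with boundary, and `z` is a boundary
point: some smooth chart maps `X` to a coordinate half-plane and `z` to its edge. -/
def IsBoundaryPoint {n : ℕ} (k : ℕ) (X : Set (E n)) (z : E n) : Prop :=
  ∃ φ : OpenPartialHomeomorph (E n) (E n), IsSmoothChartAt φ z ∧
    ∃ j : Fin n, (j : ℕ) < k ∧ φ z j = 0 ∧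
      ∀ x ∈ φ.source, x ∈ X ↔ (∀ i : Fin n, k ≤ (i : ℕ) → φ x i = 0) ∧ 0 ≤ φ x j

/-- `M` is a bounded smooth `k`-manifold in `ℝⁿ` with smooth, possibly empty, boundary: its closure
is a smoothly embedded `k`-manifold with boundary, and `M` contains all the interior points of this
manifold with boundary. It is left open whether the boundary points are counted as points
of `M`. -/
structure IsBoundedManifold {n : ℕ} (k : ℕ) (M : Set (E n)) : Prop where
  isBounded : Bornology.IsBounded M
  interior_or_boundary : ∀ z ∈ closure M,
    IsInteriorPoint k (closure M) z ∨ IsBoundaryPoint k (closure M) z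
  interior_subset : ∀ z ∈ closure M, IsInteriorPoint k (closure M) z → z ∈ M

end FracMeas

end

/-!
# The fractional measure of a manifold

Write `n = k + m`. Almost every oriented `k`-plane of `ℝⁿ` is, up to orientation, the graph of the
linear map `ℝᵏ → ℝᵐ` with columns `A`, so that almost every disk is given by its center `p`, by `A`
and by its radius `r`.

**The measure on the space of disks.** In these coordinates, the Hausdorff measure is the product of
Lebesgue measure for `p`, the measure with density `(nd A)⁻ⁿ` for `A`, and Lebesgue measure for `r`,
see `restrict_diskTriples_eq`. Here `nd A` is the volume factor of the graph of `A`. Both measures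
are invariant under isometries. For the Hausdorff measure this is clear, and for the product it is
because the density arises when planes are spanned by random frames, see `lintegral_ballTuples`. At
the standard plane `A = 0`, the chart has an isometric derivative and the density is one. Hence the
two measures agree up to factors close to one near each plane, and then they are equal. Compared
with a computation of Jacobians, this only needs the derivative of the chart at one point.

**The radial density.** Integrating over `p` and `A` first, the fractional measure becomes twice the
integral of `r ^ (-σ) * h r` over `r > 0`, where `h r` is the measure of the set of odd disks of
radius `r`, divided by `r ^ m`, see `meas_eq_lintegral_sliceDensity`. For fixed `A`, the centers are
integrated along the fibers orthogonal to the plane. In a fiber containing finitely many points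
of `M`, the centers of the odd disks of a small radius `r` form the disjoint union of the balls of
radius `r` around these points, and for any `r` they are contained in this union. Therefore `h` is
bounded by its limit at zero, which is the volume of the unit ball of `ℝᵐ` times the average number
of points of `M` in a fiber, see `sliceDensity_le` and `tendsto_sliceDensity`. By the
integral-geometric formula `lintegral_fiberCount`, this average is a multiple of the Hausdorff
measure of `M`. Moreover, `h r` decays like `1 / r` at infinity, because the boundary of a large
disk rarely meets the bounded set `Ω`, see `exists_sliceDensity_le_of_large`. As `σ` tends to one,
the measures `(1 - σ) r ^ (-σ) dr` concentrate at zero, so that the limit is twice the limit of `h`,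
see `tendsto_lintegral_rpow_mul`.

**The constant.** The constant of the integral-geometric formula is an integral of a power of
`nd A`. Adding a column to `A` multiplies it by a radial integral which is a quotient of Gamma
functions, see `chartConst_eq`.

The boundary points of `M` are negligible because, for each `A`, only a null set of fibers meets
them, see `oddCoords_ae_eq`. Measurability of the set of odd disks is obtained by exhausting
the interior of `M` by compact sets, see `measurableSet_oddCoords`.
-/

noncomputable section

namespace FracMeas

open scoped NNReal

/-! ### Gluing local information along countable partitions -/

/-- Neighbourhoods of the points of `s` refine to a countable measurable partition of `s`. -/
theorem exists_measurable_partition {X : Type*} [TopologicalSpace X] [SecondCountableTopology X]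
    [MeasurableSpace X] [OpensMeasurableSpace X] {s : Set X} (hs : MeasurableSet s)
    {V : X → Set X} (hV : ∀ x ∈ s, V x ∈ 𝓝[s] x) :
    ∃ B : ℕ → Set X, (∀ i, MeasurableSet (B i)) ∧ Pairwise (Function.onFun Disjoint B) ∧
      ⋃ i, B i = s ∧ ∀ i, B i = ∅ ∨ ∃ x ∈ s, B i ⊆ V x := by
  rcases s.eq_empty_or_nonempty with rfl | hne
  · exact ⟨fun _ => ∅, fun _ => .empty, fun i j _ => by simp [Function.onFun], by simp,
      fun _ => Or.inl rfl⟩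
  have h1 : ∀ x, ∃ U : Set X, IsOpen U ∧ (x ∈ s → x ∈ U ∧ U ∩ s ⊆ V x) := by
    intro x
    by_cases hx : x ∈ s
    · obtain ⟨U, hU, hxU, hUV⟩ := mem_nhdsWithin.1 (hV x hx)
      exact ⟨U, hU, fun _ => ⟨hxU, hUV⟩⟩
    · exact ⟨∅, isOpen_empty, fun h => absurd h hx⟩
  choose U hUo hU using h1
  obtain ⟨t, hts, htc, hcov⟩ := TopologicalSpace.countable_cover_nhdsWithin (s := s) (f := U)
    (fun x hx => mem_nhdsWithin_of_mem_nhds ((hUo x).mem_nhds (hU x hx).1))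
  have htne : t.Nonempty := by
    obtain ⟨x, hx⟩ := hne
    obtain ⟨y, hy, -⟩ := mem_iUnion₂.1 (hcov hx)
    exact ⟨y, hy⟩
  obtain ⟨e, rfl⟩ := htc.exists_eq_range htne
  refine ⟨disjointed fun i => U (e i) ∩ s,
    fun i => MeasurableSet.disjointed (fun i => (hUo _).measurableSet.inter hs) i,
    disjoint_disjointed _, ?_, fun i => Or.inr ⟨e i, hts ⟨i, rfl⟩, ?_⟩⟩
  · rw [iUnion_disjointed, ← iUnion_inter]
    refine inter_eq_right.2 (hcov.trans ?_)
    rw [biUnion_range]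
  · exact (disjointed_subset _ i).trans (hU _ (hts ⟨i, rfl⟩)).2

/-- Countable additivity, on the measurable subsets of `s`, of a function of sets. -/
def IsAdditiveOn {X : Type*} [MeasurableSpace X] (μ : Set X → ℝ≥0∞) (s : Set X) : Prop :=
  ∀ B : ℕ → Set X, (∀ i, MeasurableSet (B i)) → Pairwise (Function.onFun Disjoint B) →
    (∀ i, B i ⊆ s) → μ (⋃ i, B i) = ∑' i, μ (B i)

theorem isAdditiveOn_measure {X : Type*} [MeasurableSpace X] (μ : Measure X) (s : Set X) :
    IsAdditiveOn (fun t => μ t) s := fun _ hB hd _ => measure_iUnion hd hB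

theorem IsAdditiveOn.image {X Y : Type*} [TopologicalSpace X] [PolishSpace X] [MeasurableSpace X]
    [BorelSpace X] [TopologicalSpace Y] [T2Space Y] [MeasurableSpace Y] [OpensMeasurableSpace Y]
    (μ : Measure Y) {f : X → Y} {s : Set X} (hf : ContinuousOn f s) (hi : InjOn f s) :
    IsAdditiveOn (fun t => μ (f '' t)) s := by
  intro B hB hd hBs
  simp only [image_iUnion]
  refine measure_iUnion (fun i j hij => ?_)
    fun i => (hB i).image_of_continuousOn_injOn (hf.mono (hBs i)) (hi.mono (hBs i))
  refine Set.disjoint_left.2 ?_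
  rintro _ ⟨x, hx, rfl⟩ ⟨y, hy, hxy⟩
  exact Set.disjoint_left.1 (hd hij) hx (hi (hBs j hy) (hBs i hx) hxy ▸ hy)

/-- An inequality between countably additive functions of sets can be checked locally. -/
theorem le_of_locally_le {X : Type*} [TopologicalSpace X] [SecondCountableTopology X]
    [MeasurableSpace X] [OpensMeasurableSpace X] {μ ν : Set X → ℝ≥0∞} {s : Set X}
    (hs : MeasurableSet s) (hμ : IsAdditiveOn μ s) (hν : IsAdditiveOn ν s) (hμ0 : μ ∅ = 0)
    (h : ∀ x ∈ s, ∃ V ∈ 𝓝[s] x, ∀ B, MeasurableSet B → B ⊆ V → B ⊆ s → μ B ≤ ν B) : μ s ≤ ν s := by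
  choose! V hV hVB using h
  obtain ⟨B, hBm, hBd, hBs, hB⟩ := exists_measurable_partition hs hV
  have hsub : ∀ i, B i ⊆ s := fun i => hBs ▸ subset_iUnion B i
  rw [← hBs, hμ B hBm hBd hsub, hν B hBm hBd hsub]
  refine ENNReal.tsum_le_tsum fun i => ?_
  rcases hB i with h0 | ⟨x, hx, hxB⟩
  · rw [h0, hμ0]
    exact zero_le
  · exact hVB x hx _ (hBm i) hxB (hsub i)

theorem le_of_forall_one_lt_le_pow_mul {a b : ℝ≥0∞} (d : ℕ)
    (h : ∀ K : ℝ≥0, 1 < K → a ≤ (K : ℝ≥0∞) ^ d * b) : a ≤ b := by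
  have h1 : Tendsto (fun K : ℝ≥0 => (K : ℝ≥0∞) ^ d * b) (𝓝[>] 1) (𝓝 ((1 : ℝ≥0∞) ^ d * b)) := by
    refine ENNReal.Tendsto.mul_const ?_ (Or.inl (by simp))
    refine (ENNReal.continuous_pow d).continuousAt.tendsto.comp ?_
    have := (ENNReal.continuous_coe.tendsto (1 : ℝ≥0))
    exact (this.mono_left nhdsWithin_le_nhds)
  rw [one_pow, one_mul] at h1
  exact ge_of_tendsto h1 (eventually_nhdsWithin_of_forall fun K hK => h K hK)

/-! ### Hausdorff measure of the image of an immersion -/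

section Hausdorff

theorem euclideanHausdorffMeasure_image_le_of_lipschitzOnWith {X Y : Type*} [MetricSpace X]
    [MeasurableSpace X] [BorelSpace X] [MetricSpace Y] [MeasurableSpace Y] [BorelSpace Y]
    {K : ℝ≥0} {f : X → Y} {s : Set X} (hf : LipschitzOnWith K f s) (d : ℕ) :
    (μHE[d] : Measure Y) (f '' s) ≤ (K : ℝ≥0∞) ^ d * (μHE[d] : Measure X) s := by
  have := hf.hausdorffMeasure_image_le (d := (d : ℝ)) (by positivity)
  simp only [Measure.euclideanHausdorffMeasure_def, Measure.smul_apply, ENNReal.smul_def,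
    smul_eq_mul]
  rw [ENNReal.rpow_natCast] at this
  calc _ ≤ _ := mul_le_mul_right this _
    _ = _ := by ring

variable {X Y : Type*} [NormedAddCommGroup X] [NormedSpace ℝ X]
  [NormedAddCommGroup Y] [NormedSpace ℝ Y]

/-- A map whose strict derivative at `x` is isometric distorts distances near `x` by factors
arbitrarily close to one. -/
theorem exists_nhds_almost_isometric {f : X → Y} {f' : X →L[ℝ] Y} {x : X}
    (hf : HasStrictFDerivAt f f' x) (hi : ∀ u, ‖f' u‖ = ‖u‖) {K : ℝ≥0} (hK : 1 < K) :
    ∃ V ∈ 𝓝 x, ∀ y ∈ V, ∀ z ∈ V, dist (f y) (f z) ≤ K * dist y z ∧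
      dist y z ≤ K * dist (f y) (f z) := by
  have hK' : (1 : ℝ) < K := by exact_mod_cast hK
  have hK0 : (0 : ℝ) < K := by linarith
  -- The error `1 - K⁻¹` of the linear approximation suffices for both bounds since `2 - K⁻¹ ≤ K`.
  let c : ℝ≥0 := ⟨1 - (K : ℝ)⁻¹, by
    rw [sub_nonneg]; exact inv_le_one_of_one_le₀ hK'.le⟩
  have hc : (c : ℝ) = 1 - (K : ℝ)⁻¹ := rfl
  have hc0 : 0 < c := by
    rw [← NNReal.coe_pos, hc, sub_pos]
    exact inv_lt_one_of_one_lt₀ hK'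
  obtain ⟨V, hV, hVc⟩ := hf.approximates_deriv_on_nhds (Or.inr hc0)
  refine ⟨V, hV, fun y hy z hz => ?_⟩
  have h1 := hVc y hy z hz
  simp only [dist_eq_norm]
  have h2 : ‖f y - f z‖ ≤ ‖f y - f z - f' (y - z)‖ + ‖y - z‖ := by
    rw [← hi (y - z)]
    simpa using norm_add_le (f y - f z - f' (y - z)) (f' (y - z))
  have h3 : ‖y - z‖ ≤ ‖f y - f z‖ + ‖f y - f z - f' (y - z)‖ := by
    rw [← hi (y - z)]
    have := norm_sub_le (f y - f z) (f y - f z - f' (y - z))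
    simpa using this
  rw [hc] at h1
  have hKi : (K : ℝ) * (K : ℝ)⁻¹ = 1 := mul_inv_cancel₀ hK0.ne'
  have h4 : 2 ≤ (K : ℝ) + (K : ℝ)⁻¹ := by
    have : 0 ≤ ((K : ℝ) - 1) ^ 2 * (K : ℝ)⁻¹ := by positivity
    nlinarith
  constructor
  · nlinarith [norm_nonneg (y - z)]
  · have h5 : (K : ℝ)⁻¹ * ‖y - z‖ ≤ ‖f y - f z‖ := by linarith
    calc ‖y - z‖ = K * ((K : ℝ)⁻¹ * ‖y - z‖) := by rw [← mul_assoc, hKi, one_mul]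
      _ ≤ _ := by gcongr

variable [MeasurableSpace X] [BorelSpace X] [MeasurableSpace Y] [BorelSpace Y]

/-- A map whose strict derivative at `x` is isometric multiplies Hausdorff measure near `x` by
factors arbitrarily close to one. -/
theorem exists_nhds_hausdorff_comparison {f : X → Y} {f' : X →L[ℝ] Y} {x : X}
    (hf : HasStrictFDerivAt f f' x) (hi : ∀ u, ‖f' u‖ = ‖u‖) {K : ℝ≥0} (hK : 1 < K) (d : ℕ) :
    ∃ V ∈ 𝓝 x, InjOn f V ∧ ∀ B ⊆ V,
      (μHE[d] : Measure Y) (f '' B) ≤ (K : ℝ≥0∞) ^ d * (μHE[d] : Measure X) B ∧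
      (μHE[d] : Measure X) B ≤ (K : ℝ≥0∞) ^ d * (μHE[d] : Measure Y) (f '' B) := by
  obtain ⟨V, hV, h⟩ := exists_nhds_almost_isometric hf hi hK
  have hinj : InjOn f V := by
    intro y hy z hz hyz
    have := (h y hy z hz).2
    rw [hyz, dist_self, mul_zero] at this
    exact dist_le_zero.1 this
  refine ⟨V, hV, hinj, fun B hB => ⟨?_, ?_⟩⟩
  · exact euclideanHausdorffMeasure_image_le_of_lipschitzOnWith
      (LipschitzOnWith.of_dist_le_mul fun y hy z hz => (h y (hB hy) z (hB hz)).1) d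
  · have hl := (hinj.mono hB).leftInvOn_invFunOn
    have hL : LipschitzOnWith K (Function.invFunOn f B) (f '' B) := by
      refine LipschitzOnWith.of_dist_le_mul ?_
      rintro _ ⟨y, hy, rfl⟩ _ ⟨z, hz, rfl⟩
      rw [hl hy, hl hz]
      exact (h y (hB hy) z (hB hz)).2
    have := euclideanHausdorffMeasure_image_le_of_lipschitzOnWith hL d
    rwa [hl.image_image] at this

end Hausdorff

section Area

variable {X Y : Type*} [NormedAddCommGroup X] [InnerProductSpace ℝ X] [FiniteDimensional ℝ X]
  [NormedAddCommGroup Y] [InnerProductSpace ℝ Y]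

/-- An injective linear map is the composition of an automorphism and an isometry. -/
theorem exists_polar_decomposition {L : X →ₗ[ℝ] Y} (hL : Function.Injective L) :
    ∃ (T : X ≃ₗ[ℝ] X) (Q : X →ₗᵢ[ℝ] Y), (∀ u, L u = Q (T u)) ∧
      |LinearMap.det (T : X →ₗ[ℝ] X)| = L.normDet := by
  obtain ⟨bv⟩ := (L.normDet_ne_zero_tfae.out 4 3).1 hL
  let e : L.range ≃ₗᵢ[ℝ] X := bv.equiv (stdOrthonormalBasis ℝ X) (Equiv.refl _)
  let T : X ≃ₗ[ℝ] X := (LinearEquiv.ofInjective L hL).trans e.toLinearEquiv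
  let Q : X →ₗᵢ[ℝ] Y := L.range.subtypeₗᵢ.comp e.symm.toLinearIsometry
  have hQT : ∀ u, L u = Q (T u) := fun u => by simp [Q, T]
  refine ⟨T, Q, hQT, ?_⟩
  have h1 : L = Q.toLinearMap ∘ₗ (T : X →ₗ[ℝ] X) := LinearMap.ext hQT
  rw [h1, LinearMap.normDet_comp_of_finrank_eq _ _ rfl, LinearIsometry.normDet_eq_one, one_mul,
    LinearMap.normDet_eq_abs_det]

theorem continuous_normDet : Continuous fun L : X →L[ℝ] Y => (L : X →ₗ[ℝ] Y).normDet := by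
  let b := stdOrthonormalBasis ℝ X
  have h : ∀ L : X →L[ℝ] Y, (L : X →ₗ[ℝ] Y).normDet =
      √((Matrix.gram ℝ fun i => L (b i)).det) := by
    intro L
    have h1 := (L : X →ₗ[ℝ] Y).normDet_sq_eq_det_gram b
    rw [← Real.sqrt_sq (LinearMap.normDet_nonneg _)]
    exact congrArg _ h1
  simp_rw [h]
  refine Real.continuous_sqrt.comp (Continuous.matrix_det ?_)
  refine continuous_pi fun i => continuous_pi fun j => ?_
  simp only [Matrix.gram_apply]
  fun_prop

variable [MeasurableSpace X] [BorelSpace X] [MeasurableSpace Y] [BorelSpace Y]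

/-- The local form of the area formula, up to a factor close to one. -/
theorem exists_nhds_area_comparison {f : X → Y} {f' : X → X →L[ℝ] Y} {x : X} {s : Set X}
    (hf : HasStrictFDerivAt f (f' x) x) (hc : ContinuousWithinAt f' s x)
    (hi : Function.Injective (f' x)) {K : ℝ≥0} (hK : 1 < K) {d : ℕ} (hd : Module.finrank ℝ X = d) :
    ∃ V ∈ 𝓝[s] x, InjOn f V ∧ ∀ B, MeasurableSet B → B ⊆ V → B ⊆ s →
      (μHE[d] : Measure Y) (f '' B) ≤
        (K : ℝ≥0∞) ^ (d + 1) * ∫⁻ y in B, ENNReal.ofReal (f' y : X →ₗ[ℝ] Y).normDet ∧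
      ∫⁻ y in B, ENNReal.ofReal (f' y : X →ₗ[ℝ] Y).normDet ≤
        (K : ℝ≥0∞) ^ (d + 1) * (μHE[d] : Measure Y) (f '' B) := by
  obtain ⟨T, Q, hQT, hdet⟩ := exists_polar_decomposition (L := (f' x : X →ₗ[ℝ] Y)) hi
  set J : X → ℝ := fun y => (f' y : X →ₗ[ℝ] Y).normDet with hJ
  have hJx : 0 < J x := by
    rw [hJ]
    simp only
    rw [← hdet]
    exact abs_pos.2 (LinearEquiv.isUnit_det' T).ne_zero
  have hJc : ContinuousWithinAt J s x := continuous_normDet.continuousAt.comp_continuousWithinAt hc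
  let Tc : X ≃L[ℝ] X := T.toContinuousLinearEquiv
  -- In the coordinates `T y`, the derivative of `f` at `x` is isometric.
  have hg : HasStrictFDerivAt (f ∘ Tc.symm) ((f' x).comp (Tc.symm : X →L[ℝ] X)) (Tc x) := by
    refine HasStrictFDerivAt.comp (g := f) (f := Tc.symm) _ ?_ Tc.symm.hasStrictFDerivAt
    rwa [ContinuousLinearEquiv.symm_apply_apply]
  have hgi : ∀ u, ‖((f' x).comp (Tc.symm : X →L[ℝ] X)) u‖ = ‖u‖ := by
    intro u
    have := hQT (T.symm u)
    simp only [ContinuousLinearMap.coe_coe, LinearEquiv.apply_symm_apply] at this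
    simp only [ContinuousLinearMap.comp_apply]
    change ‖f' x (T.symm u)‖ = _
    rw [this, Q.norm_map]
  obtain ⟨V, hV, hVi, hVB⟩ := exists_nhds_hausdorff_comparison hg hgi hK d
  have hK' : (1 : ℝ) < K := by exact_mod_cast hK
  have h1 : ∀ᶠ y in 𝓝[s] x, J y ≤ K * J x := by
    refine (hJc.tendsto.eventually_lt_const ?_).mono fun y hy => hy.le
    nlinarith
  have h2 : ∀ᶠ y in 𝓝[s] x, J x ≤ K * J y := by
    refine ((hJc.tendsto.const_mul (K : ℝ)).eventually_const_lt ?_).mono fun y hy => hy.le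
    nlinarith
  have h3 : ∀ᶠ y in 𝓝[s] x, Tc y ∈ V :=
    nhdsWithin_le_nhds (Tc.continuous.continuousAt.preimage_mem_nhds hV)
  refine ⟨_, (h1.and (h2.and h3)), ?_, fun B hBm hBV hBs => ?_⟩
  · intro y hy z hz hyz
    have := hVi hy.2.2 hz.2.2 (by simpa using hyz)
    exact Tc.injective this
  · have himg : f '' B = (f ∘ Tc.symm) '' (Tc '' B) := by
      rw [image_comp]
      congr 1
      ext y
      simp
    obtain ⟨ha, hb⟩ := hVB (Tc '' B) (image_subset_iff.2 fun y hy => (hBV hy).2.2)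
    rw [← himg] at ha hb
    have hvol : (μHE[d] : Measure X) (Tc '' B) = ENNReal.ofReal (J x) * volume B := by
      rw [← hd, InnerProductSpace.euclideanHausdorffMeasure_eq_volume]
      have := Measure.addHaar_image_linearMap (volume : Measure X) (T : X →ₗ[ℝ] X) B
      rw [hdet] at this
      exact this
    rw [hvol] at ha hb
    have hcst : ENNReal.ofReal (J x) * volume B = ∫⁻ y in B, ENNReal.ofReal (J x) := by
      rw [setLIntegral_const]
    have hup : ENNReal.ofReal (J x) * volume B ≤ K * ∫⁻ y in B, ENNReal.ofReal (J y) := by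
      rw [hcst, ← lintegral_const_mul' _ _ ENNReal.coe_ne_top]
      refine setLIntegral_mono' hBm fun y hy => ?_
      rw [← ENNReal.ofReal_coe_nnreal, ← ENNReal.ofReal_mul (by positivity)]
      exact ENNReal.ofReal_le_ofReal (hBV hy).2.1
    have hdn : ∫⁻ y in B, ENNReal.ofReal (J y) ≤ K * (ENNReal.ofReal (J x) * volume B) := by
      rw [hcst, ← lintegral_const_mul' _ _ ENNReal.coe_ne_top]
      refine setLIntegral_mono' hBm fun y hy => ?_
      rw [← ENNReal.ofReal_coe_nnreal, ← ENNReal.ofReal_mul (by positivity)]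
      exact ENNReal.ofReal_le_ofReal (hBV hy).1
    constructor
    · calc _ ≤ _ := ha
        _ ≤ _ := mul_le_mul_right hup _
        _ = _ := by ring
    · calc _ ≤ _ := hdn
        _ ≤ _ := mul_le_mul_right hb _
        _ = _ := by ring

/-- The **area formula** for injective immersions and Hausdorff measure. -/
theorem euclideanHausdorffMeasure_image_eq_lintegral_normDet {f : X → Y} {f' : X → X →L[ℝ] Y}
    {s : Set X} (hs : MeasurableSet s) (hf : ∀ x ∈ s, HasStrictFDerivAt f (f' x) x)
    (hc : ContinuousOn f' s) (hi : ∀ x ∈ s, Function.Injective (f' x)) (hinj : InjOn f s)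
    {d : ℕ} (hd : Module.finrank ℝ X = d) :
    (μHE[d] : Measure Y) (f '' s) = ∫⁻ x in s, ENNReal.ofReal (f' x : X →ₗ[ℝ] Y).normDet := by
  have hfc : ContinuousOn f s := fun x hx => (hf x hx).continuousAt.continuousWithinAt
  have hA : IsAdditiveOn (fun t => (μHE[d] : Measure Y) (f '' t)) s :=
    IsAdditiveOn.image _ hfc hinj
  have hI : IsAdditiveOn (fun t => ∫⁻ x in t, ENNReal.ofReal (f' x : X →ₗ[ℝ] Y).normDet) s :=
    fun B hB hd _ => lintegral_iUnion hB hd _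
  have hmul : ∀ (c : ℝ≥0∞) (μ : Set X → ℝ≥0∞), IsAdditiveOn μ s →
      IsAdditiveOn (fun t => c * μ t) s := by
    intro c μ hμ B hB hd hBs
    simp only [hμ B hB hd hBs, ENNReal.tsum_mul_left]
  apply le_antisymm
  · refine le_of_forall_one_lt_le_pow_mul (d + 1) fun K hK => ?_
    refine le_of_locally_le hs hA (hmul _ _ hI) (by simp) fun x hx => ?_
    obtain ⟨V, hV, -, h⟩ := exists_nhds_area_comparison (hf x hx) (hc x hx) (hi x hx) hK hd
    exact ⟨V, hV, fun B hBm hBV hBs => (h B hBm hBV hBs).1⟩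
  · refine le_of_forall_one_lt_le_pow_mul (d + 1) fun K hK => ?_
    refine le_of_locally_le hs hI (hmul _ _ hA) (by simp) fun x hx => ?_
    obtain ⟨V, hV, -, h⟩ := exists_nhds_area_comparison (hf x hx) (hc x hx) (hi x hx) hK hd
    exact ⟨V, hV, fun B hBm hBV hBs => (h B hBm hBV hBs).2⟩

end Area

/-! ### The area formula with multiplicities -/

section Multiplicity

variable {X : Type*} [NormedAddCommGroup X] [NormedSpace ℝ X] [FiniteDimensional ℝ X]
  [MeasurableSpace X] [BorelSpace X]

theorem measurableSet_inter_preimage_of_continuousOn {X Z : Type*} [TopologicalSpace X]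
    [MeasurableSpace X] [OpensMeasurableSpace X] [TopologicalSpace Z] {f : X → Z} {s : Set X}
    (hs : MeasurableSet s) (hf : ContinuousOn f s) {F : Set Z} (hF : IsClosed F) :
    MeasurableSet (s ∩ f ⁻¹' F) := by
  obtain ⟨U, hU, hUs⟩ := continuousOn_iff_isClosed.1 hf F hF
  rw [inter_comm, hUs]
  exact hU.measurableSet.inter hs

theorem count_inter_preimage_singleton_of_injOn {X Z : Type*} [MeasurableSpace X]
    [MeasurableSingletonClass X] {f : X → Z} {s : Set X} (hf : InjOn f s) (z : Z) :
    Measure.count (s ∩ f ⁻¹' {z}) = (f '' s).indicator (fun _ => (1 : ℝ≥0∞)) z := by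
  by_cases hz : z ∈ f '' s
  · rw [indicator_of_mem hz]
    obtain ⟨x, hx, rfl⟩ := hz
    have : s ∩ f ⁻¹' {f x} = {x} := by
      ext y
      exact ⟨fun hy => hf hy.1 hx hy.2, fun hy => by rw [mem_singleton_iff.1 hy]; exact ⟨hx, rfl⟩⟩
    rw [this, Measure.count_singleton]
  · rw [indicator_of_notMem hz, Measure.count_eq_zero_iff]
    ext y
    simp only [mem_inter_iff, mem_preimage, mem_singleton_iff, mem_empty_iff_false, iff_false]
    rintro ⟨hy, rfl⟩
    exact hz ⟨y, hy, rfl⟩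

/-- The **area formula**, counting preimages with multiplicity. -/
theorem lintegral_count_preimage_eq_lintegral_abs_det (μ : Measure X) [μ.IsAddHaarMeasure]
    {f : X → X} {f' : X → X →L[ℝ] X} {s : Set X} (hs : MeasurableSet s)
    (hf : ∀ x ∈ s, HasStrictFDerivAt f (f' x) x) (hc : ContinuousOn f' s) :
    AEMeasurable (fun z => Measure.count (s ∩ f ⁻¹' {z})) μ ∧
    ∫⁻ z, Measure.count (s ∩ f ⁻¹' {z}) ∂μ = ∫⁻ x in s, ENNReal.ofReal |(f' x).det| ∂μ := by
  have hfw : ∀ t ⊆ s, ∀ x ∈ t, HasFDerivWithinAt f (f' x) t x :=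
    fun t ht x hx => (hf x (ht hx)).hasFDerivAt.hasFDerivWithinAt
  have hfc : ContinuousOn f s := fun x hx => (hf x hx).continuousAt.continuousWithinAt
  have hdc : ContinuousOn (fun x => (f' x).det) s :=
    ContinuousLinearMap.continuous_det.comp_continuousOn hc
  -- The critical values are negligible, and `f` is locally injective at the other points.
  let C : Set X := {x ∈ s | (f' x).det = 0}
  let R : Set X := {x ∈ s | (f' x).det ≠ 0}
  have hR : MeasurableSet R := by
    have : R = s \ (s ∩ (fun x => (f' x).det) ⁻¹' {0}) := by
      ext x
      simp only [R, mem_ofPred_eq, Set.mem_sdiff, mem_inter_iff, mem_preimage, mem_singleton_iff]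
      tauto
    rw [this]
    exact hs.diff (measurableSet_inter_preimage_of_continuousOn hs hdc isClosed_singleton)
  have hRs : R ⊆ s := fun x hx => hx.1
  have hCs : C ⊆ s := fun x hx => hx.1
  have hsCR : s = R ∪ C := by
    ext x; simp only [R, C, mem_union, mem_ofPred_eq]; tauto
  have hC : MeasurableSet C := by
    have : C = s \ R := by
      ext x; simp only [R, C, Set.mem_sdiff, mem_ofPred_eq]; tauto
    rw [this]
    exact hs.diff hR
  have hCnull : μ (f '' C) = 0 :=
    addHaar_image_eq_zero_of_det_fderivWithin_eq_zero μ (hfw C hCs) fun x hx => hx.2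
  have hV : ∀ x ∈ R, ∃ V ∈ 𝓝[R] x, InjOn f V := by
    intro x hx
    have hx' : HasStrictFDerivAt f
        ((f' x).toContinuousLinearEquivOfDetNeZero hx.2 : X →L[ℝ] X) x := by
      rw [ContinuousLinearMap.coe_toContinuousLinearEquivOfDetNeZero]
      exact hf x hx.1
    refine ⟨(hx'.toOpenPartialHomeomorph f).source, mem_nhdsWithin_of_mem_nhds
      ((hx'.toOpenPartialHomeomorph f).open_source.mem_nhds hx'.mem_toOpenPartialHomeomorph_source),
      (hx'.toOpenPartialHomeomorph f).injOn⟩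
  choose! V hV hVi using hV
  obtain ⟨B, hBm, hBd, hBR, hB⟩ := exists_measurable_partition hR hV
  have hBsub : ∀ i, B i ⊆ R := fun i => hBR ▸ subset_iUnion B i
  have hBi : ∀ i, InjOn f (B i) := by
    intro i
    rcases hB i with h | ⟨x, hx, h⟩
    · rw [h]; exact injOn_empty f
    · exact (hVi x hx).mono h
  have hBim : ∀ i, MeasurableSet (f '' B i) := fun i =>
    measurable_image_of_fderivWithin (hBm i) (hfw _ ((hBsub i).trans hRs)) (hBi i)
  have hfib : ∀ t ⊆ s, MeasurableSet t → ∀ z, MeasurableSet (t ∩ f ⁻¹' {z}) := by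
    intro t ht htm z
    exact measurableSet_inter_preimage_of_continuousOn htm (hfc.mono ht) isClosed_singleton
  have hae : ∀ᵐ z ∂μ, Measure.count (s ∩ f ⁻¹' {z}) =
      ∑' i, (f '' B i).indicator (fun _ => (1 : ℝ≥0∞)) z := by
    filter_upwards [measure_eq_zero_iff_ae_notMem.1 hCnull] with z hz
    have h1 : s ∩ f ⁻¹' {z} = ⋃ i, (B i ∩ f ⁻¹' {z}) := by
      rw [← iUnion_inter, hBR, hsCR, union_inter_distrib_right]
      refine union_eq_left.2 ?_
      rintro x ⟨hx, hxz⟩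
      exact absurd ⟨x, hx, hxz⟩ hz
    rw [h1, measure_iUnion]
    · exact tsum_congr fun i => count_inter_preimage_singleton_of_injOn (hBi i) z
    · exact fun i j hij => (hBd hij).mono inter_subset_left inter_subset_left
    · exact fun i => hfib _ ((hBsub i).trans hRs) (hBm i) z
  have hmeas : ∀ i, Measurable ((f '' B i).indicator (fun _ => (1 : ℝ≥0∞))) :=
    fun i => measurable_const.indicator (hBim i)
  refine ⟨⟨_, Measurable.tsum hmeas, hae⟩, ?_⟩
  rw [lintegral_congr_ae hae, lintegral_tsum fun i => (hmeas i).aemeasurable]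
  have h2 : ∀ i, ∫⁻ z, (f '' B i).indicator (fun _ => (1 : ℝ≥0∞)) z ∂μ =
      ∫⁻ x in B i, ENNReal.ofReal |(f' x).det| ∂μ := by
    intro i
    rw [lintegral_indicator (hBim i), setLIntegral_const, one_mul,
      lintegral_abs_det_fderiv_eq_addHaar_image μ (hBm i) (hfw _ ((hBsub i).trans hRs)) (hBi i)]
  rw [tsum_congr h2, ← lintegral_iUnion hBm hBd, hBR, hsCR, lintegral_union hC]
  · rw [setLIntegral_congr_fun (g := fun _ => 0) hC fun x hx => by simp [hx.2]]
    simp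
  · exact Set.disjoint_left.2 fun x hx hx' => hx.2 hx'.2

end Multiplicity

/-! ### Tuples of vectors as linear maps -/

section Tuples

variable {k m : ℕ}

/-- The linear map `ℝᵏ → V` whose columns are the vectors `G j`. -/
def lin {V : Type*} [NormedAddCommGroup V] [NormedSpace ℝ V] (G : Fin k → V) : E k →L[ℝ] V :=
  ∑ j, (EuclideanSpace.proj j : E k →L[ℝ] ℝ).smulRight (G j)

theorem lin_apply {V : Type*} [NormedAddCommGroup V] [NormedSpace ℝ V] (G : Fin k → V) (u : E k) :
    lin G u = ∑ j, u j • G j := by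
  simp [lin]

/-- The linear map `x ↦ (⟪G j, x⟫)ⱼ`, the adjoint of `lin G`. -/
def coef {V : Type*} [NormedAddCommGroup V] [InnerProductSpace ℝ V] (G : Fin k → V) :
    V →L[ℝ] E k :=
  (PiLp.continuousLinearEquiv 2 ℝ (fun _ : Fin k => ℝ)).symm.toContinuousLinearMap ∘L
    ContinuousLinearMap.pi fun j => innerSL ℝ (G j)

@[simp] theorem coef_apply {V : Type*} [NormedAddCommGroup V] [InnerProductSpace ℝ V]
    (G : Fin k → V) (x : V) (j : Fin k) : coef G x j = inner ℝ (G j) x := rfl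

theorem inner_coef_left {V : Type*} [NormedAddCommGroup V] [InnerProductSpace ℝ V]
    (G : Fin k → V) (x : V) (u : E k) : inner ℝ (coef G x) u = inner ℝ x (lin G u) := by
  rw [lin_apply, inner_sum, PiLp.inner_apply]
  refine Finset.sum_congr rfl fun j _ => ?_
  rw [inner_smul_right, coef_apply, real_inner_comm x]
  simp

theorem adjoint_lin {V : Type*} [NormedAddCommGroup V] [InnerProductSpace ℝ V] [CompleteSpace V]
    (G : Fin k → V) : ContinuousLinearMap.adjoint (lin G) = coef G :=
  ((ContinuousLinearMap.eq_adjoint_iff _ _).2 fun x u => inner_coef_left G x u).symm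

theorem det_adjoint_real {d : ℕ} (T : E d →ₗ[ℝ] E d) :
    LinearMap.det (LinearMap.adjoint T) = LinearMap.det T := by
  let b := stdOrthonormalBasis ℝ (E d)
  rw [← LinearMap.det_toMatrix b.toBasis, ← LinearMap.det_toMatrix b.toBasis,
    LinearMap.toMatrix_adjoint b b T, Matrix.det_conjTranspose, star_trivial]

theorem det_coef (X : Fin k → E k) : (coef X).det = (lin X).det := by
  rw [← adjoint_lin]
  exact det_adjoint_real (lin X : E k →ₗ[ℝ] E k)

/-- The tuple whose columns are the images of the columns of `X` under `lin G`: the product of the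
matrices with columns `G` and `X`. -/
def mix {V : Type*} [NormedAddCommGroup V] [NormedSpace ℝ V] (G : Fin k → V) (X : Fin k → E k) :
    Fin k → V := fun j => lin G (X j)

theorem lin_mix {V : Type*} [NormedAddCommGroup V] [NormedSpace ℝ V] (G : Fin k → V)
    (X : Fin k → E k) : lin (mix G X) = lin G ∘L lin X := by
  ext1 u
  simp [lin_apply (mix G X), lin_apply X, mix]

theorem coef_mix {V : Type*} [NormedAddCommGroup V] [InnerProductSpace ℝ V] [CompleteSpace V]
    (G : Fin k → V) (X : Fin k → E k) : coef (mix G X) = coef X ∘L coef G := by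
  rw [← adjoint_lin, lin_mix, ContinuousLinearMap.adjoint_comp, adjoint_lin, adjoint_lin]

/-- `mix` as a linear map of its first argument. -/
def mixMap (V : Type*) [NormedAddCommGroup V] [NormedSpace ℝ V] (X : Fin k → E k) :
    (Fin k → V) →ₗ[ℝ] (Fin k → V) where
  toFun G := mix G X
  map_add' G H := by
    ext1 j; simp [mix, lin_apply, Finset.sum_add_distrib]
  map_smul' c G := by
    ext1 j; simp [mix, lin_apply, Finset.smul_sum, smul_comm c]

/-- Transposition of rectangular matrices. -/
def transposeEquiv (k m : ℕ) : (Fin k → E m) ≃ₗ[ℝ] (Fin m → E k) where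
  toFun A i := WithLp.toLp 2 fun j => A j i
  invFun B j := WithLp.toLp 2 fun i => B i j
  map_add' _ _ := rfl
  map_smul' _ _ := rfl
  left_inv _ := rfl
  right_inv _ := rfl

/-- In the transposed coordinates, `mixMap` acts as `coef X` on each of the `m` rows. -/
theorem det_mixMap (X : Fin k → E k) : LinearMap.det (mixMap (E m) X) = (lin X).det ^ m := by
  rw [← LinearMap.det_conj _ (transposeEquiv k m)]
  have h : ((transposeEquiv k m : (Fin k → E m) →ₗ[ℝ] (Fin m → E k)) ∘ₗ mixMap (E m) X) ∘ₗ
      ((transposeEquiv k m).symm : (Fin m → E k) →ₗ[ℝ] (Fin k → E m)) =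
      LinearMap.pi fun i => (coef X : E k →ₗ[ℝ] E k) ∘ₗ LinearMap.proj i := by
    refine LinearMap.ext fun B => funext fun i => PiLp.ext fun j => ?_
    change (mix ((transposeEquiv k m).symm B) X j) i = inner ℝ (X j) (B i)
    simp [mix, lin_apply, transposeEquiv, PiLp.inner_apply, mul_comm]
  rw [← LinearMap.comp_assoc, h, LinearMap.det_pi]
  rw [← det_coef]
  simp [ContinuousLinearMap.det]

theorem lintegral_comp_linearEquiv {V : Type*} [NormedAddCommGroup V] [NormedSpace ℝ V]
    [FiniteDimensional ℝ V] [MeasurableSpace V] [BorelSpace V] (μ : Measure V)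
    [μ.IsAddHaarMeasure] (T : V →ₗ[ℝ] V) (hT : LinearMap.det T ≠ 0) (f : V → ℝ≥0∞) :
    ∫⁻ x, f x ∂μ = ENNReal.ofReal |LinearMap.det T| * ∫⁻ x, f (T x) ∂μ := by
  let e := (T.equivOfDetNeZero hT).toContinuousLinearEquiv
  have he : ∀ x, e x = T x := fun x => rfl
  have h1 : ∫⁻ x, f (T x) ∂μ = ∫⁻ x, f x ∂(μ.map T) := by
    have := e.toHomeomorph.measurableEmbedding.lintegral_map (μ := μ) f
    exact this.symm
  rw [h1, Measure.map_linearMap_addHaar_eq_smul_addHaar μ hT, lintegral_smul_measure, smul_eq_mul,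
    ← mul_assoc, ← ENNReal.ofReal_mul (abs_nonneg _), ← abs_mul, mul_inv_cancel₀ hT]
  simp

theorem lintegral_mix (X : Fin k → E k) (hX : (lin X).det ≠ 0) (f : (Fin k → E m) → ℝ≥0∞) :
    ∫⁻ Y, f Y = ENNReal.ofReal |(lin X).det| ^ m * ∫⁻ A, f (mix A X) := by
  have h := det_mixMap (m := m) X
  rw [lintegral_comp_linearEquiv volume (mixMap (E m) X) (by rw [h]; exact pow_ne_zero _ hX), h,
    abs_pow, ENNReal.ofReal_pow (abs_nonneg _)]
  rfl

theorem lintegral_comp_columns (T : E k →ₗ[ℝ] E k) (hT : LinearMap.det T ≠ 0)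
    (f : (Fin k → E k) → ℝ≥0∞) :
    ∫⁻ X, f X = ENNReal.ofReal |LinearMap.det T| ^ k * ∫⁻ X : Fin k → E k, f fun j => T (X j) := by
  have h : LinearMap.det (LinearMap.pi fun i : Fin k => T ∘ₗ LinearMap.proj i) =
      LinearMap.det T ^ k := by
    rw [LinearMap.det_pi]; simp
  rw [lintegral_comp_linearEquiv volume (LinearMap.pi fun i : Fin k => T ∘ₗ LinearMap.proj i)
    (by rw [h]; exact pow_ne_zero _ hT), h, abs_pow, ENNReal.ofReal_pow (abs_nonneg _)]
  rfl

end Tuples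

/-! ### Splitting off the first coordinates -/

section Split

variable {k m : ℕ}

/-- The isometry of `ℝᵏ⁺ᵐ` with the Euclidean product of `ℝᵏ` and `ℝᵐ`. -/
def splitE (k m : ℕ) : E (k + m) ≃ₗᵢ[ℝ] WithLp 2 (E k × E m) :=
  (LinearIsometryEquiv.piLpCongrLeft 2 ℝ ℝ finSumFinEquiv.symm).trans
    (PiLp.sumPiLpEquivProdLpPiLp 2 _)

/-- The vector of `ℝᵏ⁺ᵐ` with the given first and last coordinates. -/
def join (p : E k × E m) : E (k + m) := (splitE k m).symm (WithLp.toLp 2 p)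

theorem join_add (p q : E k × E m) : join (p + q) = join p + join q := by
  simp [join]

theorem join_sub (p q : E k × E m) : join (p - q) = join p - join q := by
  simp [join]

theorem inner_join (p q : E k × E m) :
    inner ℝ (join p) (join q) = inner ℝ p.1 q.1 + inner ℝ p.2 q.2 := by
  simp [join]

theorem norm_join_sq (p : E k × E m) : ‖join p‖ ^ 2 = ‖p.1‖ ^ 2 + ‖p.2‖ ^ 2 := by
  rw [← real_inner_self_eq_norm_sq, inner_join, real_inner_self_eq_norm_sq,
    real_inner_self_eq_norm_sq]

/-- `join` as a continuous linear equivalence. -/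
def joinL (k m : ℕ) : (E k × E m) ≃L[ℝ] E (k + m) :=
  (WithLp.prodContinuousLinearEquiv 2 ℝ (E k) (E m)).symm.trans
    (splitE k m).symm.toContinuousLinearEquiv

@[simp] theorem joinL_apply (p : E k × E m) : joinL k m p = join p := rfl

theorem continuous_join : Continuous (join : E k × E m → E (k + m)) := (joinL k m).continuous

theorem measurePreserving_join : MeasurePreserving (join : E k × E m → E (k + m)) :=
  (splitE k m).symm.measurePreserving.comp (WithLp.volume_preserving_toLp _ _)

theorem measurableEmbedding_join : MeasurableEmbedding (join : E k × E m → E (k + m)) :=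
  (joinL k m).toHomeomorph.measurableEmbedding

theorem join_apply_castAdd (p : E k × E m) (i : Fin k) : join p (Fin.castAdd m i) = p.1 i := by
  simp [join, splitE]

theorem join_apply_natAdd (p : E k × E m) (i : Fin m) : join p (Fin.natAdd k i) = p.2 i := by
  simp [join, splitE]

/-- A pair of tuples, joined columnwise. -/
def joinTuple (p : (Fin k → E k) × (Fin k → E m)) : Fin k → E (k + m) :=
  fun j => join (p.1 j, p.2 j)

theorem lintegral_joinTuple (f : (Fin k → E (k + m)) → ℝ≥0∞) (hf : Measurable f) :
    ∫⁻ G, f G = ∫⁻ X : Fin k → E k, ∫⁻ Y : Fin k → E m, f (joinTuple (X, Y)) := by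
  have h1 := volume_preserving_pi (fun _ : Fin k => measurePreserving_join (k := k) (m := m))
  have h2 := (volume_measurePreserving_arrowProdEquivProdArrow (E k) (E m) (Fin k)).symm
  have h3 := h1.comp h2
  rw [← h3.lintegral_comp hf]
  exact lintegral_prod _ ((hf.comp h3.measurable).aemeasurable)

end Split

/-! ### Integration over frames in affine coordinates of the Grassmannian -/

section Frames

variable {k m : ℕ}

/-- The standard basis of `ℝᵏ`. -/
def stdTuple (k : ℕ) : Fin k → E k := fun j => EuclideanSpace.single j 1

theorem lin_stdTuple (u : E k) : lin (stdTuple k) u = u := by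
  ext i
  simp [lin_apply, stdTuple, Pi.single_apply]

/-- The basis `(e_j, A_j)` of the graph of the linear map with columns `A j`. -/
def graph (A : Fin k → E m) : Fin k → E (k + m) := joinTuple (stdTuple k, A)

theorem lin_joinTuple (X : Fin k → E k) (Y : Fin k → E m) (u : E k) :
    lin (joinTuple (X, Y)) u = join (lin X u, lin Y u) := by
  simp only [lin_apply, joinTuple, ← joinL_apply, ← map_smul, ← map_sum]
  congr 1
  ext1 <;> simp [Prod.fst_sum, Prod.snd_sum]

theorem lin_graph (A : Fin k → E m) (u : E k) : lin (graph A) u = join (u, lin A u) := by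
  rw [graph, lin_joinTuple, lin_stdTuple]

theorem mix_graph (A : Fin k → E m) (X : Fin k → E k) :
    mix (graph A) X = joinTuple (X, mix A X) := by
  ext1 j
  simp [mix, lin_graph, joinTuple]

theorem lin_graph_injective (A : Fin k → E m) : Function.Injective (lin (graph A)) := by
  intro u v h
  rw [lin_graph, lin_graph, ← joinL_apply, ← joinL_apply] at h
  exact congrArg Prod.fst ((joinL k m).injective h)

/-- The factor `√det (1 + Aᵀ A)` by which the parametrization of the graph of `A` multiplies
volumes. -/
def nd (A : Fin k → E m) : ℝ := (lin (graph A) : E k →ₗ[ℝ] E (k + m)).normDet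

theorem continuous_lin {V : Type*} [NormedAddCommGroup V] [NormedSpace ℝ V] :
    Continuous (lin : (Fin k → V) → E k →L[ℝ] V) := by
  unfold lin
  refine continuous_finsetSum _ fun j _ => ?_
  exact ((ContinuousLinearMap.smulRightL ℝ (E k) V (EuclideanSpace.proj j)).continuous).comp
    (continuous_apply j)

theorem continuous_joinTuple :
    Continuous (joinTuple : (Fin k → E k) × (Fin k → E m) → Fin k → E (k + m)) :=
  continuous_pi fun j => continuous_join.comp (by fun_prop)

theorem continuous_graph : Continuous (graph : (Fin k → E m) → Fin k → E (k + m)) :=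
  continuous_joinTuple.comp (by fun_prop)

theorem continuous_nd : Continuous (nd : (Fin k → E m) → ℝ) :=
  continuous_normDet.comp (continuous_lin.comp continuous_graph)

theorem continuous_mix {V : Type*} [NormedAddCommGroup V] [NormedSpace ℝ V] :
    Continuous fun p : (Fin k → V) × (Fin k → E k) => mix p.1 p.2 := by
  refine continuous_pi fun j => ?_
  simp only [mix, lin_apply]
  fun_prop

theorem continuous_det_lin : Continuous fun X : Fin k → E k => (lin X).det :=
  ContinuousLinearMap.continuous_det.comp continuous_lin

theorem nd_pos (A : Fin k → E m) : 0 < nd A := by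
  refine lt_of_le_of_ne (LinearMap.normDet_nonneg _) (Ne.symm ?_)
  exact ((lin (graph A) : E k →ₗ[ℝ] E (k + m)).normDet_ne_zero_tfae.out 4 0).1
    (lin_graph_injective A)

/-- On each line in the direction of the identity matrix, the determinant has finitely many zeros.
They are the negatives of eigenvalues. -/
theorem ae_det_lin_ne_zero : ∀ᵐ X : Fin k → E k, (lin X).det ≠ 0 := by
  have hs : MeasurableSet {X : Fin k → E k | (lin X).det ≠ 0} :=
    (isOpen_compl_singleton.preimage continuous_det_lin).measurableSet
  refine ae_mem_of_ae_add_linearMap_mem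
    ((LinearMap.id : ℝ →ₗ[ℝ] ℝ).smulRight (stdTuple k)) volume volume hs fun Y => ?_
  have hfin : {t : ℝ | Module.End.HasEigenvalue (lin Y : E k →ₗ[ℝ] E k) (-t)}.Finite :=
    (Module.End.finite_hasEigenvalue (lin Y : E k →ₗ[ℝ] E k)).preimage neg_injective.injOn
  filter_upwards [hfin.countable.ae_notMem volume] with t ht h0
  refine ht ?_
  have hlin : (lin (Y + t • stdTuple k) : E k →ₗ[ℝ] E k) =
      (lin Y : E k →ₗ[ℝ] E k) - -t • 1 := by
    refine LinearMap.ext fun u => ?_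
    have h1 : lin (Y + t • stdTuple k) u = lin Y u + t • lin (stdTuple k) u := by
      simp [lin_apply, Finset.sum_add_distrib, Finset.smul_sum, smul_comm t]
    simp [h1, lin_stdTuple]
  rw [Module.End.hasEigenvalue_iff, Module.End.eigenspace_def]
  rw [← hlin]
  have h0' : LinearMap.det (lin (Y + t • stdTuple k) : E k →ₗ[ℝ] E k) = 0 := by
    simpa [ContinuousLinearMap.det] using h0
  exact (LinearMap.det_eq_zero_iff_ker_ne_bot).1 h0'

/-- The set of tuples of vectors of length at most one. It is invariant under isometries acting on
all the vectors. -/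
def ballTuples {V : Type*} [NormedAddCommGroup V] : Set (Fin k → V) := {G | ∀ j, ‖G j‖ ≤ 1}

theorem isClosed_ballTuples {V : Type*} [NormedAddCommGroup V] :
    IsClosed (ballTuples : Set (Fin k → V)) := by
  simp only [ballTuples, ofPred_forall]
  exact isClosed_iInter fun j => isClosed_le (by fun_prop) continuous_const

/-- The constant of proportionality in `lintegral_ballTuples`. -/
def frameConst (k s : ℕ) : ℝ≥0∞ :=
  ∫⁻ X in (ballTuples : Set (Fin k → E k)), ENNReal.ofReal |(lin X).det| ^ s

theorem isCompact_ballTuples {d : ℕ} : IsCompact (ballTuples : Set (Fin k → E d)) := by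
  refine Metric.isCompact_of_isClosed_isBounded isClosed_ballTuples
    ((Metric.isBounded_closedBall (x := (0 : Fin k → E d)) (r := 1)).subset fun G hG => ?_)
  rw [mem_closedBall_zero_iff, pi_norm_le_iff_of_nonneg zero_le_one]
  exact hG

theorem frameConst_ne_top (k s : ℕ) : frameConst k s ≠ ⊤ := by
  obtain ⟨C, hC⟩ := isCompact_ballTuples.exists_bound_of_continuousOn
    (f := fun X : Fin k → E k => (lin X).det) continuous_det_lin.continuousOn
  refine ne_top_of_le_ne_top ?_ (setLIntegral_mono' (g := fun _ => ENNReal.ofReal C ^ s)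
    isClosed_ballTuples.measurableSet fun X hX => ?_)
  · rw [setLIntegral_const]
    exact ENNReal.mul_ne_top (by simp) isCompact_ballTuples.measure_lt_top.ne
  · gcongr
    exact hC X hX

theorem frameConst_ne_zero (k s : ℕ) : frameConst k s ≠ 0 := by
  have hpos : 0 < volume (ballTuples : Set (Fin k → E k)) := by
    refine (Metric.measure_ball_pos volume 0 one_pos).trans_le (measure_mono fun G hG j => ?_)
    exact (norm_le_pi_norm G j).trans (mem_ball_zero_iff.1 hG).le
  rw [frameConst, ← pos_iff_ne_zero, setLIntegral_pos_iff]
  · refine hpos.trans_le (measure_mono_ae ?_)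
    filter_upwards [ae_det_lin_ne_zero] with X hX hXb
    refine ⟨?_, hXb⟩
    simp [hX]
  · exact (continuous_det_lin.measurable.abs.ennreal_ofReal).pow_const _

theorem measurableSet_ballTuples {d : ℕ} :
    MeasurableSet (ballTuples : Set (Fin k → E d)) := isClosed_ballTuples.measurableSet

/-- The weight of `X` in the integral over all frames `mix (graph A) X`. -/
def frameWeight (p : ℕ) (X : Fin k → E k) (A : Fin k → E m) : ℝ≥0∞ :=
  ENNReal.ofReal |(lin X).det| ^ p *
    (ballTuples : Set (Fin k → E (k + m))).indicator (fun _ => 1) (mix (graph A) X)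

theorem measurable_frameWeight (p : ℕ) :
    Measurable fun q : (Fin k → E k) × (Fin k → E m) => frameWeight p q.1 q.2 := by
  have ha : Measurable fun p : (Fin k → E k) × (Fin k → E m) => mix (graph p.2) p.1 :=
    (continuous_mix.comp ((continuous_graph.comp continuous_snd).prodMk
      continuous_fst)).measurable
  have hb : Measurable fun p : (Fin k → E k) × (Fin k → E m) => (lin p.1).det :=
    (continuous_det_lin.comp continuous_fst).measurable
  have hd : Measurable ((ballTuples : Set (Fin k → E (k + m))).indicator
      fun _ => (1 : ℝ≥0∞)) := measurable_const.indicator measurableSet_ballTuples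
  exact (hb.abs.ennreal_ofReal.pow_const _).mul (hd.comp ha)

theorem measurable_frameWeight_left (p : ℕ) (A : Fin k → E m) :
    Measurable fun X : Fin k → E k => frameWeight p X A := by
  have ha : Measurable fun X : Fin k → E k => mix (graph A) X :=
    (continuous_mix.comp (continuous_const.prodMk continuous_id)).measurable
  have hd : Measurable ((ballTuples : Set (Fin k → E (k + m))).indicator
      fun _ => (1 : ℝ≥0∞)) := measurable_const.indicator measurableSet_ballTuples
  exact (continuous_det_lin.measurable.abs.ennreal_ofReal.pow_const _).mul (hd.comp ha)

/-- Up to an isometry, the frame `mix (graph A) X` is obtained from `X` by a linear map of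
determinant `± nd A`, which the substitution in the integral removes. -/
theorem lintegral_frameWeight (A : Fin k → E m) (p : ℕ) :
    ∫⁻ X : Fin k → E k, frameWeight p X A =
      frameConst k p * ENNReal.ofReal (nd A)⁻¹ ^ (k + p) := by
  obtain ⟨T, Q, hQT, hdet⟩ := exists_polar_decomposition
    (L := (lin (graph A) : E k →ₗ[ℝ] E (k + m))) (lin_graph_injective A)
  have hT0 : LinearMap.det (T : E k →ₗ[ℝ] E k) ≠ 0 := (LinearEquiv.isUnit_det' T).ne_zero
  have hpos := nd_pos A
  change _ = nd A at hdet
  have hmem : ∀ X : Fin k → E k, mix (graph A) X ∈ (ballTuples : Set (Fin k → E (k + m))) ↔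
      (fun j => T (X j)) ∈ (ballTuples : Set (Fin k → E k)) := by
    intro X
    refine forall_congr' fun j => ?_
    have := hQT (X j)
    simp only [ContinuousLinearMap.coe_coe] at this
    rw [mix, this, Q.norm_map]
  have hdetT : ∀ X : Fin k → E k, (lin fun j => T (X j)).det =
      LinearMap.det (T : E k →ₗ[ℝ] E k) * (lin X).det := by
    intro X
    have : (lin fun j => T (X j) : E k →ₗ[ℝ] E k) = (T : E k →ₗ[ℝ] E k) ∘ₗ (lin X) := by
      refine LinearMap.ext fun u => ?_
      simp [lin_apply]
    rw [ContinuousLinearMap.det, this, LinearMap.det_comp]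
  have hC : frameConst k p = ENNReal.ofReal (nd A) ^ (k + p) *
      ∫⁻ X : Fin k → E k, ENNReal.ofReal |(lin X).det| ^ p *
        ballTuples.indicator (fun _ => 1) (mix (graph A) X) := by
    rw [frameConst, ← lintegral_indicator measurableSet_ballTuples, lintegral_comp_columns _ hT0,
      hdet, pow_add, mul_assoc]
    congr 1
    rw [← lintegral_const_mul' _ _ (by simp)]
    refine lintegral_congr fun X => ?_
    simp only [LinearEquiv.coe_coe]
    by_cases hb : mix (graph A) X ∈ ballTuples
    · rw [indicator_of_mem hb, indicator_of_mem ((hmem X).1 hb)]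
      rw [hdetT, abs_mul, hdet, ENNReal.ofReal_mul hpos.le, mul_pow, mul_one]
    · rw [indicator_of_notMem hb, indicator_of_notMem fun h => hb ((hmem X).2 h)]
      simp
  simp only [frameWeight]
  rw [hC, ENNReal.ofReal_inv_of_pos hpos, ← ENNReal.inv_pow, mul_right_comm,
    ENNReal.mul_inv_cancel (pow_ne_zero _ (by simpa using hpos)) (by simp), one_mul]

/-- Integration over all tuples `G = (X, Y)` of vectors of length at most one, in the coordinates
`X` and `A = Y X⁻¹`: for a homogeneous integrand, the `X`-integral separates. Since the left-hand
side is invariant under isometries, so is the right-hand side. -/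
theorem lintegral_ballTuples (s : ℕ) (F : (Fin k → E (k + m)) → ℝ≥0∞) (hF : Measurable F)
    (hhom : ∀ G X, (lin X).det ≠ 0 → F (mix G X) = ENNReal.ofReal |(lin X).det| ^ s * F G) :
    ∫⁻ G in ballTuples, F G =
      frameConst k (m + s) * ∫⁻ A : Fin k → E m,
        F (graph A) * ENNReal.ofReal (nd A)⁻¹ ^ (k + (m + s)) := by
  rw [← lintegral_indicator measurableSet_ballTuples,
    lintegral_joinTuple _ (hF.indicator measurableSet_ballTuples)]
  let w : (Fin k → E k) → (Fin k → E m) → ℝ≥0∞ := frameWeight (m + s)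
  have h1 : ∀ᵐ X : Fin k → E k, ∫⁻ Y : Fin k → E m, ballTuples.indicator F (joinTuple (X, Y)) =
      ∫⁻ A : Fin k → E m, F (graph A) * w X A := by
    filter_upwards [ae_det_lin_ne_zero] with X hX
    rw [lintegral_mix X hX, ← lintegral_const_mul' _ _ (by simp)]
    refine lintegral_congr fun A => ?_
    simp only [w, frameWeight]
    rw [← mix_graph]
    by_cases hb : mix (graph A) X ∈ ballTuples
    · rw [indicator_of_mem hb, indicator_of_mem hb, hhom _ _ hX]
      ring
    · rw [indicator_of_notMem hb, indicator_of_notMem hb]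
      simp
  have hmeas : Measurable fun p : (Fin k → E k) × (Fin k → E m) => F (graph p.2) * w p.1 p.2 :=
    ((hF.comp (continuous_graph (k := k) (m := m)).measurable).comp measurable_snd).mul
      (measurable_frameWeight (m + s))
  calc ∫⁻ X : Fin k → E k, ∫⁻ Y : Fin k → E m, ballTuples.indicator F (joinTuple (X, Y))
      = ∫⁻ X : Fin k → E k, ∫⁻ A : Fin k → E m, F (graph A) * w X A := lintegral_congr_ae h1
    _ = ∫⁻ A : Fin k → E m, ∫⁻ X : Fin k → E k, F (graph A) * w X A :=
        lintegral_lintegral_swap hmeas.aemeasurable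
    _ = ∫⁻ A : Fin k → E m, frameConst k (m + s) *
          (F (graph A) * ENNReal.ofReal (nd A)⁻¹ ^ (k + (m + s))) := by
        refine lintegral_congr fun A => ?_
        have hA : Measurable fun X => w X A := measurable_frameWeight_left (m + s) A
        rw [lintegral_const_mul _ hA, lintegral_frameWeight, mul_left_comm]
    _ = _ := lintegral_const_mul' _ _ (frameConst_ne_top _ _)

/-- The integral over the affine chart of the Grassmannian which gives the constant of the
integral-geometric formula. -/
def chartConst (k m : ℕ) : ℝ≥0∞ :=
  ∫⁻ A : Fin k → E m, ENNReal.ofReal (nd A)⁻¹ ^ (k + (m + 1))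

/-- The standard inclusion of `ℝᵏ` into `ℝᵏ⁺ᵐ`. -/
def stdIncl (k m : ℕ) : E k →ₗᵢ[ℝ] E (k + m) :=
  ⟨(lin (graph (0 : Fin k → E m)) : E k →ₗ[ℝ] E (k + m)), fun u => by
    have h1 : lin (0 : Fin k → E m) u = 0 := by simp [lin_apply]
    have h2 := norm_join_sq (u, (0 : E m))
    rw [← sq_eq_sq₀ (norm_nonneg _) (norm_nonneg _)]
    simp only [ContinuousLinearMap.coe_coe]
    rw [lin_graph, h1, h2]
    simp⟩

theorem stdIncl_apply (u : E k) : stdIncl k m u = lin (graph (0 : Fin k → E m)) u := rfl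

theorem stdIncl_eq_join (u : E k) : stdIncl k m u = join (u, 0) := by
  have h1 : lin (0 : Fin k → E m) u = 0 := by simp [lin_apply]
  rw [stdIncl_apply, lin_graph, h1]

/-- Up to a change of coordinates in its domain, every injective linear map is the composition of
the standard inclusion with an isometry. -/
theorem exists_isometry_comp_stdIncl {L : E k →ₗ[ℝ] E (k + m)} (hL : Function.Injective L) :
    ∃ (R : E (k + m) ≃ₗᵢ[ℝ] E (k + m)) (T : E k ≃ₗ[ℝ] E k),
      (∀ u, L u = R (stdIncl k m (T u))) ∧ |LinearMap.det (T : E k →ₗ[ℝ] E k)| = L.normDet := by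
  obtain ⟨T, Q, hQT, hdet⟩ := exists_polar_decomposition hL
  let e := (stdIncl k m).equivRange
  let R' := (Q.comp e.symm.toLinearIsometry).extend
  refine ⟨R'.toLinearIsometryEquiv rfl, T, fun u => ?_, hdet⟩
  have h1 := LinearIsometry.extend_apply (Q.comp e.symm.toLinearIsometry) (e (T u))
  have h2 : R' (stdIncl k m (T u)) = Q (T u) := by simpa [R', e] using h1
  rw [hQT]
  exact h2.symm

/-- The average over all planes of the volume of a projection does not depend on the plane
containing the projected set. -/
theorem lintegral_abs_det_coef_graph (L : E k →L[ℝ] E (k + m)) (hL : Function.Injective L) :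
    ∫⁻ A : Fin k → E m, ENNReal.ofReal |(coef (graph A) ∘L L).det| *
        ENNReal.ofReal (nd A)⁻¹ ^ (k + (m + 1)) =
      chartConst k m * ENNReal.ofReal (L : E k →ₗ[ℝ] E (k + m)).normDet := by
  have hcont : ∀ L : E k →L[ℝ] E (k + m), Measurable fun G : Fin k → E (k + m) =>
      ENNReal.ofReal |(coef G ∘L L).det| := by
    intro L
    have h1 : Continuous fun G : Fin k → E (k + m) => coef G ∘L L := by
      simp_rw [← adjoint_lin]
      exact ((ContinuousLinearMap.adjoint (𝕜 := ℝ)).continuous.comp continuous_lin).clm_comp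
        continuous_const
    exact (ContinuousLinearMap.continuous_det.comp h1).measurable.abs.ennreal_ofReal
  have hkey : ∀ L : E k →L[ℝ] E (k + m),
      ∫⁻ G in ballTuples, ENNReal.ofReal |(coef G ∘L L).det| =
      frameConst k (m + 1) * ∫⁻ A : Fin k → E m, ENNReal.ofReal |(coef (graph A) ∘L L).det| *
        ENNReal.ofReal (nd A)⁻¹ ^ (k + (m + 1)) := by
    intro L
    refine lintegral_ballTuples 1 _ (hcont L) fun G X hX => ?_
    rw [coef_mix, pow_one, ContinuousLinearMap.comp_assoc, ← ENNReal.ofReal_mul (abs_nonneg _),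
      ← abs_mul, ← det_coef]
    simp [ContinuousLinearMap.det, LinearMap.det_comp]
  let L₀ := stdIncl k m
  -- For the standard inclusion, the determinant is identically one.
  have hdet1 : ∀ A : Fin k → E m, coef (graph A) ∘L L₀.toContinuousLinearMap =
      ContinuousLinearMap.id ℝ (E k) := by
    intro A
    refine ContinuousLinearMap.ext fun u => PiLp.ext fun j => ?_
    simp [L₀, stdIncl_eq_join, graph, joinTuple, inner_join, stdTuple,
      EuclideanSpace.inner_single_left]
  obtain ⟨R, T, hQT, hdet⟩ := exists_isometry_comp_stdIncl (L := (L : E k →ₗ[ℝ] E (k + m))) hL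
  have hLR : L = (R : E (k + m) →L[ℝ] E (k + m)) ∘L L₀.toContinuousLinearMap ∘L
      (T.toContinuousLinearEquiv : E k →L[ℝ] E k) := ContinuousLinearMap.ext hQT
  -- Integration over frames is invariant under `R`, so `L` may be replaced with the standard
  -- inclusion.
  have hinv : ∫⁻ G in ballTuples, ENNReal.ofReal |(coef G ∘L L).det| =
      ENNReal.ofReal |LinearMap.det (T : E k →ₗ[ℝ] E k)| *
        ∫⁻ G in ballTuples, ENNReal.ofReal |(coef G ∘L L₀.toContinuousLinearMap).det| := by
    have hmp := volume_preserving_pi (fun _ : Fin k => R.measurePreserving)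
    rw [← lintegral_const_mul' _ _ ENNReal.ofReal_ne_top]
    have hpre : (fun (G : Fin k → E (k + m)) j => R (G j)) ⁻¹' ballTuples = ballTuples := by
      ext G; simp [ballTuples]
    rw [← hmp.setLIntegral_comp_preimage measurableSet_ballTuples (hcont L), hpre]
    refine lintegral_congr fun G => ?_
    rw [← ENNReal.ofReal_mul (abs_nonneg _), ← abs_mul]
    have h1 : coef (fun j => R (G j)) ∘L L = (coef G ∘L L₀.toContinuousLinearMap) ∘L
        (T.toContinuousLinearEquiv : E k →L[ℝ] E k) := by
      refine ContinuousLinearMap.ext fun u => PiLp.ext fun j => ?_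
      rw [hLR]
      simp
    rw [h1]
    congr 2
    simp [ContinuousLinearMap.det, LinearMap.det_comp, mul_comm]
  have h0 := frameConst_ne_zero k (m + 1)
  have ht := frameConst_ne_top k (m + 1)
  rw [← ENNReal.mul_right_inj h0 ht, ← hkey L, hinv, hkey, hdet]
  simp only [hdet1, chartConst]
  simp only [ContinuousLinearMap.det, ContinuousLinearMap.coe_id, LinearMap.det_id, abs_one,
    ENNReal.ofReal_one, one_mul]
  ring

end Frames

/-! ### Evaluation of the constant -/

section Constant

variable {k m : ℕ}

/-- The parametrization of the orthogonal complement of the graph of `A`. -/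
def kap (A : Fin k → E m) : E m →L[ℝ] E (k + m) :=
  (joinL k m : E k × E m →L[ℝ] E (k + m)) ∘L
    ((-coef A).prod (ContinuousLinearMap.id ℝ (E m)))

theorem kap_apply (A : Fin k → E m) (v : E m) : kap A v = join (-coef A v, v) := rfl

theorem inner_kap (A : Fin k → E m) (v w : E m) :
    inner ℝ (kap A v) (kap A w) = inner ℝ v w + ∑ j, inner ℝ (A j) v * inner ℝ (A j) w := by
  rw [kap_apply, kap_apply, inner_join]
  simp [PiLp.inner_apply, add_comm, mul_comm]

theorem kap_injective (A : Fin k → E m) : Function.Injective (kap A) := by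
  intro u v h
  rw [kap_apply, kap_apply, ← joinL_apply, ← joinL_apply] at h
  exact congrArg Prod.snd ((joinL k m).injective h)

theorem lin_single {V : Type*} [NormedAddCommGroup V] [NormedSpace ℝ V] (G : Fin k → V)
    (j : Fin k) : lin G (EuclideanSpace.single j 1) = G j := by
  simp [lin_apply]

theorem inner_graph (A : Fin k → E m) (i j : Fin k) :
    inner ℝ (graph A i) (graph A j) = (if i = j then 1 else 0) + inner ℝ (A i) (A j) := by
  simp [graph, joinTuple, inner_join, stdTuple, EuclideanSpace.inner_single_left]

theorem nd_sq (A : Fin k → E m) :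
    nd A ^ 2 = (1 + (Matrix.of fun (j : Fin k) (i : Fin m) => A j i) *
      (Matrix.of fun (i : Fin m) (j : Fin k) => A j i)).det := by
  have h := (lin (graph A) : E k →ₗ[ℝ] E (k + m)).normDet_sq_eq_det_gram
    (EuclideanSpace.basisFun (Fin k) ℝ)
  refine Eq.trans h ?_
  congr 1
  ext i j
  rw [Matrix.gram_apply, EuclideanSpace.basisFun_apply, EuclideanSpace.basisFun_apply,
    ContinuousLinearMap.coe_coe, lin_single, lin_single, inner_graph]
  simp [Matrix.one_apply, Matrix.mul_apply, PiLp.inner_apply, mul_comm]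

theorem normDet_kap_sq (A : Fin k → E m) :
    (kap A : E m →ₗ[ℝ] E (k + m)).normDet ^ 2 =
      (1 + (Matrix.of fun (i : Fin m) (j : Fin k) => A j i) *
        (Matrix.of fun (j : Fin k) (i : Fin m) => A j i)).det := by
  have h := (kap A : E m →ₗ[ℝ] E (k + m)).normDet_sq_eq_det_gram
    (EuclideanSpace.basisFun (Fin m) ℝ)
  refine Eq.trans h ?_
  congr 1
  ext i j
  simp [Matrix.gram_apply, inner_kap, Matrix.one_apply, Matrix.mul_apply,
    EuclideanSpace.inner_single_right, eq_comm]

/-- Complementary minors: a graph and its orthogonal complement have the same volume factor. -/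
theorem normDet_kap (A : Fin k → E m) : (kap A : E m →ₗ[ℝ] E (k + m)).normDet = nd A := by
  have h : (kap A : E m →ₗ[ℝ] E (k + m)).normDet ^ 2 = nd A ^ 2 := by
    rw [normDet_kap_sq, nd_sq, Matrix.det_one_add_mul_comm]
  exact (sq_eq_sq₀ (LinearMap.normDet_nonneg _) (nd_pos A).le).1 h

theorem exists_polar_kap (A : Fin k → E m) : ∃ T : E m ≃ₗ[ℝ] E m,
    (∀ v w, inner ℝ (kap A v) (kap A w) = inner ℝ (T v) (T w)) ∧
    |LinearMap.det (T : E m →ₗ[ℝ] E m)| = nd A := by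
  obtain ⟨T, Q, hQT, hdet⟩ := exists_polar_decomposition
    (L := (kap A : E m →ₗ[ℝ] E (k + m))) (kap_injective A)
  refine ⟨T, fun v w => ?_, hdet.trans (normDet_kap A)⟩
  have h1 := hQT v
  have h2 := hQT w
  simp only [ContinuousLinearMap.coe_coe] at h1 h2
  rw [h1, h2, Q.inner_map_map]

/-- The effect on `nd` of an additional column, in coordinates adapted to the other columns. -/
theorem nd_cons (A : Fin k → E m) (T : E m →ₗ[ℝ] E m)
    (hT : ∀ v w, inner ℝ (kap A v) (kap A w) = inner ℝ (T v) (T w)) (b : E m) :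
    nd (Fin.cons (LinearMap.adjoint T b) A : Fin (k + 1) → E m) =
      |LinearMap.det T| * √(1 + ‖b‖ ^ 2) := by
  rw [← sq_eq_sq₀ (nd_pos _).le (by positivity), mul_pow, sq_abs, Real.sq_sqrt (by positivity),
    ← normDet_kap]
  have h := (kap (Fin.cons (LinearMap.adjoint T b) A : Fin (k + 1) → E m) :
    E m →ₗ[ℝ] E (k + 1 + m)).normDet_sq_eq_det_gram (EuclideanSpace.basisFun (Fin m) ℝ)
  refine Eq.trans h ?_
  let e := EuclideanSpace.basisFun (Fin m) ℝ
  let M : Matrix (Fin m) (Fin m) ℝ := LinearMap.toMatrix e.toBasis e.toBasis T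
  have hM : ∀ i j, M i j = T (e j) i := by
    intro i j
    simp [M, e, LinearMap.toMatrix_apply]
  have hgram : Matrix.gram ℝ (fun i =>
      (kap (Fin.cons (LinearMap.adjoint T b) A : Fin (k + 1) → E m) :
        E m →ₗ[ℝ] E (k + 1 + m)) (e i)) =
      M.transpose * (1 + Matrix.replicateCol Unit b.ofLp * Matrix.replicateRow Unit b.ofLp) *
        M := by
    ext i j
    have h1 : inner ℝ (T (e i)) (T (e j)) = ∑ p, M p i * M p j := by
      simp only [PiLp.inner_apply, hM]
      exact Finset.sum_congr rfl fun p _ => by simp [mul_comm]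
    have h2 : ∀ i, inner ℝ (LinearMap.adjoint T b) (e i) = ∑ p, b p * M p i := by
      intro i
      rw [LinearMap.adjoint_inner_left, PiLp.inner_apply]
      exact Finset.sum_congr rfl fun p _ => by simp [hM, mul_comm]
    have h3 : inner ℝ (kap A (e i)) (kap A (e j)) = _ := inner_kap A (e i) (e j)
    rw [hT, h1] at h3
    rw [Matrix.gram_apply, ContinuousLinearMap.coe_coe, inner_kap, Fin.sum_univ_succ]
    simp only [Fin.cons_zero, Fin.cons_succ]
    rw [add_left_comm, ← h3, h2, h2, mul_add, add_mul, mul_one, Matrix.add_apply,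
      Matrix.mul_apply, ← Matrix.mul_assoc, Matrix.mul_assoc, Matrix.mul_apply]
    simp [Matrix.mul_apply, add_comm, mul_comm]
  have hdetM : M.det = LinearMap.det T := LinearMap.det_toMatrix _ _
  rw [hgram, Matrix.det_mul, Matrix.det_mul, Matrix.det_transpose,
    Matrix.det_one_add_replicateCol_mul_replicateRow, hdetM]
  have hb : b.ofLp ⬝ᵥ b.ofLp = ‖b‖ ^ 2 := by
    rw [EuclideanSpace.real_norm_sq_eq]
    simp [dotProduct, sq]
  rw [hb]
  ring

/-- The radial integral that each column contributes to the constant. -/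
def radialConst (m P : ℕ) : ℝ≥0∞ := ∫⁻ b : E m, ENNReal.ofReal (√(1 + ‖b‖ ^ 2))⁻¹ ^ P

/-- Integration over one of the columns. For fixed other columns, a linear substitution makes `nd` a
function of the length of this column. -/
theorem lintegral_nd_succ (P : ℕ) :
    ∫⁻ A : Fin (k + 1) → E m, ENNReal.ofReal (nd A)⁻¹ ^ (P + 1) =
      radialConst m (P + 1) * ∫⁻ A : Fin k → E m, ENNReal.ofReal (nd A)⁻¹ ^ P := by
  have hmeas : ∀ (k P : ℕ), Measurable fun A : Fin k → E m => ENNReal.ofReal (nd A)⁻¹ ^ P :=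
    fun k P => (continuous_nd.measurable.inv.ennreal_ofReal).pow_const P
  have hmp := (volume_preserving_piFinSuccAbove (fun _ : Fin (k + 1) => E m) 0).symm
  have hcons : ∀ p : E m × (Fin k → E m),
      (MeasurableEquiv.piFinSuccAbove (fun _ : Fin (k + 1) => E m) 0).symm p =
        (Fin.cons p.1 p.2 : Fin (k + 1) → E m) := by
    intro p
    simp [MeasurableEquiv.piFinSuccAbove, Fin.insertNthEquiv]
  rw [← hmp.lintegral_comp (hmeas _ _), Measure.volume_eq_prod]
  refine (lintegral_prod_symm' _ ((hmeas _ _).comp hmp.measurable)).trans ?_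
  rw [← lintegral_const_mul _ (hmeas _ _)]
  refine lintegral_congr fun A => ?_
  simp only [Function.comp_apply, hcons]
  obtain ⟨T, hT, hdet⟩ := exists_polar_kap A
  have hT0 : LinearMap.det (LinearMap.adjoint (T : E m →ₗ[ℝ] E m)) ≠ 0 := by
    rw [det_adjoint_real]
    exact (LinearEquiv.isUnit_det' T).ne_zero
  have hdet' : |LinearMap.det (LinearMap.adjoint (T : E m →ₗ[ℝ] E m))| = nd A := by
    rw [det_adjoint_real, hdet]
  have hpos := nd_pos A
  rw [lintegral_comp_linearEquiv volume _ hT0, hdet']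
  have h1 : ∀ b : E m, ENNReal.ofReal (nd (Fin.cons
      (LinearMap.adjoint (T : E m →ₗ[ℝ] E m) b) A : Fin (k + 1) → E m))⁻¹ ^ (P + 1) =
      ENNReal.ofReal (nd A)⁻¹ ^ (P + 1) * ENNReal.ofReal (√(1 + ‖b‖ ^ 2))⁻¹ ^ (P + 1) := by
    intro b
    rw [nd_cons A T hT b, hdet, mul_inv, ENNReal.ofReal_mul (by positivity), mul_pow]
  simp only [h1]
  rw [lintegral_const_mul' _ _ (by simp), radialConst, pow_succ]
  have h2 : ENNReal.ofReal (nd A) * ENNReal.ofReal (nd A)⁻¹ = 1 := by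
    rw [← ENNReal.ofReal_mul hpos.le, mul_inv_cancel₀ hpos.ne', ENNReal.ofReal_one]
  calc _ = (ENNReal.ofReal (nd A) * ENNReal.ofReal (nd A)⁻¹) * (ENNReal.ofReal (nd A)⁻¹ ^ P *
        ∫⁻ b : E m, ENNReal.ofReal (√(1 + ‖b‖ ^ 2))⁻¹ ^ (P + 1)) := by ring
    _ = _ := by rw [h2]; ring

theorem chartConst_succ (k m : ℕ) :
    chartConst (k + 1) m = radialConst m (k + m + 2) * chartConst k m := by
  have := lintegral_nd_succ (k := k) (m := m) (k + m + 1)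
  rw [chartConst, chartConst, show k + 1 + (m + 1) = k + m + 1 + 1 by ring, this]
  rfl

theorem chartConst_zero (m : ℕ) : chartConst 0 m = 1 := by
  have h : ∀ A : Fin 0 → E m, nd A = 1 := fun A => LinearMap.normDet_of_subsingleton _
  simp [chartConst, h, volume_pi, Measure.pi_empty_univ]

theorem radialConst_eq {m P : ℕ} (h : m < P) : radialConst m P =
    ENNReal.ofReal (Real.pi ^ ((m : ℝ) / 2) * Real.Gamma (((P : ℝ) - m) / 2) /
      Real.Gamma ((P : ℝ) / 2)) := by
  have hP : (0 : ℝ) < P := by exact_mod_cast (Nat.zero_le m).trans_lt h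
  have hPm : (0 : ℝ) < ((P : ℝ) - m) / 2 := by
    have : (m : ℝ) < P := by exact_mod_cast h
    linarith
  have hΓ : 0 < Real.Gamma ((P : ℝ) / 2) := Real.Gamma_pos_of_pos (by positivity)
  -- The radial integrand as a superposition of Gaussians.
  have hgam : ∀ {a r : ℝ}, 0 < a → 0 < r →
      ∫⁻ t in Ioi (0 : ℝ), ENNReal.ofReal (t ^ (a - 1) * Real.exp (-(r * t))) =
        ENNReal.ofReal ((1 / r) ^ a * Real.Gamma a) := by
    intro a r ha hr
    have h1 := Real.integral_rpow_mul_exp_neg_mul_Ioi ha hr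
    have hpos : 0 < (1 / r) ^ a * Real.Gamma a :=
      mul_pos (by positivity) (Real.Gamma_pos_of_pos ha)
    rw [← h1, ofReal_integral_eq_lintegral_ofReal]
    · by_contra hni
      rw [integral_undef hni] at h1
      exact hpos.ne h1
    · filter_upwards [ae_restrict_mem measurableSet_Ioi] with t ht
      have : 0 < t := ht
      positivity
  have hgauss : ∀ {t : ℝ}, 0 < t → ∫⁻ b : E m, ENNReal.ofReal (Real.exp (-t * ‖b‖ ^ 2)) =
      ENNReal.ofReal ((Real.pi / t) ^ ((m : ℝ) / 2)) := by
    intro t ht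
    have h1 := GaussianFourier.integral_rexp_neg_mul_sq_norm (V := E m) ht
    simp only [finrank_euclideanSpace, Fintype.card_fin] at h1
    have hpos : 0 < (Real.pi / t) ^ ((m : ℝ) / 2) := by positivity
    rw [← h1, ofReal_integral_eq_lintegral_ofReal]
    · by_contra hni
      rw [integral_undef hni] at h1
      exact hpos.ne h1
    · exact ae_of_all _ fun b => (Real.exp_pos _).le
  have hkey : ENNReal.ofReal (Real.Gamma ((P : ℝ) / 2)) * radialConst m P =
      ENNReal.ofReal (Real.pi ^ ((m : ℝ) / 2) * Real.Gamma (((P : ℝ) - m) / 2)) := by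
    calc ENNReal.ofReal (Real.Gamma ((P : ℝ) / 2)) * radialConst m P
        = ∫⁻ b : E m, ∫⁻ t in Ioi (0 : ℝ), ENNReal.ofReal
            (t ^ ((P : ℝ) / 2 - 1) * Real.exp (-((1 + ‖b‖ ^ 2) * t))) := by
          rw [radialConst, ← lintegral_const_mul' _ _ (by simp)]
          refine lintegral_congr fun b => ?_
          have hb : 0 < 1 + ‖b‖ ^ 2 := by positivity
          rw [hgam (by positivity) hb, ← ENNReal.ofReal_pow (by positivity),
            ← ENNReal.ofReal_mul hΓ.le, mul_comm]
          congr 2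
          rw [Real.sqrt_eq_rpow, ← Real.rpow_neg hb.le, ← Real.rpow_natCast, ← Real.rpow_mul hb.le,
            one_div (1 + ‖b‖ ^ 2), Real.inv_rpow hb.le, ← Real.rpow_neg hb.le]
          congr 1
          ring
      _ = ∫⁻ t in Ioi (0 : ℝ), ∫⁻ b : E m, ENNReal.ofReal
            (t ^ ((P : ℝ) / 2 - 1) * Real.exp (-((1 + ‖b‖ ^ 2) * t))) := by
          refine lintegral_lintegral_swap (Measurable.aemeasurable ?_)
          exact Measurable.ennreal_ofReal (by fun_prop)
      _ = ∫⁻ t in Ioi (0 : ℝ), ENNReal.ofReal (Real.pi ^ ((m : ℝ) / 2)) * ENNReal.ofReal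
            (t ^ (((P : ℝ) - m) / 2 - 1) * Real.exp (-(1 * t))) := by
          refine setLIntegral_congr_fun measurableSet_Ioi fun t ht => ?_
          have ht : 0 < t := ht
          have h1 : ∀ b : E m, ENNReal.ofReal
              (t ^ ((P : ℝ) / 2 - 1) * Real.exp (-((1 + ‖b‖ ^ 2) * t))) =
              ENNReal.ofReal (t ^ ((P : ℝ) / 2 - 1) * Real.exp (-t)) *
                ENNReal.ofReal (Real.exp (-t * ‖b‖ ^ 2)) := by
            intro b
            rw [← ENNReal.ofReal_mul (by positivity), mul_assoc, ← Real.exp_add]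
            congr 3
            ring
          simp only [h1]
          rw [lintegral_const_mul' _ _ (by simp), hgauss ht, ← ENNReal.ofReal_mul (by positivity),
            ← ENNReal.ofReal_mul (by positivity), Real.div_rpow Real.pi_pos.le ht.le, one_mul]
          congr 1
          have h2 : t ^ ((P : ℝ) / 2 - 1) =
              t ^ (((P : ℝ) - m) / 2 - 1) * t ^ ((m : ℝ) / 2) := by
            rw [← Real.rpow_add ht]
            congr 1
            ring
          rw [h2]
          have : t ^ ((m : ℝ) / 2) ≠ 0 := by positivity
          field_simp
      _ = _ := by
          rw [lintegral_const_mul' _ _ (by simp), hgam hPm one_pos,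
            ← ENNReal.ofReal_mul (by positivity)]
          simp
  rw [ENNReal.ofReal_div_of_pos hΓ, ← hkey, mul_comm, ENNReal.mul_div_cancel_right]
  · simpa using hΓ
  · simp

theorem chartConst_eq (k m : ℕ) : chartConst k m =
    ENNReal.ofReal (∏ i ∈ Finset.range k, (Real.pi ^ ((m : ℝ) / 2) *
      Real.Gamma (((i : ℝ) + 2) / 2) / Real.Gamma (((m : ℝ) + i + 2) / 2))) := by
  induction k with
  | zero => simp [chartConst_zero]
  | succ k ih =>
    rw [chartConst_succ, ih, radialConst_eq (by omega), Finset.prod_range_succ, mul_comm,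
      ← ENNReal.ofReal_mul]
    · congr 2
      push_cast
      congr 2 <;> ring_nf
    · refine Finset.prod_nonneg fun i _ => ?_
      have := Real.Gamma_pos_of_pos (show 0 < ((i : ℝ) + 2) / 2 by positivity)
      have := Real.Gamma_pos_of_pos (show 0 < ((m : ℝ) + i + 2) / 2 by positivity)
      positivity

end Constant

/-! ### Simple `k`-vectors -/

section Wedge

variable {n k m : ℕ}

theorem inner_wedge (x y : Fin k → E n) :
    inner ℝ (wedge x) (wedge y) = (Matrix.of fun i j => inner ℝ (x j) (y i)).det :=
  exteriorPower.inner_ιMulti_ιMulti x y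

theorem inner_smul_kVec (w v : KVec n k) (c : ℝ) : inner ℝ w (c • v) = c * inner ℝ w v :=
  inner_smul_right (𝕜 := ℝ) (E := KVec n k) _ _ _

theorem neg_smul_kVec (c : ℝ) (v : KVec n k) : -c • v = -(c • v) :=
  neg_smul (R := ℝ) (M := KVec n k) _ _

/-- The wedge product of a frame depends on the frame through a determinant only, as alternating
`k`-forms on `ℝᵏ` are multiples of the determinant. -/
theorem wedge_mix (G : Fin k → E n) (X : Fin k → E k) :
    wedge (mix G X) = (lin X).det • wedge G := by
  refine ext_inner_left ℝ fun w => ?_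
  let e := (EuclideanSpace.basisFun (Fin k) ℝ).toBasis
  let f : E k [⋀^Fin k]→ₗ[ℝ] ℝ := ((innerₗ (KVec n k) w).compAlternatingMap
    (exteriorPower.ιMulti ℝ k)).compLinearMap (lin G : E k →ₗ[ℝ] E n)
  have hf : ∀ Y : Fin k → E k, f Y = inner ℝ w (wedge (mix G Y)) := fun Y => rfl
  have he : ⇑e = stdTuple k := by
    ext1 j
    simp [e, stdTuple]
  have hX : lin X ∘ stdTuple k = X := by
    ext1 j
    simp [Function.comp, lin_apply, stdTuple]
  have hG : mix G (stdTuple k) = G := by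
    ext1 j
    simp [mix, lin_apply, stdTuple]
  have hdet : e.det X = (lin X).det := by
    have h := e.det_comp (lin X : E k →ₗ[ℝ] E k) (stdTuple k)
    rw [ContinuousLinearMap.coe_coe, hX, ← he, e.det_self, mul_one] at h
    exact h
  have h1 := congrArg (fun g => g X) (f.eq_smul_basis_det e)
  simp only [AlternatingMap.smul_apply, smul_eq_mul] at h1
  rw [hf, hf, he, hG, hdet, mul_comm] at h1
  rw [h1, inner_smul_kVec]

theorem norm_wedge_le (v : Fin k → E n) : ‖wedge v‖ ≤ √(k.factorial : ℝ) * ∏ i, ‖v i‖ := by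
  have hp : 0 ≤ ∏ i, ‖v i‖ := Finset.prod_nonneg fun i _ => norm_nonneg _
  refine le_of_sq_le_sq ?_ (mul_nonneg (Real.sqrt_nonneg _) hp)
  rw [← real_inner_self_eq_norm_sq, inner_wedge, mul_pow, Real.sq_sqrt (Nat.cast_nonneg _),
    Matrix.det_apply']
  have h1 : ∀ s ∈ (Finset.univ : Finset (Equiv.Perm (Fin k))), (((Equiv.Perm.sign s : ℤ) : ℝ) *
      ∏ i, (Matrix.of fun i j => inner ℝ (v j) (v i)) (s i) i) ≤ (∏ i, ‖v i‖) ^ 2 := by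
    intro s _
    refine (le_abs_self _).trans ?_
    have hs : |((Equiv.Perm.sign s : ℤ) : ℝ)| = 1 := by
      rcases Int.units_eq_one_or (Equiv.Perm.sign s) with h | h <;> simp [h]
    rw [abs_mul, hs, one_mul, Finset.abs_prod]
    calc ∏ i, |inner ℝ (v i) (v (s i))| ≤ ∏ i, ‖v i‖ * ‖v (s i)‖ :=
          Finset.prod_le_prod (fun i _ => abs_nonneg _) fun i _ => abs_real_inner_le_norm _ _
      _ = (∏ i, ‖v i‖) ^ 2 := by
          rw [Finset.prod_mul_distrib, Equiv.prod_comp s fun i => ‖v i‖, sq]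
  refine (Finset.sum_le_sum h1).trans ?_
  simp [Finset.card_univ, Fintype.card_perm]

/-- The wedge product as a continuous multilinear map. -/
def wedgeL (n k : ℕ) : ContinuousMultilinearMap ℝ (fun _ : Fin k => E n) (KVec n k) :=
  ((exteriorPower.ιMulti ℝ k : E n [⋀^Fin k]→ₗ[ℝ] KVec n k).mkContinuous _
    norm_wedge_le).toContinuousMultilinearMap

theorem wedgeL_apply (v : Fin k → E n) : wedgeL n k v = wedge v := rfl

theorem continuous_wedge : Continuous (wedge : (Fin k → E n) → KVec n k) :=
  (wedgeL n k).cont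

/-- The action of an isometry of `ℝⁿ` on `k`-vectors. -/
def rot (k : ℕ) (Q : E n ≃ₗᵢ[ℝ] E n) : KVec n k ≃ₗᵢ[ℝ] KVec n k :=
  LinearEquiv.isometryOfInner
    (LinearEquiv.ofLinearMap (exteriorPower.map k (Q.toLinearEquiv : E n →ₗ[ℝ] E n))
      (exteriorPower.map k (Q.symm.toLinearEquiv : E n →ₗ[ℝ] E n))
      (by
        rw [← exteriorPower.map_comp, ← exteriorPower.map_id]
        congr 1
        ext1 x
        simp)
      (by
        rw [← exteriorPower.map_comp, ← exteriorPower.map_id]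
        congr 1
        ext1 x
        simp))
    (by
      let g : KVec n k →ₗ[ℝ] KVec n k := exteriorPower.map k (Q.toLinearEquiv : E n →ₗ[ℝ] E n)
      have hg : ∀ v : Fin k → E n, g (wedge v) = wedge fun i => Q (v i) := fun v =>
        exteriorPower.map_apply_ιMulti _ _
      suffices h : (innerₗ (KVec n k)).compl₁₂ g g = innerₗ (KVec n k) from
        fun x y => congrArg (fun f => f x y) h
      refine exteriorPower.linearMap_ext (AlternatingMap.ext fun v => ?_)
      refine exteriorPower.linearMap_ext (AlternatingMap.ext fun w => ?_)
      change inner ℝ (g (wedge v)) (g (wedge w)) = inner ℝ (wedge v) (wedge w)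
      rw [hg, hg, inner_wedge, inner_wedge]
      simp)

theorem rot_wedge (Q : E n ≃ₗᵢ[ℝ] E n) (v : Fin k → E n) :
    rot k Q (wedge v) = wedge fun i => Q (v i) := exteriorPower.map_apply_ιMulti _ _

/-- The unit `k`-vector of an oriented basis. -/
def orient (G : Fin k → E n) : KVec n k := ‖wedge G‖⁻¹ • wedge G

theorem measurable_orient : Measurable (orient : (Fin k → E n) → KVec n k) :=
  continuous_wedge.norm.measurable.inv.smul continuous_wedge.measurable

theorem rot_orient (Q : E n ≃ₗᵢ[ℝ] E n) (G : Fin k → E n) :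
    rot k Q (orient G) = orient fun i => Q (G i) := by
  rw [orient, map_smul, rot_wedge, orient, ← rot_wedge, LinearIsometryEquiv.norm_map]

theorem orient_mix (G : Fin k → E n) (X : Fin k → E k) (hX : (lin X).det ≠ 0) :
    orient (mix G X) = orient G ∨ orient (mix G X) = -orient G := by
  rw [orient, wedge_mix, norm_smul, smul_smul, mul_inv, mul_right_comm, Real.norm_eq_abs]
  rcases hX.lt_or_gt with h | h
  · right
    rw [abs_of_neg h, inv_neg, neg_mul, inv_mul_cancel₀ hX, neg_one_mul, neg_smul_kVec, orient]
  · left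
    rw [abs_of_pos h, inv_mul_cancel₀ hX, one_mul, orient]

theorem norm_orient {G : Fin k → E n} (hG : wedge G ≠ 0) : ‖orient G‖ = 1 := by
  rw [orient, norm_smul, norm_inv, norm_norm, inv_mul_cancel₀ (norm_ne_zero_iff.2 hG)]

theorem mem_unitSimple_iff {w : KVec n k} :
    w ∈ unitSimple n k ↔ ∃ G : Fin k → E n, wedge G ≠ 0 ∧ (w = orient G ∨ w = -orient G) := by
  constructor
  · rintro ⟨⟨c, v, rfl⟩, hw⟩
    have hv : wedge v ≠ 0 := fun h => by simp [h] at hw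
    refine ⟨v, hv, ?_⟩
    have hn := norm_ne_zero_iff.2 hv
    rw [norm_smul, Real.norm_eq_abs] at hw
    have hc : |c| = ‖wedge v‖⁻¹ := eq_inv_of_mul_eq_one_left hw
    rw [orient, ← hc, ← neg_smul_kVec]
    rcases abs_choice c with h | h <;> simp [h]
  · rintro ⟨G, hG, rfl | rfl⟩
    · exact ⟨⟨_, G, rfl⟩, norm_orient hG⟩
    · exact ⟨⟨-‖wedge G‖⁻¹, G, by rw [orient, neg_smul_kVec]⟩, by rw [norm_neg, norm_orient hG]⟩

theorem neg_mem_unitSimple {w : KVec n k} (hw : w ∈ unitSimple n k) : -w ∈ unitSimple n k := by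
  obtain ⟨G, hG, h⟩ := mem_unitSimple_iff.1 hw
  refine mem_unitSimple_iff.2 ⟨G, hG, ?_⟩
  rcases h with rfl | rfl <;> simp

theorem rot_mem_unitSimple {w : KVec n k} (Q : E n ≃ₗᵢ[ℝ] E n) (hw : w ∈ unitSimple n k) :
    rot k Q w ∈ unitSimple n k := by
  obtain ⟨⟨c, v, rfl⟩, h⟩ := hw
  exact ⟨⟨c, _, by rw [map_smul, rot_wedge]⟩, by rw [LinearIsometryEquiv.norm_map, h]⟩

theorem wedge_graph_ne_zero (A : Fin k → E m) : wedge (graph A) ≠ 0 := by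
  rw [wedge_ne_zero_iff, Fintype.linearIndependent_iff]
  intro g hg i
  have h : lin (graph A) (WithLp.toLp 2 g) = lin (graph A) 0 := by
    rw [map_zero, lin_apply]; exact hg
  exact congrFun (congrArg WithLp.ofLp (lin_graph_injective A h)) i

/-- The unit `k`-vector of the graph of the linear map with columns `A`. -/
def omega (A : Fin k → E m) : KVec (k + m) k := orient (graph A)

theorem omega_mem (A : Fin k → E m) : omega A ∈ unitSimple (k + m) k :=
  mem_unitSimple_iff.2 ⟨_, wedge_graph_ne_zero A, Or.inl rfl⟩

theorem continuous_omega : Continuous (omega : (Fin k → E m) → KVec (k + m) k) := by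
  have h := continuous_wedge.comp (continuous_graph (k := k) (m := m))
  exact (h.norm.inv₀ fun A => norm_ne_zero_iff.2 (wedge_graph_ne_zero A)).smul h

/-- The `k`-vector `e₁ ∧ ⋯ ∧ e_k`. -/
def omega₀ (k m : ℕ) : KVec (k + m) k := wedge (graph (0 : Fin k → E m))

theorem inner_stdTuple (i j : Fin k) :
    inner ℝ (stdTuple k i) (stdTuple k j) = if i = j then 1 else 0 := by
  rw [stdTuple, stdTuple, EuclideanSpace.inner_single_left]
  simp

theorem graph_apply (A : Fin k → E m) (j : Fin k) : graph A j = join (stdTuple k j, A j) := rfl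

theorem inner_omega₀_wedge_joinTuple (X : Fin k → E k) (Y : Fin k → E m) :
    inner ℝ (omega₀ k m) (wedge (joinTuple (X, Y))) = (lin X).det := by
  have h : joinTuple (X, Y) = fun i => join (X i, Y i) := rfl
  have h2 : wedge (joinTuple (X, (0 : Fin k → E m))) = (lin X).det • omega₀ k m := by
    rw [omega₀, ← wedge_mix, mix_graph]
    congr 3
    ext1 j
    simp [mix, lin_apply]
  have h3 : inner ℝ (omega₀ k m) (wedge (joinTuple (X, Y))) =
      inner ℝ (omega₀ k m) (wedge (joinTuple (X, (0 : Fin k → E m)))) := by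
    rw [omega₀, inner_wedge, inner_wedge]
    simp [graph_apply, joinTuple, inner_join]
  rw [h3, h2, inner_smul_kVec, omega₀, inner_wedge]
  have h4 : (Matrix.of fun i j => inner ℝ (graph (0 : Fin k → E m) j) (graph 0 i)) = 1 := by
    ext i j
    simp [graph_apply, inner_join, inner_stdTuple, Matrix.one_apply, eq_comm]
  rw [h4, Matrix.det_one, mul_one]

theorem inner_omega₀_wedge_graph (A : Fin k → E m) :
    inner ℝ (omega₀ k m) (wedge (graph A)) = 1 := by
  rw [graph, inner_omega₀_wedge_joinTuple]
  have : lin (stdTuple k) = ContinuousLinearMap.id ℝ (E k) :=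
    ContinuousLinearMap.ext fun u => lin_stdTuple u
  rw [this]
  simp [ContinuousLinearMap.det]

theorem norm_omega₀ : ‖omega₀ k m‖ = 1 := by
  have h := inner_omega₀_wedge_graph (0 : Fin k → E m)
  rw [← omega₀, real_inner_self_eq_norm_sq] at h
  exact (pow_eq_one_iff_of_nonneg (norm_nonneg _) two_ne_zero).1 h

theorem omega_zero : omega (0 : Fin k → E m) = omega₀ k m := by
  rw [omega, orient, ← omega₀, norm_omega₀, inv_one, one_smul]

theorem inner_omega₀_omega_pos (A : Fin k → E m) : 0 < inner ℝ (omega₀ k m) (omega A) := by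
  rw [omega, orient, inner_smul_kVec, inner_omega₀_wedge_graph, mul_one]
  exact inv_pos.2 (norm_pos_iff.2 (wedge_graph_ne_zero A))

/-- The `k`-vector which differs from `e₁ ∧ ⋯ ∧ e_k` in that the `j`-th factor is replaced by the
vector `a` of the orthogonal complement. -/
def tangentVec (j : Fin k) (a : E m) : KVec (k + m) k :=
  wedge (Function.update (graph (0 : Fin k → E m)) j (join (0, a)))

theorem inner_tangentVec_wedge_graph (j : Fin k) (a : E m) (A : Fin k → E m) :
    inner ℝ (tangentVec j a) (wedge (graph A)) = inner ℝ a (A j) := by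
  have h : (Matrix.of fun p q => inner ℝ
      (Function.update (graph (0 : Fin k → E m)) j (join (0, a)) q) (graph A p)) =
      (1 : Matrix (Fin k) (Fin k) ℝ).updateCol j fun p => inner ℝ a (A p) := by
    ext p q
    by_cases hq : q = j
    · subst hq
      simp [graph_apply, inner_join]
    · simp [hq, graph_apply, inner_join, inner_stdTuple, Matrix.one_apply, eq_comm]
  rw [tangentVec, inner_wedge, h, ← Matrix.cramer_apply, Matrix.cramer_one]
  rfl

theorem inner_omega₀_tangentVec (j : Fin k) (a : E m) :
    inner ℝ (omega₀ k m) (tangentVec j a) = 0 := by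
  rw [real_inner_comm, omega₀, inner_tangentVec_wedge_graph]
  simp

theorem inner_tangentVec (i j : Fin k) (a b : E m) :
    inner ℝ (tangentVec i a) (tangentVec j b) = if i = j then inner ℝ a b else 0 := by
  rw [tangentVec, tangentVec, inner_wedge]
  split_ifs with h
  · subst h
    have h2 : (Matrix.of fun p q => inner ℝ
        (Function.update (graph (0 : Fin k → E m)) i (join (0, a)) q)
        (Function.update (graph (0 : Fin k → E m)) i (join (0, b)) p)) =
        Matrix.diagonal (Function.update 1 i (inner ℝ a b)) := by
      ext p q
      by_cases hq : q = i <;> by_cases hp : p = i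
      · subst hq; subst hp
        simp [inner_join]
      · subst hq
        simp [hp, graph_apply, inner_join]
      · subst hp
        have : p ≠ q := fun h => hq h.symm
        simp [hq, this, graph_apply, inner_join]
      · simp only [Matrix.of_apply, Function.update_of_ne hq, Function.update_of_ne hp,
          graph_apply, inner_join, inner_stdTuple, Matrix.diagonal_apply]
        by_cases hpq : p = q <;> simp [hpq, eq_comm]
    rw [h2, Matrix.det_diagonal, Finset.prod_update_of_mem (Finset.mem_univ i)]
    simp
  · refine Matrix.det_eq_zero_of_row_eq_zero i fun q => ?_
    rw [Matrix.of_apply, Function.update_of_ne h]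
    by_cases hq : q = i
    · subst hq
      simp [graph_apply, inner_join]
    · simp [hq, graph_apply, inner_join, inner_stdTuple]

/-- The coordinates `A` of a plane near the standard one, as a function of its `k`-vector. The value
is meaningful only if the `k`-vector is not orthogonal to `e₁ ∧ ⋯ ∧ e_k`. -/
def coord (w : KVec (k + m) k) : Fin k → E m := fun j => WithLp.toLp 2 fun i =>
  inner ℝ (tangentVec j (EuclideanSpace.single i 1)) w / inner ℝ (omega₀ k m) w

theorem coord_smul {c : ℝ} (hc : c ≠ 0) (w : KVec (k + m) k) : coord (c • w) = coord w := by
  ext j i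
  simp only [coord, inner_smul_kVec]
  rw [mul_div_mul_left _ _ hc]

theorem coord_omega (A : Fin k → E m) : coord (omega A) = A := by
  rw [omega, orient, coord_smul (inv_ne_zero (norm_ne_zero_iff.2 (wedge_graph_ne_zero A)))]
  ext j i
  simp [coord, inner_omega₀_wedge_graph, inner_tangentVec_wedge_graph,
    EuclideanSpace.inner_single_left]

theorem continuousAt_coord {w : KVec (k + m) k} (hw : inner ℝ (omega₀ k m) w ≠ 0) :
    ContinuousAt coord w := by
  refine continuousAt_pi.2 fun j => ?_
  refine (PiLp.continuous_toLp 2 _).continuousAt.comp (continuousAt_pi.2 fun i => ?_)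
  exact ContinuousAt.div (by fun_prop) (by fun_prop) hw

theorem omega_injective : Function.Injective (omega : (Fin k → E m) → KVec (k + m) k) :=
  Function.LeftInverse.injective coord_omega

/-- The oriented planes with a positive component along `e₁ ∧ ⋯ ∧ e_k` are oriented graphs. -/
theorem omega_coord {w : KVec (k + m) k} (hw : w ∈ unitSimple (k + m) k)
    (hpos : 0 < inner ℝ (omega₀ k m) w) : omega (coord w) = w := by
  obtain ⟨G, hG, hw⟩ := mem_unitSimple_iff.1 hw
  obtain ⟨X, Y, rfl⟩ : ∃ (X : Fin k → E k) (Y : Fin k → E m), G = joinTuple (X, Y) := by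
    refine ⟨fun j => ((joinL k m).symm (G j)).1, fun j => ((joinL k m).symm (G j)).2, ?_⟩
    ext1 j
    exact ((joinL k m).apply_symm_apply (G j)).symm
  have hX : (lin X).det ≠ 0 := by
    intro h0
    have h1 := inner_omega₀_wedge_joinTuple X Y
    rw [h0] at h1
    rcases hw with rfl | rfl <;> simp [orient, inner_smul_kVec, h1] at hpos
  -- The coordinates are the columns of `Y X⁻¹`.
  let S : E k →ₗ[ℝ] E k := ((lin X : E k →ₗ[ℝ] E k).equivOfDetNeZero hX).symm
  have hS : ∀ u, S (lin X u) = u := fun u =>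
    ((lin X : E k →ₗ[ℝ] E k).equivOfDetNeZero hX).symm_apply_apply u
  let A : Fin k → E m := fun j => lin Y (S (stdTuple k j))
  have hA : ∀ u, lin A u = lin Y (S u) := by
    intro u
    conv_rhs => rw [← lin_stdTuple u]
    simp [lin_apply A, A, lin_apply (stdTuple k)]
  have hY : mix A X = Y := by
    ext1 j
    have h1 : X j = lin X (stdTuple k j) := by
      simp [lin_apply, stdTuple]
    rw [mix, hA, h1, hS]
    simp [lin_apply, stdTuple]
  have h2 : orient (joinTuple (X, Y)) = omega A ∨ orient (joinTuple (X, Y)) = -omega A := by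
    have := orient_mix (graph A) X hX
    rwa [mix_graph, hY] at this
  have h3 : w = omega A ∨ w = -omega A := by
    rcases hw with rfl | rfl <;> rcases h2 with h | h <;> simp [h]
  rcases h3 with rfl | rfl
  · rw [coord_omega]
  · rw [inner_neg_right] at hpos
    linarith [inner_omega₀_omega_pos A]

end Wedge

/-! ### The invariant measure on oriented planes -/

section OrientedPlanes

variable {k m : ℕ}

/-- The space of tuples with its Euclidean norm. -/
abbrev Tuples (k m : ℕ) : Type := PiLp 2 fun _ : Fin k => E m

theorem measurePreserving_uncurry (k m : ℕ) :
    MeasurePreserving (fun (x : Fin k → Fin m → ℝ) (p : (_ : Fin k) × Fin m) => x p.1 p.2) := by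
  have hm : Measurable fun (x : Fin k → Fin m → ℝ) (p : (_ : Fin k) × Fin m) => x p.1 p.2 :=
    measurable_pi_lambda _ fun p => (measurable_pi_apply p.2).comp (measurable_pi_apply p.1)
  refine ⟨hm, (Measure.pi_eq fun s hs => ?_).symm⟩
  rw [Measure.map_apply hm (MeasurableSet.univ_pi hs)]
  have h : (fun (x : Fin k → Fin m → ℝ) (p : (_ : Fin k) × Fin m) => x p.1 p.2) ⁻¹' univ.pi s =
      univ.pi fun i => univ.pi fun j => s ⟨i, j⟩ := by
    ext x
    simp [Set.mem_pi, Sigma.forall]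
  rw [h, volume_pi_pi]
  simp_rw [volume_pi_pi]
  rw [Fintype.prod_sigma]

theorem measurePreserving_toTuples (k m : ℕ) :
    MeasurePreserving (WithLp.toLp 2 : (Fin k → E m) → Tuples k m) := by
  let b := Pi.orthonormalBasis fun _ : Fin k => EuclideanSpace.basisFun (Fin m) ℝ
  have h1 := volume_preserving_pi fun _ : Fin k => PiLp.volume_preserving_ofLp (Fin m)
  have h2 := (PiLp.volume_preserving_toLp ((_ : Fin k) × Fin m)).comp
    ((measurePreserving_uncurry k m).comp h1)
  have h3 := b.repr.symm.measurePreserving.comp h2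
  convert h3 using 1
  ext1 x
  simp only [Function.comp]
  rw [LinearIsometryEquiv.eq_symm_apply]
  ext p
  simp [b, Pi.orthonormalBasis_repr]

/-- The derivative of `omega` at zero. It is isometric, see `norm_omegaDeriv`. -/
def omegaDeriv (k m : ℕ) : Tuples k m →L[ℝ] KVec (k + m) k :=
  (wedgeL (k + m) k).linearDeriv (graph 0) ∘L
    (ContinuousLinearMap.pi fun j => (joinL k m : E k × E m →L[ℝ] E (k + m)) ∘L
      ContinuousLinearMap.inr ℝ (E k) (E m) ∘L ContinuousLinearMap.proj j) ∘L
    (PiLp.continuousLinearEquiv 2 ℝ (fun _ : Fin k => E m) : Tuples k m →L[ℝ] Fin k → E m)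

theorem omegaDeriv_apply (A : Tuples k m) : omegaDeriv k m A = ∑ j, tangentVec j (A j) := by
  simp only [omegaDeriv, ContinuousLinearMap.comp_apply,
    ContinuousMultilinearMap.linearDeriv_apply, wedgeL_apply]
  rfl

theorem inner_omega₀_omegaDeriv (A : Tuples k m) : inner ℝ (omega₀ k m) (omegaDeriv k m A) = 0 := by
  rw [omegaDeriv_apply, inner_sum]
  exact Finset.sum_eq_zero fun j _ => inner_omega₀_tangentVec j _

theorem norm_omegaDeriv (A : Tuples k m) : ‖omegaDeriv k m A‖ = ‖A‖ := by
  rw [← sq_eq_sq₀ (norm_nonneg _) (norm_nonneg _), ← real_inner_self_eq_norm_sq,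
    ← real_inner_self_eq_norm_sq, omegaDeriv_apply, sum_inner, PiLp.inner_apply]
  refine Finset.sum_congr rfl fun i _ => ?_
  rw [inner_sum]
  simp [inner_tangentVec]

theorem hasStrictFDerivAt_wedge_graph : HasStrictFDerivAt
    (fun A : Tuples k m => wedge (graph A)) (omegaDeriv k m) 0 := by
  let J : (Fin k → E m) →L[ℝ] (Fin k → E (k + m)) :=
    ContinuousLinearMap.pi fun j => (joinL k m : E k × E m →L[ℝ] E (k + m)) ∘L
      ContinuousLinearMap.inr ℝ (E k) (E m) ∘L ContinuousLinearMap.proj j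
  let J' : Tuples k m →L[ℝ] (Fin k → E (k + m)) := J ∘L
    (PiLp.continuousLinearEquiv 2 ℝ (fun _ : Fin k => E m) : Tuples k m →L[ℝ] Fin k → E m)
  have h1 : ∀ A : Tuples k m, graph A = graph (0 : Fin k → E m) + J' A := by
    intro A
    ext1 j
    change join (stdTuple k j, A j) = join (stdTuple k j, 0) + join (0, A j)
    rw [← join_add]
    simp
  have h2 : HasStrictFDerivAt (fun A : Tuples k m => graph A) J' 0 := by
    rw [show (fun A : Tuples k m => graph A) = fun A => graph (0 : Fin k → E m) + J' A from
      funext h1]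
    exact J'.hasStrictFDerivAt.const_add _
  exact HasStrictFDerivAt.comp (g := wedgeL (k + m) k) (0 : Tuples k m)
    ((wedgeL (k + m) k).hasStrictFDerivAt _) h2

/-- Normalization does not affect the derivative at a point where the value is a unit vector
orthogonal to the derivative. -/
theorem hasStrictFDerivAt_normalize {X F : Type*} [NormedAddCommGroup X] [NormedSpace ℝ X]
    [NormedAddCommGroup F] [InnerProductSpace ℝ F] {f : X → F} {f' : X →L[ℝ] F} {x : X}
    (hf : HasStrictFDerivAt f f' x) (hx : ‖f x‖ = 1) (h : ∀ u, inner ℝ (f x) (f' u) = 0) :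
    HasStrictFDerivAt (fun y => ‖f y‖⁻¹ • f y) f' x := by
  have h1 : HasStrictFDerivAt (fun y => ‖f y‖ ^ 2) (0 : X →L[ℝ] ℝ) x := by
    refine ((hasStrictFDerivAt_norm_sq _).comp x hf).congr_fderiv ?_
    ext u
    simp [h]
  have h2 : HasStrictFDerivAt (fun y => ‖f y‖⁻¹) (0 : X →L[ℝ] ℝ) x := by
    have h3 := h1.rpow_const (p := -(1 / 2 : ℝ)) (Or.inl (by rw [hx]; norm_num))
    refine (h3.congr_fderiv (by simp)).congr_of_eventuallyEq (Eventually.of_forall fun y => ?_)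
    simp only
    rw [Real.rpow_neg (sq_nonneg _), ← Real.sqrt_eq_rpow, Real.sqrt_sq (norm_nonneg _)]
  refine (h2.smul hf).congr_fderiv ?_
  ext1 u
  simp [hx]

theorem hasStrictFDerivAt_omega : HasStrictFDerivAt
    (fun A : Tuples k m => omega A) (omegaDeriv k m) 0 :=
  hasStrictFDerivAt_normalize hasStrictFDerivAt_wedge_graph norm_omega₀ inner_omega₀_omegaDeriv

/-- The invariant measure on planes, in the coordinates `A`. Planes which are not graphs over `ℝᵏ`
have measure zero and do not occur. -/
def chartMeasure (k m : ℕ) : Measure (Fin k → E m) :=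
  volume.withDensity fun A => ENNReal.ofReal (nd A)⁻¹ ^ (k + m)

theorem measurable_weight (p : ℕ) :
    Measurable fun A : Fin k → E m => ENNReal.ofReal (nd A)⁻¹ ^ p :=
  ((continuous_nd.measurable.inv).ennreal_ofReal).pow_const _

/-- The invariant measure on the unit simple `k`-vectors, supported by the two orientations of the
graphs. -/
def orientedMeasure (k m : ℕ) : Measure (KVec (k + m) k) :=
  (chartMeasure k m).map omega + (chartMeasure k m).map fun A => -omega A

theorem measurable_neg_omega : Measurable fun A : Fin k → E m => -omega A :=
  continuous_omega.neg.measurable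

theorem lintegral_orientedMeasure {f : KVec (k + m) k → ℝ≥0∞} (hf : Measurable f) :
    ∫⁻ w, f w ∂orientedMeasure k m =
      ∫⁻ A : Fin k → E m, (f (omega A) + f (-omega A)) * ENNReal.ofReal (nd A)⁻¹ ^ (k + m) := by
  have h1 : Measurable fun A : Fin k → E m => f (omega A) := hf.comp continuous_omega.measurable
  have h2 : Measurable fun A : Fin k → E m => f (-omega A) := hf.comp measurable_neg_omega
  rw [orientedMeasure, lintegral_add_measure, lintegral_map hf continuous_omega.measurable,
    lintegral_map hf measurable_neg_omega, ← lintegral_add_left h1]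
  refine (lintegral_withDensity_eq_lintegral_mul _ (measurable_weight _) (h1.add h2)).trans ?_
  refine lintegral_congr fun A => ?_
  simp only [Pi.mul_apply, Pi.add_apply]
  rw [mul_comm]

theorem measurable_orient_sum {f : KVec (k + m) k → ℝ≥0∞} (hf : Measurable f) :
    Measurable fun G : Fin k → E (k + m) => f (orient G) + f (-orient G) :=
  (hf.comp measurable_orient).add (hf.comp (measurable_orient.neg))

/-- Up to a constant, the invariant measure is the distribution of the plane spanned by a random
frame. This makes its invariance under isometries evident. -/
theorem lintegral_orient {f : KVec (k + m) k → ℝ≥0∞} (hf : Measurable f) :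
    ∫⁻ G in ballTuples, (f (orient G) + f (-orient G)) =
      frameConst k m * ∫⁻ w, f w ∂orientedMeasure k m := by
  rw [lintegral_orientedMeasure hf]
  refine lintegral_ballTuples 0 _ (measurable_orient_sum hf) fun G X hX => ?_
  rw [pow_zero, one_mul]
  rcases orient_mix G X hX with h | h
  · rw [h]
  · rw [h, neg_neg, add_comm]

theorem map_rot_orientedMeasure (Q : E (k + m) ≃ₗᵢ[ℝ] E (k + m)) :
    (orientedMeasure k m).map (rot k Q) = orientedMeasure k m := by
  have hr : Measurable (rot k Q) := (rot k Q).continuous.measurable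
  refine Measure.ext fun s hs => ?_
  have h : ∀ f : KVec (k + m) k → ℝ≥0∞, Measurable f →
      ∫⁻ w, f (rot k Q w) ∂orientedMeasure k m = ∫⁻ w, f w ∂orientedMeasure k m := by
    intro f hf
    rw [← ENNReal.mul_right_inj (frameConst_ne_zero k m) (frameConst_ne_top k m),
      ← lintegral_orient hf, ← lintegral_orient (f := fun w => f (rot k Q w)) (hf.comp hr)]
    have hmp := volume_preserving_pi (fun _ : Fin k => Q.measurePreserving)
    have hpre : (fun (G : Fin k → E (k + m)) j => Q (G j)) ⁻¹' ballTuples = ballTuples := by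
      ext G; simp [ballTuples]
    rw [← hmp.setLIntegral_comp_preimage measurableSet_ballTuples (measurable_orient_sum hf), hpre]
    refine lintegral_congr fun G => ?_
    rw [← rot_orient, map_neg]
  have h1 := h (s.indicator 1) (measurable_one.indicator hs)
  rw [lintegral_indicator_one hs] at h1
  rw [Measure.map_apply hr hs, ← h1, ← lintegral_indicator_one (hr hs)]
  rfl

theorem map_neg_orientedMeasure :
    (orientedMeasure k m).map (fun w => -w) = orientedMeasure k m := by
  have hn : Measurable fun w : KVec (k + m) k => -w := continuous_neg.measurable
  rw [orientedMeasure, Measure.map_add _ _ hn, Measure.map_map hn continuous_omega.measurable,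
    Measure.map_map hn measurable_neg_omega]
  simp only [Function.comp_def, neg_neg]
  exact add_comm _ _

theorem chartMeasure_univ_lt_top : chartMeasure k m univ < ⊤ := by
  have h := lintegral_orient (k := k) (m := m) (f := fun _ => 1) measurable_const
  rw [lintegral_orientedMeasure measurable_const] at h
  rw [chartMeasure, withDensity_apply _ .univ, Measure.restrict_univ]
  have h1 : ∫⁻ A : Fin k → E m, (1 + 1) * ENNReal.ofReal (nd A)⁻¹ ^ (k + m) < ⊤ := by
    refine lt_top_iff_ne_top.2 fun h2 => ?_
    rw [h2, ENNReal.mul_top (frameConst_ne_zero k m), setLIntegral_const] at h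
    refine ENNReal.mul_ne_top (by simp) ?_ h
    exact isCompact_ballTuples.measure_lt_top.ne
  refine lt_of_le_of_lt (lintegral_mono fun A => ?_) h1
  rw [one_add_one_eq_two, two_mul]
  exact le_self_add

instance : IsFiniteMeasure (chartMeasure k m) := ⟨chartMeasure_univ_lt_top⟩

instance : IsFiniteMeasure (orientedMeasure k m) := by
  unfold orientedMeasure; infer_instance

/-- The group of isometries of `ℝⁿ` acts transitively on the `k`-dimensional planes. -/
theorem exists_rotation {G : Fin k → E (k + m)} (hG : wedge G ≠ 0) :
    ∃ Q : E (k + m) ≃ₗᵢ[ℝ] E (k + m), orient G = rot k Q (omega₀ k m) ∨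
      orient G = -rot k Q (omega₀ k m) := by
  have hL : Function.Injective (lin G : E k →ₗ[ℝ] E (k + m)) := by
    rw [← LinearMap.ker_eq_bot, LinearMap.ker_eq_bot']
    intro u hu
    rw [wedge_ne_zero_iff, Fintype.linearIndependent_iff] at hG
    ext i
    exact hG u (by rw [← lin_apply]; exact hu) i
  obtain ⟨Q, T, hQT, -⟩ := exists_isometry_comp_stdIncl hL
  let X : Fin k → E k := fun j => T (stdTuple k j)
  have hlinX : lin X = (T.toContinuousLinearEquiv : E k →L[ℝ] E k) := by
    refine ContinuousLinearMap.ext fun u => ?_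
    conv_rhs => rw [← lin_stdTuple u]
    simp [lin_apply, X]
  have hX : (lin X).det ≠ 0 := by
    rw [hlinX]
    exact (LinearEquiv.isUnit_det' T).ne_zero
  have hGX : G = mix (fun j => Q (graph (0 : Fin k → E m) j)) X := by
    have h1 : ∀ u, lin (fun j => Q (graph (0 : Fin k → E m) j)) u = Q (stdIncl k m u) := by
      intro u
      change _ = Q (lin (graph (0 : Fin k → E m)) u)
      simp [lin_apply]
    ext1 j
    rw [mix, h1]
    have h2 := hQT (stdTuple k j)
    have h3 : lin G (stdTuple k j) = G j := by simp [lin_apply, stdTuple]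
    rw [← h3]
    exact h2
  refine ⟨Q, ?_⟩
  rw [← omega_zero, omega, rot_orient]
  conv_lhs => rw [hGX]
  conv_rhs => rw [hGX]
  exact orient_mix _ X hX

end OrientedPlanes

/-! ### Hausdorff measure on the space of disks -/

section Triples

variable {n k m : ℕ}

/-- The triple with given center, `k`-vector and radius. -/
def toTriple (t : E n × KVec n k × ℝ) : Triple n k := WithLp.toLp 2 (t.1, WithLp.toLp 2 t.2)

/-- The components of a triple. -/
def ofTriple (d : Triple n k) : E n × KVec n k × ℝ := (d.fst, d.snd.fst, d.snd.snd)

theorem continuous_toTriple : Continuous (toTriple : E n × KVec n k × ℝ → Triple n k) := by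
  unfold toTriple; fun_prop

theorem continuous_ofTriple : Continuous (ofTriple : Triple n k → E n × KVec n k × ℝ) := by
  unfold ofTriple; fun_prop

theorem ofTriple_toTriple (t : E n × KVec n k × ℝ) : ofTriple (toTriple t) = t := rfl

/-- The set of triples representing disks. -/
def diskTriples (n k : ℕ) : Set (Triple n k) := {d | d.normal ∈ unitSimple n k}

/-- The unit simple `k`-vectors are, up to sign, the wedge products of orthonormal frames. -/
theorem isCompact_unitSimple : IsCompact (unitSimple (k + m) k) := by
  let K : Set (Fin k → E (k + m)) := {v | ∀ i j, inner ℝ (v i) (v j) = if i = j then 1 else 0}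
  have hK : IsCompact K := by
    refine Metric.isCompact_of_isClosed_isBounded ?_
      ((Metric.isBounded_closedBall (x := (0 : Fin k → E (k + m))) (r := 1)).subset fun v hv => ?_)
    · simp only [K, ofPred_forall]
      exact isClosed_iInter fun i => isClosed_iInter fun j =>
        isClosed_eq (by fun_prop) continuous_const
    · rw [mem_closedBall_zero_iff, pi_norm_le_iff_of_nonneg zero_le_one]
      intro i
      have h := hv i i
      rw [real_inner_self_eq_norm_sq, if_pos rfl] at h
      exact ((pow_eq_one_iff_of_nonneg (norm_nonneg _) two_ne_zero).1 h).le
  have h : unitSimple (k + m) k = wedge '' K ∪ (fun v => -wedge v) '' K := by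
    refine Subset.antisymm (fun w hw => ?_) (union_subset ?_ ?_)
    · obtain ⟨G, hG, hwG⟩ := mem_unitSimple_iff.1 hw
      obtain ⟨Q, hQ⟩ := exists_rotation hG
      have hv : (fun j => Q (graph (0 : Fin k → E m) j)) ∈ K := fun i j => by
        rw [LinearIsometryEquiv.inner_map_map, graph_apply, graph_apply, inner_join,
          inner_stdTuple]
        simp
      have h1 : rot k Q (omega₀ k m) = wedge fun j => Q (graph (0 : Fin k → E m) j) := by
        rw [omega₀, rot_wedge]
      have h2 : w = rot k Q (omega₀ k m) ∨ w = -rot k Q (omega₀ k m) := by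
        rcases hwG with rfl | rfl <;> rcases hQ with h | h <;> simp [h]
      rcases h2 with rfl | rfl
      · exact Or.inl ⟨_, hv, h1.symm⟩
      · exact Or.inr ⟨_, hv, by rw [h1]⟩
    all_goals
      rintro _ ⟨v, hv, rfl⟩
      have h1 : ‖wedge v‖ = 1 := by
        refine (pow_eq_one_iff_of_nonneg (norm_nonneg _) two_ne_zero).1 ?_
        rw [← real_inner_self_eq_norm_sq, inner_wedge]
        have : (Matrix.of fun i j => inner ℝ (v j) (v i)) = 1 := by
          ext i j
          rw [Matrix.of_apply, hv, Matrix.one_apply]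
          simp [eq_comm]
        rw [this, Matrix.det_one]
      have h2 : wedge v ∈ unitSimple (k + m) k := ⟨⟨1, v, (one_smul ℝ _).symm⟩, h1⟩
    · exact h2
    · exact neg_mem_unitSimple h2
  rw [h]
  exact (hK.image continuous_wedge).union (hK.image continuous_wedge.neg)

theorem measurableSet_diskTriples : MeasurableSet (diskTriples (k + m) k) := by
  have h : Continuous fun d : Triple (k + m) k => d.snd.fst := by fun_prop
  exact (isCompact_unitSimple.isClosed.preimage h).measurableSet

/-- The product of Lebesgue measure for the centers, the invariant measure for the oriented planes
and Lebesgue measure for the radii. -/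
def tripleMeasure (k m : ℕ) : Measure (Triple (k + m) k) :=
  ((volume : Measure (E (k + m))).prod
    ((orientedMeasure k m).prod (volume : Measure ℝ))).map toTriple

/-- The isometry of the space of triples induced by one of the space of `k`-vectors. -/
def tripleIso (R : KVec n k ≃ₗᵢ[ℝ] KVec n k) : Triple n k ≃ₗᵢ[ℝ] Triple n k :=
  LinearIsometryEquiv.withLpProdCongr 2 (LinearIsometryEquiv.refl ℝ (E n))
    (LinearIsometryEquiv.withLpProdCongr 2 R (LinearIsometryEquiv.refl ℝ ℝ))

theorem tripleIso_toTriple (R : KVec n k ≃ₗᵢ[ℝ] KVec n k) (p : E n) (w : KVec n k) (r : ℝ) :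
    tripleIso R (toTriple (p, w, r)) = toTriple (p, R w, r) := rfl

theorem map_tripleIso (R : KVec (k + m) k ≃ₗᵢ[ℝ] KVec (k + m) k)
    (hR : (orientedMeasure k m).map R = orientedMeasure k m) :
    (tripleMeasure k m).map (tripleIso R) = tripleMeasure k m := by
  have hRm : Measurable R := R.continuous.measurable
  have h1 : tripleIso R ∘ toTriple = (toTriple : _ → Triple (k + m) k) ∘
      Prod.map id (Prod.map R id) := rfl
  rw [tripleMeasure, Measure.map_map (tripleIso R).continuous.measurable
    continuous_toTriple.measurable, h1, ← Measure.map_map continuous_toTriple.measurable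
    (measurable_id.prodMap (hRm.prodMap measurable_id)),
    ← Measure.map_prod_map _ _ measurable_id (hRm.prodMap measurable_id),
    ← Measure.map_prod_map _ _ hRm measurable_id, hR, Measure.map_id, Measure.map_id]

/-- The coordinates of oriented disks: the plane is the graph of the map with columns `A`. -/
def chartTriple (t : E (k + m) × (Fin k → E m) × ℝ) : Triple (k + m) k :=
  toTriple (t.1, omega t.2.1, t.2.2)

/-- The coordinates of disks with the opposite orientation. -/
def chartTripleNeg (t : E (k + m) × (Fin k → E m) × ℝ) : Triple (k + m) k :=
  toTriple (t.1, -omega t.2.1, t.2.2)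

theorem continuous_chartTriple :
    Continuous (chartTriple : E (k + m) × (Fin k → E m) × ℝ → Triple (k + m) k) :=
  continuous_toTriple.comp (continuous_fst.prodMk
    ((continuous_omega.comp (continuous_fst.comp continuous_snd)).prodMk
      (continuous_snd.comp continuous_snd)))

theorem continuous_chartTripleNeg :
    Continuous (chartTripleNeg : E (k + m) × (Fin k → E m) × ℝ → Triple (k + m) k) :=
  continuous_toTriple.comp (continuous_fst.prodMk
    ((continuous_omega.comp (continuous_fst.comp continuous_snd)).neg.prodMk
      (continuous_snd.comp continuous_snd)))

theorem chartTriple_injective :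
    Function.Injective (chartTriple : E (k + m) × (Fin k → E m) × ℝ → Triple (k + m) k) := by
  rintro ⟨p, A, r⟩ ⟨p', A', r'⟩ h
  have h1 := congrArg ofTriple h
  simp only [chartTriple, ofTriple_toTriple, Prod.mk.injEq] at h1
  rw [h1.1, omega_injective h1.2.1, h1.2.2]

theorem chartTripleNeg_injective :
    Function.Injective (chartTripleNeg : E (k + m) × (Fin k → E m) × ℝ → Triple (k + m) k) := by
  rintro ⟨p, A, r⟩ ⟨p', A', r'⟩ h
  have h1 := congrArg ofTriple h
  simp only [chartTripleNeg, ofTriple_toTriple, Prod.mk.injEq, neg_inj] at h1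
  rw [h1.1, omega_injective h1.2.1, h1.2.2]

/-- The product measure in the coordinates of oriented disks. -/
def chartVolume (k m : ℕ) : Measure (E (k + m) × (Fin k → E m) × ℝ) :=
  volume.prod ((chartMeasure k m).prod volume)

theorem tripleMeasure_eq_map : tripleMeasure k m =
    (chartVolume k m).map chartTriple + (chartVolume k m).map chartTripleNeg := by
  have h : ∀ g : (Fin k → E m) → KVec (k + m) k, Measurable g →
      ((volume : Measure (E (k + m))).prod (((chartMeasure k m).map g).prod
        (volume : Measure ℝ))).map toTriple =
      (chartVolume k m).map fun t => toTriple (t.1, g t.2.1, t.2.2) := by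
    intro g hg
    have h1 : (fun t : E (k + m) × (Fin k → E m) × ℝ => (toTriple (t.1, g t.2.1, t.2.2) :
        Triple (k + m) k)) = toTriple ∘ Prod.map id (Prod.map g id) := rfl
    rw [h1, ← Measure.map_map continuous_toTriple.measurable
      (measurable_id.prodMap (hg.prodMap measurable_id)), chartVolume,
      ← Measure.map_prod_map _ _ measurable_id (hg.prodMap measurable_id),
      ← Measure.map_prod_map _ _ hg measurable_id, Measure.map_id, Measure.map_id]
  rw [tripleMeasure, orientedMeasure, Measure.add_prod, Measure.prod_add,
    Measure.map_add _ _ continuous_toTriple.measurable, h _ continuous_omega.measurable,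
    h _ measurable_neg_omega]
  rfl

theorem chartVolume_eq_withDensity : chartVolume k m =
    (volume : Measure (E (k + m) × (Fin k → E m) × ℝ)).withDensity
      fun t => ENNReal.ofReal (nd t.2.1)⁻¹ ^ (k + m) := by
  rw [chartVolume, chartMeasure, prod_withDensity_left (measurable_weight _)]
  exact prod_withDensity_right ((measurable_weight (k + m)).comp measurable_fst)

/-- The space of coordinates, with the Euclidean norm. -/
abbrev Coords (k m : ℕ) : Type := WithLp 2 (E (k + m) × WithLp 2 (Tuples k m × ℝ))

/-- The underlying tuple of coordinates. -/
def ofCoords (x : Coords k m) : E (k + m) × (Fin k → E m) × ℝ := (x.fst, x.snd.fst, x.snd.snd)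

theorem measurePreserving_ofCoords :
    MeasurePreserving (ofCoords : Coords k m → E (k + m) × (Fin k → E m) × ℝ) := by
  have h0 : MeasurePreserving (WithLp.ofLp : Tuples k m → Fin k → E m) := by
    let e : (Fin k → E m) ≃ᵐ Tuples k m :=
      (PiLp.continuousLinearEquiv 2 ℝ (fun _ : Fin k => E m)).symm.toHomeomorph.toMeasurableEquiv
    exact MeasurePreserving.symm e (measurePreserving_toTuples k m)
  have h1 := WithLp.volume_preserving_ofLp (Tuples k m) ℝ
  have h2 := WithLp.volume_preserving_ofLp (E (k + m)) (WithLp 2 (Tuples k m × ℝ))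
  have h3 : MeasurePreserving (Prod.map WithLp.ofLp id : Tuples k m × ℝ → (Fin k → E m) × ℝ) :=
    h0.prod (MeasurePreserving.id volume)
  have h4 : MeasurePreserving (Prod.map id (Prod.map WithLp.ofLp id ∘ WithLp.ofLp) :
      E (k + m) × WithLp 2 (Tuples k m × ℝ) → E (k + m) × (Fin k → E m) × ℝ) :=
    (MeasurePreserving.id volume).prod (h3.comp h1)
  exact h4.comp h2

/-- The derivative of the chart at `A = 0`. It is isometric, see `norm_chartDeriv`. -/
def chartDeriv (k m : ℕ) : Coords k m →L[ℝ] Triple (k + m) k :=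
  (WithLp.prodContinuousLinearEquiv 2 ℝ (E (k + m))
      (WithLp 2 (KVec (k + m) k × ℝ))).symm.toContinuousLinearMap ∘L
    ContinuousLinearMap.prodMap (ContinuousLinearMap.id ℝ (E (k + m)))
      ((WithLp.prodContinuousLinearEquiv 2 ℝ (KVec (k + m) k) ℝ).symm.toContinuousLinearMap ∘L
        ContinuousLinearMap.prodMap (omegaDeriv k m) (ContinuousLinearMap.id ℝ ℝ) ∘L
        (WithLp.prodContinuousLinearEquiv 2 ℝ (Tuples k m) ℝ).toContinuousLinearMap) ∘L
    (WithLp.prodContinuousLinearEquiv 2 ℝ (E (k + m))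
      (WithLp 2 (Tuples k m × ℝ))).toContinuousLinearMap

theorem norm_chartDeriv (x : Coords k m) : ‖chartDeriv k m x‖ = ‖x‖ := by
  have h : chartDeriv k m x = WithLp.toLp 2 (x.fst, WithLp.toLp 2
    (omegaDeriv k m x.snd.fst, x.snd.snd)) := rfl
  rw [h, ← sq_eq_sq₀ (norm_nonneg _) (norm_nonneg _)]
  simp [WithLp.prod_norm_sq_eq_of_L2, norm_omegaDeriv]

theorem hasStrictFDerivAt_chartTriple (x : Coords k m) (hx : x.snd.fst = 0) :
    HasStrictFDerivAt (fun y : Coords k m => chartTriple (ofCoords y)) (chartDeriv k m) x := by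
  let c₁ := WithLp.prodContinuousLinearEquiv 2 ℝ (E (k + m)) (WithLp 2 (Tuples k m × ℝ))
  let c₂ := WithLp.prodContinuousLinearEquiv 2 ℝ (Tuples k m) ℝ
  let c₃ := WithLp.prodContinuousLinearEquiv 2 ℝ (E (k + m)) (WithLp 2 (KVec (k + m) k × ℝ))
  let c₄ := WithLp.prodContinuousLinearEquiv 2 ℝ (KVec (k + m) k) ℝ
  have hA : HasStrictFDerivAt (fun A : Tuples k m => omega A) (omegaDeriv k m) x.snd.fst := by
    rw [hx]; exact hasStrictFDerivAt_omega
  have h1 : HasStrictFDerivAt (Prod.map (fun A : Tuples k m => (omega A : KVec (k + m) k))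
      (id : ℝ → ℝ)) ((omegaDeriv k m).prodMap (ContinuousLinearMap.id ℝ ℝ)) (c₂ x.snd) :=
    hA.prodMap (c₂ x.snd) (hasStrictFDerivAt_id _)
  have h2 := (c₄.symm.toContinuousLinearMap.hasStrictFDerivAt).comp x.snd
    (h1.comp x.snd c₂.toContinuousLinearMap.hasStrictFDerivAt)
  have h3 := HasStrictFDerivAt.prodMap (c₁ x) (hasStrictFDerivAt_id (𝕜 := ℝ) (c₁ x).1) h2
  exact (c₃.symm.toContinuousLinearMap.hasStrictFDerivAt).comp x
    (h3.comp x c₁.toContinuousLinearMap.hasStrictFDerivAt)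

end Triples

/-! ### Hausdorff measure as a product measure -/

section TripleMeasure

variable {n k m : ℕ}

theorem tripleMeasure_apply_of_inner_pos {B : Set (Triple (k + m) k)} (hB : MeasurableSet B)
    (hpos : ∀ d ∈ B, 0 < inner ℝ (omega₀ k m) d.normal) :
    tripleMeasure k m B = chartVolume k m (chartTriple ⁻¹' B) := by
  have h : chartTripleNeg ⁻¹' B = ∅ := by
    refine eq_empty_of_forall_notMem fun t ht => ?_
    have h1 : 0 < inner ℝ (omega₀ k m) (-omega t.2.1) := hpos _ ht
    rw [inner_neg_right] at h1
    linarith [inner_omega₀_omega_pos t.2.1]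
  rw [tripleMeasure_eq_map, Measure.add_apply,
    Measure.map_apply continuous_chartTriple.measurable hB,
    Measure.map_apply continuous_chartTripleNeg.measurable hB, h, measure_empty, add_zero]

theorem chartTriple_image_preimage {B : Set (Triple (k + m) k)} (hB : B ⊆ diskTriples (k + m) k)
    (hpos : ∀ d ∈ B, 0 < inner ℝ (omega₀ k m) d.normal) :
    chartTriple '' (chartTriple ⁻¹' B) = B := by
  refine image_preimage_eq_of_subset fun d hd => ⟨(d.center, coord d.normal, d.radius), ?_⟩
  rw [chartTriple, omega_coord (hB hd) (hpos d hd)]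
  rfl

theorem nd_zero : nd (0 : Fin k → E m) = 1 := by
  refine (pow_eq_one_iff_of_nonneg (nd_pos _).le two_ne_zero).1 ?_
  rw [nd_sq]
  have h : (Matrix.of fun (j : Fin k) (i : Fin m) => (0 : Fin k → E m) j i) = 0 := rfl
  rw [h, Matrix.zero_mul, add_zero, Matrix.det_one]

theorem continuous_normal : Continuous fun q : Triple n k => q.normal :=
  (continuous_ofTriple (n := n) (k := k)).snd.fst

theorem continuousAt_chartCoords {q : Triple (k + m) k} (hq : inner ℝ (omega₀ k m) q.normal ≠ 0) :
    ContinuousAt (fun q : Triple (k + m) k => (q.center, (coord q.normal : Fin k → E m), q.radius))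
      q := by
  have hc : Continuous fun q : Triple (k + m) k => q.center :=
    (continuous_ofTriple (n := k + m) (k := k)).fst
  have hr : Continuous fun q : Triple (k + m) k => q.radius :=
    (continuous_ofTriple (n := k + m) (k := k)).snd.snd
  have h1 : ContinuousAt (fun q : Triple (k + m) k => (coord q.normal : Fin k → E m)) q :=
    ContinuousAt.comp (g := coord) (f := fun q : Triple (k + m) k => q.normal)
      (continuousAt_coord hq) continuous_normal.continuousAt
  exact hc.continuousAt.prodMk (h1.prodMk hr.continuousAt)

theorem eventually_inner_pos {q : Triple (k + m) k} (hq : 0 < inner ℝ (omega₀ k m) q.normal) :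
    ∀ᶠ q' in 𝓝 q, 0 < inner ℝ (omega₀ k m) q'.normal := by
  have h : Continuous fun q : Triple (k + m) k => (inner ℝ (omega₀ k m) q.normal : ℝ) :=
    continuous_const.inner continuous_normal
  exact (h.tendsto q).eventually_const_lt hq

/-- Near the standard plane, Hausdorff measure and the product measure are nearly equal, because the
derivative of the chart is isometric there and the density of the product measure is one. -/
theorem exists_nhds_comparison_omega₀ (p : E (k + m)) (r : ℝ) {K : ℝ≥0} (hK : 1 < K) {d : ℕ}
    (hd : Module.finrank ℝ (Coords k m) = d) :
    ∃ V ∈ 𝓝 (toTriple (p, omega₀ k m, r)), ∀ B, MeasurableSet B → B ⊆ V →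
      B ⊆ diskTriples (k + m) k →
      (μHE[d] : Measure (Triple (k + m) k)) B ≤ (K : ℝ≥0∞) ^ (d + 1) * tripleMeasure k m B ∧
      tripleMeasure k m B ≤
        (K : ℝ≥0∞) ^ (d + 1) * (μHE[d] : Measure (Triple (k + m) k)) B := by
  let toC : E (k + m) × (Fin k → E m) × ℝ → Coords k m := fun t =>
    WithLp.toLp 2 (t.1, WithLp.toLp 2 (WithLp.toLp 2 t.2.1, t.2.2))
  have htoC : Continuous toC := by fun_prop
  let x₀ : Coords k m := toC (p, 0, r)
  obtain ⟨V₁, hV₁, -, hVB⟩ := exists_nhds_hausdorff_comparison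
    (hasStrictFDerivAt_chartTriple x₀ rfl) norm_chartDeriv hK d
  let g : E (k + m) × (Fin k → E m) × ℝ → ℝ≥0∞ := fun t => ENNReal.ofReal (nd t.2.1)⁻¹ ^ (k + m)
  have hgm : Measurable g := (measurable_weight (k + m)).comp (measurable_fst.comp measurable_snd)
  have hg : Tendsto g (𝓝 (p, 0, r)) (𝓝 1) := by
    have h1 : Continuous fun t : E (k + m) × (Fin k → E m) × ℝ => (nd t.2.1)⁻¹ :=
      (continuous_nd.comp (continuous_fst.comp continuous_snd)).inv₀ fun t => (nd_pos _).ne'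
    have h2 : Continuous g := (ENNReal.continuous_pow _).comp (ENNReal.continuous_ofReal.comp h1)
    have h3 := h2.tendsto (p, 0, r)
    simpa [g, nd_zero] using h3
  have hK1 : (1 : ℝ≥0∞) < K := by exact_mod_cast hK
  have hK0 : (K : ℝ≥0∞) ≠ 0 := (zero_lt_one.trans hK1).ne'
  have hKi : (K : ℝ≥0∞)⁻¹ < 1 := ENNReal.inv_lt_one.2 hK1
  have hW : ∀ᶠ t in 𝓝 ((p, 0, r) : E (k + m) × (Fin k → E m) × ℝ),
      g t ≤ K ∧ (K : ℝ≥0∞)⁻¹ ≤ g t ∧ toC t ∈ V₁ := by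
    filter_upwards [hg.eventually_lt_const hK1, hg.eventually_const_lt hKi,
      htoC.continuousAt.preimage_mem_nhds (show V₁ ∈ 𝓝 (toC (p, 0, r)) from hV₁)] with t h1 h2 h3
    exact ⟨h1.le, h2.le, h3⟩
  have hV : ∀ᶠ q in 𝓝 (toTriple (p, omega₀ k m, r)), 0 < inner ℝ (omega₀ k m) q.normal ∧
      (g (q.center, coord q.normal, q.radius) ≤ K ∧
        (K : ℝ≥0∞)⁻¹ ≤ g (q.center, coord q.normal, q.radius) ∧
        toC (q.center, coord q.normal, q.radius) ∈ V₁) := by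
    have h1 : (0 : ℝ) < inner ℝ (omega₀ k m) (toTriple (p, omega₀ k m, r)).normal := by
      change (0 : ℝ) < inner ℝ (omega₀ k m) (omega₀ k m)
      rw [real_inner_self_eq_norm_sq, norm_omega₀]
      norm_num
    have h3 : coord (omega₀ k m) = (0 : Fin k → E m) := by rw [← omega_zero, coord_omega]
    have h2 := (continuousAt_chartCoords h1.ne').tendsto
    have h4 : ((toTriple (p, omega₀ k m, r)).center,
        (coord (toTriple (p, omega₀ k m, r)).normal : Fin k → E m),
        (toTriple (p, omega₀ k m, r)).radius) = (p, 0, r) := by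
      change (p, (coord (omega₀ k m) : Fin k → E m), r) = _
      rw [h3]
    rw [h4] at h2
    exact (eventually_inner_pos h1).and (h2.eventually hW)
  refine ⟨_, hV, fun B hB hBV hBS => ?_⟩
  have hpos : ∀ q ∈ B, 0 < inner ℝ (omega₀ k m) q.normal := fun q hq => (hBV hq).1
  let B₁ : Set (E (k + m) × (Fin k → E m) × ℝ) := chartTriple ⁻¹' B
  have hB₁m : MeasurableSet B₁ := continuous_chartTriple.measurable hB
  have hB₁ : ∀ t ∈ B₁, g t ≤ K ∧ (K : ℝ≥0∞)⁻¹ ≤ g t ∧ toC t ∈ V₁ := by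
    intro t ht
    have h1 := (hBV ht).2
    have h2 : ((chartTriple t).center, (coord (chartTriple t).normal : Fin k → E m),
        (chartTriple t).radius) = t := by
      change (t.1, (coord (omega t.2.1) : Fin k → E m), t.2.2) = t
      rw [coord_omega]
    rwa [h2] at h1
  have hΛ : tripleMeasure k m B = ∫⁻ t in B₁, g t := by
    rw [tripleMeasure_apply_of_inner_pos hB hpos, chartVolume_eq_withDensity,
      withDensity_apply _ hB₁m]
  have hle : tripleMeasure k m B ≤ K * volume B₁ := by
    rw [hΛ, ← setLIntegral_const]
    exact setLIntegral_mono' hB₁m fun t ht => (hB₁ t ht).1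
  have hge : volume B₁ ≤ K * tripleMeasure k m B := by
    rw [hΛ, ← lintegral_const_mul _ hgm, ← setLIntegral_one]
    refine setLIntegral_mono' hB₁m fun t ht => ?_
    rw [← ENNReal.mul_inv_cancel hK0 (by simp : (K : ℝ≥0∞) ≠ ⊤)]
    gcongr
    exact (hB₁ t ht).2.1
  let B₂ : Set (Coords k m) := ofCoords ⁻¹' B₁
  have hB₂ : B₂ ⊆ V₁ := fun x hx => (hB₁ _ hx).2.2
  have hvol : (μHE[d] : Measure (Coords k m)) B₂ = volume B₁ := by
    rw [← hd, InnerProductSpace.euclideanHausdorffMeasure_eq_volume]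
    exact measurePreserving_ofCoords.measure_preimage hB₁m.nullMeasurableSet
  have himg : (fun y : Coords k m => (chartTriple (ofCoords y) : Triple (k + m) k)) '' B₂ = B := by
    have h1 : ofCoords '' B₂ = B₁ := image_preimage_eq _ fun t => ⟨toC t, rfl⟩
    rw [← chartTriple_image_preimage hBS hpos, ← image_image (g := chartTriple), h1]
  obtain ⟨h1, h2⟩ := hVB B₂ hB₂
  rw [himg, hvol] at h1 h2
  rw [pow_succ]
  constructor
  · calc _ ≤ (K : ℝ≥0∞) ^ d * volume B₁ := h1
      _ ≤ (K : ℝ≥0∞) ^ d * (K * tripleMeasure k m B) := by gcongr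
      _ = _ := by rw [mul_assoc]
  · calc _ ≤ K * volume B₁ := hle
      _ ≤ K * ((K : ℝ≥0∞) ^ d * (μHE[d] : Measure (Triple (k + m) k)) B) := by gcongr
      _ = _ := by ring

theorem rot_symm_apply (Q : E n ≃ₗᵢ[ℝ] E n) (w : KVec n k) :
    (rot k Q).symm w = rot k Q.symm w := rfl

/-- The group of isometries acts transitively on the unit simple `k`-vectors. -/
theorem exists_isometry_omega₀ {w : KVec (k + m) k} (hw : w ∈ unitSimple (k + m) k) :
    ∃ R : KVec (k + m) k ≃ₗᵢ[ℝ] KVec (k + m) k, R (omega₀ k m) = w ∧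
      (orientedMeasure k m).map R = orientedMeasure k m ∧
      ∀ v, R v ∈ unitSimple (k + m) k → v ∈ unitSimple (k + m) k := by
  obtain ⟨G, hG, hwG⟩ := mem_unitSimple_iff.1 hw
  obtain ⟨Q, hQ⟩ := exists_rotation hG
  have h2 : w = rot k Q (omega₀ k m) ∨ w = -rot k Q (omega₀ k m) := by
    rcases hwG with rfl | rfl <;> rcases hQ with h | h <;> simp [h]
  have hmem : ∀ v, rot k Q v ∈ unitSimple (k + m) k → v ∈ unitSimple (k + m) k := by
    intro v hv
    have := rot_mem_unitSimple Q.symm hv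
    rwa [← rot_symm_apply, LinearIsometryEquiv.symm_apply_apply] at this
  rcases h2 with rfl | rfl
  · exact ⟨rot k Q, rfl, map_rot_orientedMeasure Q, hmem⟩
  · refine ⟨(rot k Q).trans (LinearIsometryEquiv.neg ℝ), rfl, ?_, fun v hv => hmem v ?_⟩
    · have h3 : ((rot k Q).trans (LinearIsometryEquiv.neg ℝ) : KVec (k + m) k → KVec (k + m) k) =
          (fun w => -w) ∘ rot k Q := rfl
      rw [h3, ← Measure.map_map continuous_neg.measurable (rot k Q).continuous.measurable,
        map_rot_orientedMeasure, map_neg_orientedMeasure]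
    · have h4 := neg_mem_unitSimple hv
      have h5 : ((rot k Q).trans (LinearIsometryEquiv.neg ℝ)) v = -rot k Q v := rfl
      rwa [h5, neg_neg] at h4

/-- By homogeneity, the comparison near the standard plane carries over to all oriented planes. -/
theorem exists_nhds_comparison {q : Triple (k + m) k} (hq : q ∈ diskTriples (k + m) k)
    {K : ℝ≥0} (hK : 1 < K) {d : ℕ} (hd : Module.finrank ℝ (Coords k m) = d) :
    ∃ V ∈ 𝓝 q, ∀ B, MeasurableSet B → B ⊆ V → B ⊆ diskTriples (k + m) k →
      (μHE[d] : Measure (Triple (k + m) k)) B ≤ (K : ℝ≥0∞) ^ (d + 1) * tripleMeasure k m B ∧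
      tripleMeasure k m B ≤
        (K : ℝ≥0∞) ^ (d + 1) * (μHE[d] : Measure (Triple (k + m) k)) B := by
  obtain ⟨R, hR, hRm, hRu⟩ := exists_isometry_omega₀ hq
  obtain ⟨V, hV, hVB⟩ := exists_nhds_comparison_omega₀ q.center q.radius hK hd
  let I := tripleIso R
  have hI : I (toTriple (q.center, omega₀ k m, q.radius)) = q := by
    rw [tripleIso_toTriple, hR]; rfl
  refine ⟨I.symm ⁻¹' V, I.symm.continuous.continuousAt.preimage_mem_nhds ?_,
    fun B hB hBV hBS => ?_⟩
  · rw [← hI, LinearIsometryEquiv.symm_apply_apply]; exact hV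
  have hIm : Measurable I := I.continuous.measurable
  have h1 := hVB (I ⁻¹' B) (hIm hB) (fun t ht => by
    have := hBV ht
    rwa [mem_preimage, LinearIsometryEquiv.symm_apply_apply] at this)
    (fun t ht => hRu _ (hBS ht))
  have h2 : (μHE[d] : Measure (Triple (k + m) k)) (I ⁻¹' B) = μHE[d] B :=
    (I.toIsometryEquiv.measurePreserving_euclideanHausdorffMeasure d).measure_preimage
      hB.nullMeasurableSet
  have h3 : tripleMeasure k m (I ⁻¹' B) = tripleMeasure k m B := by
    rw [← Measure.map_apply hIm hB, map_tripleIso R hRm]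
  rwa [h2, h3] at h1

theorem tripleMeasure_compl_diskTriples : tripleMeasure k m (diskTriples (k + m) k)ᶜ = 0 := by
  have hm := (measurableSet_diskTriples (k := k) (m := m)).compl
  have h1 : chartTriple ⁻¹' (diskTriples (k + m) k)ᶜ = ∅ :=
    eq_empty_of_forall_notMem fun t ht => ht (omega_mem t.2.1)
  have h2 : chartTripleNeg ⁻¹' (diskTriples (k + m) k)ᶜ = ∅ :=
    eq_empty_of_forall_notMem fun t ht => ht (neg_mem_unitSimple (omega_mem t.2.1))
  rw [tripleMeasure_eq_map, Measure.add_apply,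
    Measure.map_apply continuous_chartTriple.measurable hm,
    Measure.map_apply continuous_chartTripleNeg.measurable hm, h1, h2, measure_empty, add_zero]

/-- On the space of oriented disks, Hausdorff measure is the product of Lebesgue measure and the
invariant measure on oriented planes. -/
theorem restrict_diskTriples_eq {d : ℕ} (hd : Module.finrank ℝ (Coords k m) = d) :
    (μHE[d] : Measure (Triple (k + m) k)).restrict (diskTriples (k + m) k) =
      tripleMeasure k m := by
  refine Measure.ext fun B hB => ?_
  have hS := measurableSet_diskTriples (k := k) (m := m)
  have hΛ : tripleMeasure k m B = tripleMeasure k m (B ∩ diskTriples (k + m) k) :=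
    (measure_inter_conull' (measure_mono_null (fun x hx => hx.2)
      tripleMeasure_compl_diskTriples)).symm
  rw [Measure.restrict_apply hB, hΛ]
  set s := B ∩ diskTriples (k + m) k
  have hs : MeasurableSet s := hB.inter hS
  have hsub : s ⊆ diskTriples (k + m) k := inter_subset_right
  refine le_antisymm ?_ ?_ <;> refine le_of_forall_one_lt_le_pow_mul (d + 1) fun K hK => ?_
  · refine le_of_locally_le (ν := ⇑((K : ℝ≥0∞) ^ (d + 1) • tripleMeasure k m)) hs
      (isAdditiveOn_measure _ _) (isAdditiveOn_measure _ _) measure_empty fun x hx => ?_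
    obtain ⟨V, hV, h⟩ := exists_nhds_comparison (hsub hx) hK hd
    exact ⟨V, mem_nhdsWithin_of_mem_nhds hV, fun B hB hBV hBs =>
      (h B hB hBV (hBs.trans hsub)).1⟩
  · refine le_of_locally_le (ν := ⇑((K : ℝ≥0∞) ^ (d + 1) •
      (μHE[d] : Measure (Triple (k + m) k)))) hs
      (isAdditiveOn_measure _ _) (isAdditiveOn_measure _ _) measure_empty fun x hx => ?_
    obtain ⟨V, hV, h⟩ := exists_nhds_comparison (hsub hx) hK hd
    exact ⟨V, mem_nhdsWithin_of_mem_nhds hV, fun B hB hBV hBs =>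
      (h B hB hBV (hBs.trans hsub)).2⟩

theorem finrank_coords : Module.finrank ℝ (Coords k m) = (k + m) + k * (k + m - k) + 1 := by
  rw [Nat.add_sub_cancel_left]
  have h1 : Module.finrank ℝ (Coords k m) =
      Module.finrank ℝ (E (k + m) × (Fin k → E m) × ℝ) := by
    let e₂ : WithLp 2 (Tuples k m × ℝ) ≃ₗ[ℝ] (Fin k → E m) × ℝ :=
      (WithLp.linearEquiv 2 ℝ (Tuples k m × ℝ)).trans
        (LinearEquiv.prodCongr (WithLp.linearEquiv 2 ℝ (Fin k → E m)) (LinearEquiv.refl ℝ ℝ))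
    exact ((WithLp.linearEquiv 2 ℝ (E (k + m) × WithLp 2 (Tuples k m × ℝ))).trans
      (LinearEquiv.prodCongr (LinearEquiv.refl ℝ (E (k + m))) e₂)).finrank_eq
  rw [h1, Module.finrank_prod, Module.finrank_prod, Module.finrank_pi_fintype]
  simp
  ring

/-- Integration over a set of oriented disks, in the coordinates of the two charts. -/
theorem setLIntegral_diskTriples {O : Set (Triple (k + m) k)} (hO : O ⊆ diskTriples (k + m) k)
    (f : Triple (k + m) k → ℝ≥0∞) :
    ∫⁻ d in O, f d ∂(μHE[(k + m) + k * (k + m - k) + 1] : Measure (Triple (k + m) k)) =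
      ∫⁻ t in chartTriple ⁻¹' O, f (chartTriple t) ∂chartVolume k m +
        ∫⁻ t in chartTripleNeg ⁻¹' O, f (chartTripleNeg t) ∂chartVolume k m := by
  have h₁ : MeasurableEmbedding (chartTriple : _ → Triple (k + m) k) :=
    continuous_chartTriple.measurableEmbedding chartTriple_injective
  have h₂ : MeasurableEmbedding (chartTripleNeg : _ → Triple (k + m) k) :=
    continuous_chartTripleNeg.measurableEmbedding chartTripleNeg_injective
  rw [← Measure.restrict_restrict_of_subset hO, restrict_diskTriples_eq finrank_coords,
    tripleMeasure_eq_map, Measure.restrict_add, lintegral_add_measure, h₁.restrict_map,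
    h₂.restrict_map, h₁.lintegral_map, h₂.lintegral_map]

end TripleMeasure

/-! ### Bounded manifolds with boundary -/

section Manifold

variable {n k m : ℕ}

/-- The interior points of the manifold with boundary `X`. -/
def interiorPart (k : ℕ) (X : Set (E n)) : Set (E n) := {z ∈ X | IsInteriorPoint k X z}

theorem interiorPart_subset (k : ℕ) (X : Set (E n)) : interiorPart k X ⊆ X := fun _ h => h.1

theorem exists_isOpen_interiorPart (k : ℕ) (X : Set (E n)) :
    ∃ O : Set (E n), IsOpen O ∧ interiorPart k X = X ∩ O := by
  let O : Set (E n) := ⋃₀ {S | IsOpen S ∧ X ∩ S ⊆ interiorPart k X}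
  refine ⟨O, isOpen_sUnion fun S hS => hS.1, Subset.antisymm (fun z hz => ⟨hz.1, ?_⟩) ?_⟩
  · obtain ⟨φ, hφ, hX⟩ := hz.2
    exact ⟨φ.source, ⟨φ.open_source, fun x hx => ⟨hx.1, φ, ⟨hx.2, hφ.2⟩, hX⟩⟩, hφ.1⟩
  · rintro x ⟨hx, S, hS, hxS⟩
    exact hS.2 ⟨hx, hxS⟩

/-- A parametrized piece of the manifold with boundary `X` near `z`: on the open set `V`, the map
`ψ` is an injective immersion of class `C¹`, and on the part of `X` in the open set `U`, it is
inverted by a map `π` which is continuous on all of `U`. As `V` is open also at the parameters of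
boundary points of `X`, the image of `ψ` may contain points which do not belong to `X`. -/
structure Param (k : ℕ) (X : Set (E n)) (z : E n) where
  /-- The parametrization. -/
  ψ : E k → E n
  /-- The derivative of the parametrization. -/
  ψ' : E k → E k →L[ℝ] E n
  /-- An extension of the inverse of the parametrization. -/
  π : E n → E k
  /-- The domain of the parametrization. -/
  V : Set (E k)
  /-- A neighbourhood of `z` in which the manifold is parametrized. -/
  U : Set (E n)
  /-- A set of measure zero containing the parameters of the boundary points. -/
  H : Set (E k)
  isOpen_V : IsOpen V
  isOpen_U : IsOpen U
  mem_U : z ∈ U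
  hasStrictFDerivAt : ∀ u ∈ V, HasStrictFDerivAt ψ (ψ' u) u
  continuousOn_deriv : ContinuousOn ψ' V
  injective_deriv : ∀ u ∈ V, Function.Injective (ψ' u)
  injOn : InjOn ψ V
  continuousOn_π : ContinuousOn π U
  π_mem : ∀ x ∈ X ∩ U, π x ∈ V
  ψ_π : ∀ x ∈ X ∩ U, ψ (π x) = x
  volume_H : volume H = 0
  π_mem_H : ∀ x ∈ X ∩ U, x ∉ interiorPart k X → π x ∈ H

theorem volume_coordinate_hyperplane (j : Fin k) : volume {u : E k | u j = 0} = 0 := by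
  let p : E k →ₗ[ℝ] ℝ := (EuclideanSpace.proj j : E k →L[ℝ] ℝ)
  have h : {u : E k | u j = 0} = (LinearMap.ker p : Set (E k)) := by
    ext u; simp [p]
  rw [h]
  refine Measure.addHaar_submodule _ _ fun htop => ?_
  have h1 : EuclideanSpace.single j (1 : ℝ) ∈ LinearMap.ker p := htop ▸ Submodule.mem_top
  simp [p] at h1

theorem eq_join_of_apply_eq_zero {y : E (k + m)} (h : ∀ i : Fin (k + m), k ≤ (i : ℕ) → y i = 0) :
    y = join (((joinL k m).symm y).1, 0) := by
  have h1 : join ((joinL k m).symm y) = y := (joinL k m).apply_symm_apply y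
  have h2 : ((joinL k m).symm y).2 = 0 := by
    ext i
    have h3 := join_apply_natAdd ((joinL k m).symm y) i
    rw [h1, h (Fin.natAdd k i) (by simp)] at h3
    exact h3.symm
  conv_lhs => rw [← h1]
  rw [← h2]

/-- The parametrization obtained from a chart of the ambient space. -/
def paramOfChart {X : Set (E (k + m))} {z : E (k + m)}
    (φ : OpenPartialHomeomorph (E (k + m)) (E (k + m))) (hφ : IsSmoothChartAt φ z) (H : Set (E k))
    (hH : volume H = 0) (hX : ∀ x ∈ X ∩ φ.source, ∀ i : Fin (k + m), k ≤ (i : ℕ) → φ x i = 0)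
    (hXH : ∀ x ∈ X ∩ φ.source, x ∉ interiorPart k X → ((joinL k m).symm (φ x)).1 ∈ H) :
    Param k X z := by
  let ι : E k →L[ℝ] E (k + m) :=
    (joinL k m : E k × E m →L[ℝ] E (k + m)) ∘L ContinuousLinearMap.inl ℝ (E k) (E m)
  have hι : Function.Injective ι :=
    (joinL k m).injective.comp fun u v h => congrArg Prod.fst h
  have hstrict : ∀ y ∈ φ.target, HasStrictFDerivAt φ.symm (fderiv ℝ φ.symm y) y := fun y hy =>
    (hφ.2.2.contDiffAt (φ.open_target.mem_nhds hy)).hasStrictFDerivAt (by simp)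
  exact
    { ψ := fun u => φ.symm (ι u)
      ψ' := fun u => fderiv ℝ φ.symm (ι u) ∘L ι
      π := fun x => ((joinL k m).symm (φ x)).1
      V := ι ⁻¹' φ.target
      U := φ.source
      H := H
      isOpen_V := φ.open_target.preimage ι.continuous
      isOpen_U := φ.open_source
      mem_U := hφ.1
      hasStrictFDerivAt := fun u hu => (hstrict _ hu).comp u ι.hasStrictFDerivAt
      continuousOn_deriv := by
        have h1 := hφ.2.2.continuousOn_fderiv_of_isOpen φ.open_target (by simp)
        exact (h1.comp ι.continuous.continuousOn fun u hu => hu).clm_comp continuousOn_const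
      injective_deriv := fun u hu => by
        have h1 : DifferentiableAt ℝ φ (φ.symm (ι u)) :=
          ((hφ.2.1.contDiffAt (φ.open_source.mem_nhds (φ.map_target hu))).differentiableAt
            (by simp))
        have h2 := h1.hasFDerivAt.comp (ι u) (hstrict _ hu).hasFDerivAt
        have h3 : HasFDerivAt (φ ∘ φ.symm) (ContinuousLinearMap.id ℝ (E (k + m))) (ι u) :=
          (hasFDerivAt_id _).congr_of_eventuallyEq
            (eventually_of_mem (φ.open_target.mem_nhds hu) fun y hy => φ.right_inv hy)
        have h4 := h2.unique h3
        refine Function.Injective.comp (g := fderiv ℝ φ.symm (ι u)) (fun a b hab => ?_) hι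
        have h5 := congrArg (fderiv ℝ φ (φ.symm (ι u))) hab
        rwa [← ContinuousLinearMap.comp_apply, ← ContinuousLinearMap.comp_apply, h4] at h5
      injOn := fun u hu v hv h => hι (φ.symm.injOn hu hv h)
      continuousOn_π := continuous_fst.comp_continuousOn
        ((joinL k m).symm.continuous.comp_continuousOn φ.continuousOn)
      π_mem := fun x hx => by
        have h1 := eq_join_of_apply_eq_zero (hX x hx)
        change join (((joinL k m).symm (φ x)).1, 0) ∈ φ.target
        rw [← h1]
        exact φ.map_source hx.2
      ψ_π := fun x hx => by
        have h1 := eq_join_of_apply_eq_zero (hX x hx)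
        change φ.symm (join (((joinL k m).symm (φ x)).1, 0)) = x
        rw [← h1]
        exact φ.left_inv hx.2
      volume_H := hH
      π_mem_H := hXH }

/-- In a chart at a boundary point, the points of the open half-plane are interior points. -/
theorem isInteriorPoint_of_pos {X : Set (E n)} {z : E n} {φ : OpenPartialHomeomorph (E n) (E n)}
    (hφ : IsSmoothChartAt φ z) {j : Fin n}
    (hX : ∀ x ∈ φ.source, x ∈ X ↔ (∀ i : Fin n, k ≤ (i : ℕ) → φ x i = 0) ∧ 0 ≤ φ x j)
    {x : E n} (hx : x ∈ φ.source) (hpos : 0 < φ x j) : IsInteriorPoint k X x := by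
  have ho : IsOpen {y : E n | 0 < y j} := isOpen_lt continuous_const (by fun_prop)
  have hs : IsOpen (φ.source ∩ φ ⁻¹' {y : E n | 0 < y j}) :=
    φ.continuousOn.isOpen_inter_preimage φ.open_source ho
  let χ := φ.restrOpen _ hs
  have hsrc : χ.source ⊆ φ.source := fun y hy => hy.1
  have htgt : χ.target ⊆ φ.target := fun y hy => hy.1
  refine ⟨χ, ⟨⟨hx, hx, hpos⟩, hφ.2.1.mono hsrc, hφ.2.2.mono htgt⟩, fun y hy => ?_⟩
  have hy1 : 0 < φ y j := hy.2.2
  change y ∈ X ↔ ∀ i : Fin n, k ≤ (i : ℕ) → φ y i = 0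
  rw [hX y hy.1]
  exact and_iff_left hy1.le

theorem exists_param {M : Set (E (k + m))} (hM : IsBoundedManifold k M) {z : E (k + m)}
    (hz : z ∈ closure M) : Nonempty (Param k (closure M) z) := by
  rcases hM.interior_or_boundary z hz with ⟨φ, hφ, hX⟩ | ⟨φ, hφ, j, hj, -, hX⟩
  · refine ⟨paramOfChart φ hφ ∅ measure_empty (fun x hx => (hX x hx.2).1 hx.1) fun x hx hx' => ?_⟩
    exact absurd ⟨hx.1, φ, ⟨hx.2, hφ.2⟩, hX⟩ hx'
  · refine ⟨paramOfChart φ hφ {u | u ⟨j, hj⟩ = 0} (volume_coordinate_hyperplane _)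
      (fun x hx => ((hX x hx.2).1 hx.1).1) fun x hx hx' => ?_⟩
    have h1 := ((hX x hx.2).1 hx.1).2
    have h2 : φ x j = 0 := by
      refine le_antisymm (not_lt.1 fun hpos => hx' ⟨hx.1, ?_⟩) h1
      exact isInteriorPoint_of_pos hφ hX hx.2 hpos
    have h3 := join_apply_castAdd ((joinL k m).symm (φ x)) ⟨j, hj⟩
    have h4 : join ((joinL k m).symm (φ x)) = φ x := (joinL k m).apply_symm_apply _
    rw [h4] at h3
    change ((joinL k m).symm (φ x)).1 ⟨j, hj⟩ = 0
    rw [← h3]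
    exact h2

theorem isCompact_closure {M : Set (E n)} (hM : IsBoundedManifold k M) : IsCompact (closure M) :=
  hM.isBounded.isCompact_closure

/-- Near each of its points, a manifold has finite measure and its boundary has measure zero. -/
theorem exists_nhds_measure {X : Set (E n)} {z : E n} (P : Param k X z) (hz : z ∈ X) :
    ∃ W ∈ 𝓝 z, (μHE[k] : Measure (E n)) (X ∩ W) < ⊤ ∧
      (μHE[k] : Measure (E n)) ((X \ interiorPart k X) ∩ W) = 0 := by
  have hzU : z ∈ X ∩ P.U := ⟨hz, P.mem_U⟩
  obtain ⟨K, s, hs, hK⟩ := (P.hasStrictFDerivAt _ (P.π_mem z hzU)).exists_lipschitzOnWith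
  have hs' : s ∩ Metric.ball (P.π z) 1 ∈ 𝓝 (P.π z) :=
    inter_mem hs (Metric.ball_mem_nhds _ one_pos)
  have hvol : ∀ t : Set (E k), (μHE[k] : Measure (E k)) t = volume t := fun t => by
    rw [EuclideanSpace.euclideanHausdorffMeasure_eq_volume]
  refine ⟨P.U ∩ P.π ⁻¹' (s ∩ Metric.ball (P.π z) 1), inter_mem (P.isOpen_U.mem_nhds P.mem_U)
    ((P.continuousOn_π.continuousAt (P.isOpen_U.mem_nhds P.mem_U)).preimage_mem_nhds hs'), ?_, ?_⟩
  · have h1 : X ∩ (P.U ∩ P.π ⁻¹' (s ∩ Metric.ball (P.π z) 1)) ⊆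
        P.ψ '' (s ∩ Metric.ball (P.π z) 1) := fun x hx => ⟨P.π x, hx.2.2, P.ψ_π x ⟨hx.1, hx.2.1⟩⟩
    refine (measure_mono h1).trans_lt ((euclideanHausdorffMeasure_image_le_of_lipschitzOnWith
      (hK.mono inter_subset_left) k).trans_lt ?_)
    rw [hvol]
    exact ENNReal.mul_lt_top (by simp)
      ((measure_mono inter_subset_right).trans_lt measure_ball_lt_top)
  · have h1 : (X \ interiorPart k X) ∩ (P.U ∩ P.π ⁻¹' (s ∩ Metric.ball (P.π z) 1)) ⊆
        P.ψ '' (s ∩ P.H) := fun x hx =>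
      ⟨P.π x, ⟨hx.2.2.1, P.π_mem_H x ⟨hx.1.1, hx.2.1⟩ hx.1.2⟩, P.ψ_π x ⟨hx.1.1, hx.2.1⟩⟩
    refine measure_mono_null h1 (le_antisymm ((euclideanHausdorffMeasure_image_le_of_lipschitzOnWith
      (hK.mono inter_subset_left) k).trans ?_) (zero_le))
    rw [hvol, measure_mono_null inter_subset_right P.volume_H, mul_zero]

theorem euclideanHausdorffMeasure_closure_lt_top {M : Set (E (k + m))}
    (hM : IsBoundedManifold k M) : (μHE[k] : Measure (E (k + m))) (closure M) < ⊤ := by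
  refine (isCompact_closure hM).measure_lt_top_of_nhdsWithin fun z hz => ?_
  obtain ⟨P⟩ := exists_param hM hz
  obtain ⟨W, hW, h, -⟩ := exists_nhds_measure P hz
  exact ⟨closure M ∩ W, inter_mem_nhdsWithin _ hW, h⟩

theorem euclideanHausdorffMeasure_boundary {M : Set (E (k + m))} (hM : IsBoundedManifold k M) :
    (μHE[k] : Measure (E (k + m))) (closure M \ interiorPart k (closure M)) = 0 := by
  refine measure_null_of_locally_null _ fun z hz => ?_
  obtain ⟨P⟩ := exists_param hM hz.1
  obtain ⟨W, hW, -, h⟩ := exists_nhds_measure P hz.1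
  exact ⟨_, inter_mem_nhdsWithin _ hW, h⟩

theorem interiorPart_subset_manifold {M : Set (E n)} (hM : IsBoundedManifold k M) :
    interiorPart k (closure M) ⊆ M := fun z hz => hM.interior_subset z hz.1 hz.2

theorem euclideanHausdorffMeasure_interiorPart {M : Set (E (k + m))} (hM : IsBoundedManifold k M) :
    (μHE[k] : Measure (E (k + m))) (interiorPart k (closure M)) = μHE[k] M := by
  refine le_antisymm (measure_mono (interiorPart_subset_manifold hM)) ?_
  calc (μHE[k] : Measure (E (k + m))) M
      ≤ μHE[k] (interiorPart k (closure M) ∪ (closure M \ interiorPart k (closure M))) := by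
        refine measure_mono fun x hx => ?_
        by_cases h : x ∈ interiorPart k (closure M)
        · exact Or.inl h
        · exact Or.inr ⟨subset_closure hx, h⟩
    _ ≤ _ := measure_union_le _ _
    _ = _ := by rw [euclideanHausdorffMeasure_boundary hM, add_zero]

theorem measurableSet_interiorPart {X : Set (E n)} (hX : IsClosed X) :
    MeasurableSet (interiorPart k X) := by
  obtain ⟨O, hO, h⟩ := exists_isOpen_interiorPart k X
  rw [h]
  exact hX.measurableSet.inter hO.measurableSet

/-- The projection of the boundary to the orthogonal complement of a disk is negligible. -/
theorem volume_image_boundary {M : Set (E (k + m))} (hM : IsBoundedManifold k M)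
    (L : E (k + m) →L[ℝ] E k) :
    volume (L '' (closure M \ interiorPart k (closure M))) = 0 := by
  rw [← EuclideanSpace.euclideanHausdorffMeasure_eq_volume]
  refine le_antisymm ((euclideanHausdorffMeasure_image_le_of_lipschitzOnWith
    (L.lipschitz.lipschitzOnWith) k).trans ?_) zero_le
  rw [euclideanHausdorffMeasure_boundary hM, mul_zero]

end Manifold

/-! ### The integral-geometric formula -/

section Crofton

variable {k m : ℕ}

/-- The number of points of `S` over the point `z` of `ℝᵏ`, projecting along the orthogonal
complement of the graph of the map with columns `A`. -/
def fiberCount (S : Set (E (k + m))) (A : Fin k → E m) (z : E k) : ℝ≥0∞ :=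
  Measure.count (S ∩ coef (graph A) ⁻¹' {z})

theorem continuous_coef {V : Type*} [NormedAddCommGroup V] [InnerProductSpace ℝ V]
    [CompleteSpace V] : Continuous (coef : (Fin k → V) → V →L[ℝ] E k) := by
  have h : (coef : (Fin k → V) → V →L[ℝ] E k) =
      fun G => ContinuousLinearMap.adjoint (lin G) := funext fun G => (adjoint_lin G).symm
  rw [h]
  exact (ContinuousLinearMap.adjoint (𝕜 := ℝ)).continuous.comp continuous_lin

theorem measure_count_image {X Y : Type*} [MeasurableSpace X] [MeasurableSingletonClass X]
    [MeasurableSpace Y] [MeasurableSingletonClass Y] {f : X → Y} {s : Set X}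
    (hf : InjOn f s) : Measure.count (f '' s) = Measure.count s := by
  rcases s.finite_or_infinite with h | h
  · rw [Measure.count_apply h.measurableSet, Measure.count_apply (h.image f).measurableSet,
      hf.encard_image]
  · rw [Measure.count_apply_infinite h, Measure.count_apply_infinite (h.image hf)]

/-- The integral-geometric formula for a subset of a parametrized piece. -/
theorem lintegral_fiberCount_of_param {X : Set (E (k + m))} {z : E (k + m)} (P : Param k X z)
    {B : Set (E (k + m))} (hB : MeasurableSet B) (hBX : B ⊆ X ∩ P.U) :
    (∀ A, AEMeasurable (fiberCount B A)) ∧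
    Measurable (fun A : Fin k → E m => ∫⁻ z, fiberCount B A z) ∧
    ∫⁻ A : Fin k → E m, (∫⁻ z, fiberCount B A z) * ENNReal.ofReal (nd A)⁻¹ ^ (k + (m + 1)) =
      chartConst k m * (μHE[k] : Measure (E (k + m))) B := by
  let s : Set (E k) := P.V ∩ P.ψ ⁻¹' B
  have hψc : ContinuousOn P.ψ P.V := fun u hu =>
    (P.hasStrictFDerivAt u hu).continuousAt.continuousWithinAt
  have hs : MeasurableSet s := by
    have h1 := (continuousOn_iff_continuous_domRestrict.1 hψc).measurable hB
    have h2 : s = Subtype.val '' (P.V.domRestrict P.ψ ⁻¹' B) := by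
      ext u
      simp [s, and_comm]
    rw [h2]
    exact P.isOpen_V.measurableSet.subtype_image h1
  have hsV : s ⊆ P.V := inter_subset_left
  have himg : P.ψ '' s = B := by
    refine Subset.antisymm (by rintro _ ⟨u, hu, rfl⟩; exact hu.2) fun x hx => ?_
    have h := P.ψ_π x (hBX hx)
    exact ⟨P.π x, ⟨P.π_mem x (hBX hx), by rw [mem_preimage, h]; exact hx⟩, h⟩
  have hinj : InjOn P.ψ s := P.injOn.mono hsV
  have hcount : ∀ (A : Fin k → E m) (z : E k), fiberCount B A z =
      Measure.count (s ∩ (fun u => coef (graph A) (P.ψ u)) ⁻¹' {z}) := by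
    intro A z
    rw [fiberCount, ← measure_count_image (hinj.mono (inter_subset_left (t :=
      (fun u => coef (graph A) (P.ψ u)) ⁻¹' {z})))]
    congr 1
    rw [← himg]
    ext x
    constructor
    · rintro ⟨⟨u, hu, rfl⟩, hx⟩
      exact ⟨u, ⟨hu, hx⟩, rfl⟩
    · rintro ⟨u, ⟨hu, hx⟩, rfl⟩
      exact ⟨⟨u, hu, rfl⟩, hx⟩
  have harea : ∀ A : Fin k → E m, AEMeasurable (fiberCount B A) ∧ ∫⁻ z, fiberCount B A z =
      ∫⁻ u in s, ENNReal.ofReal |(coef (graph A) ∘L P.ψ' u).det| := by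
    intro A
    have h := lintegral_count_preimage_eq_lintegral_abs_det (volume : Measure (E k))
      (f := fun u => coef (graph A) (P.ψ u)) (f' := fun u => coef (graph A) ∘L P.ψ' u) hs
      (fun u hu => (coef (graph A)).hasStrictFDerivAt.comp u (P.hasStrictFDerivAt u (hsV hu)))
      (continuousOn_const.clm_comp (P.continuousOn_deriv.mono hsV))
    simp_rw [← hcount] at h
    exact h
  -- A globally measurable extension of the derivative.
  let D : E k → E k →L[ℝ] E (k + m) := s.indicator P.ψ'
  have hD : Measurable D := by
    classical
    rw [show D = s.piecewise P.ψ' 0 from (piecewise_eq_indicator).symm]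
    exact (P.continuousOn_deriv.mono hsV).measurable_piecewise continuousOn_const hs
  have hDs : ∀ u ∈ s, D u = P.ψ' u := fun u hu => indicator_of_mem hu _
  have hjoint : Measurable fun p : (Fin k → E m) × E k =>
      ENNReal.ofReal |(coef (graph p.1) ∘L D p.2).det| := by
    have h1 : Measurable fun p : (Fin k → E m) × E k => (coef (graph p.1), D p.2) :=
      ((continuous_coef.comp continuous_graph).measurable.comp measurable_fst).prodMk
        (hD.comp measurable_snd)
    have h2 : Continuous fun q : (E (k + m) →L[ℝ] E k) × (E k →L[ℝ] E (k + m)) =>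
        (q.1 ∘L q.2).det :=
      ContinuousLinearMap.continuous_det.comp (continuous_fst.clm_comp continuous_snd)
    exact (h2.measurable.comp h1).abs.ennreal_ofReal
  have hinner : ∀ A : Fin k → E m, ∫⁻ z, fiberCount B A z =
      ∫⁻ u in s, ENNReal.ofReal |(coef (graph A) ∘L D u).det| := by
    intro A
    rw [(harea A).2]
    exact setLIntegral_congr_fun hs fun u hu => by simp only [hDs u hu]
  refine ⟨fun A => (harea A).1, ?_, ?_⟩
  · simp_rw [hinner]
    exact hjoint.lintegral_prod_right'
  have hw := measurable_weight (k := k) (m := m) (k + (m + 1))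
  have hjoint2 : Measurable fun p : (Fin k → E m) × E k =>
      ENNReal.ofReal |(coef (graph p.1) ∘L D p.2).det| *
        ENNReal.ofReal (nd p.1)⁻¹ ^ (k + (m + 1)) := hjoint.mul (hw.comp measurable_fst)
  calc ∫⁻ A : Fin k → E m, (∫⁻ z, fiberCount B A z) * ENNReal.ofReal (nd A)⁻¹ ^ (k + (m + 1))
      = ∫⁻ A : Fin k → E m, ∫⁻ u in s, ENNReal.ofReal |(coef (graph A) ∘L D u).det| *
          ENNReal.ofReal (nd A)⁻¹ ^ (k + (m + 1)) := by
        refine lintegral_congr fun A => ?_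
        rw [hinner A, lintegral_mul_const' _ _ (by simp)]
    _ = ∫⁻ u in s, ∫⁻ A : Fin k → E m, ENNReal.ofReal |(coef (graph A) ∘L D u).det| *
          ENNReal.ofReal (nd A)⁻¹ ^ (k + (m + 1)) :=
        lintegral_lintegral_swap hjoint2.aemeasurable
    _ = ∫⁻ u in s, chartConst k m *
          ENNReal.ofReal (P.ψ' u : E k →ₗ[ℝ] E (k + m)).normDet := by
        refine setLIntegral_congr_fun hs fun u hu => ?_
        simp only [hDs u hu]
        exact lintegral_abs_det_coef_graph _ (P.injective_deriv u (hsV hu))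
    _ = chartConst k m * (μHE[k] : Measure (E (k + m))) B := by
        rw [lintegral_const_mul' _ _ ?_, ← himg,
          euclideanHausdorffMeasure_image_eq_lintegral_normDet hs
          (fun u hu => P.hasStrictFDerivAt u (hsV hu)) (P.continuousOn_deriv.mono hsV)
          (fun u hu => P.injective_deriv u (hsV hu)) hinj (by simp)]
        rw [chartConst_eq]
        exact ENNReal.ofReal_ne_top

/-- The **integral-geometric formula**: the measure of a manifold is the average, over all affine
planes of the complementary dimension, of the number of their points on the manifold. -/
theorem lintegral_fiberCount {M : Set (E (k + m))} (hM : IsBoundedManifold k M)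
    {S : Set (E (k + m))} (hS : MeasurableSet S) (hSM : S ⊆ closure M) :
    (∀ A, AEMeasurable (fiberCount S A)) ∧
    Measurable (fun A : Fin k → E m => ∫⁻ z, fiberCount S A z) ∧
    ∫⁻ A : Fin k → E m, (∫⁻ z, fiberCount S A z) * ENNReal.ofReal (nd A)⁻¹ ^ (k + (m + 1)) =
      chartConst k m * (μHE[k] : Measure (E (k + m))) S := by
  have hex : ∀ x, ∃ V : Set (E (k + m)), x ∈ S → V ∈ 𝓝[S] x ∧ ∀ B, MeasurableSet B → B ⊆ V →
      (∀ A, AEMeasurable (fiberCount B A)) ∧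
      Measurable (fun A : Fin k → E m => ∫⁻ z, fiberCount B A z) ∧
      ∫⁻ A : Fin k → E m, (∫⁻ z, fiberCount B A z) * ENNReal.ofReal (nd A)⁻¹ ^ (k + (m + 1)) =
        chartConst k m * (μHE[k] : Measure (E (k + m))) B := by
    intro x
    by_cases hx : x ∈ S
    · obtain ⟨P⟩ := exists_param hM (hSM hx)
      exact ⟨S ∩ P.U, fun _ => ⟨inter_mem self_mem_nhdsWithin
        (mem_nhdsWithin_of_mem_nhds (P.isOpen_U.mem_nhds P.mem_U)), fun B hB hBV =>
        lintegral_fiberCount_of_param P hB (hBV.trans (inter_subset_inter_left _ hSM))⟩⟩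
    · exact ⟨∅, fun h => absurd h hx⟩
  choose V hV using hex
  obtain ⟨B, hBm, hBd, hBS, hB⟩ := exists_measurable_partition hS fun x hx => (hV x hx).1
  have hpart : ∀ i, (∀ A, AEMeasurable (fiberCount (B i) A)) ∧
      Measurable (fun A : Fin k → E m => ∫⁻ z, fiberCount (B i) A z) ∧
      ∫⁻ A : Fin k → E m, (∫⁻ z, fiberCount (B i) A z) *
        ENNReal.ofReal (nd A)⁻¹ ^ (k + (m + 1)) =
        chartConst k m * (μHE[k] : Measure (E (k + m))) (B i) := by
    intro i
    rcases hB i with h | ⟨x, hx, h⟩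
    · rw [h]
      have h0 : ∀ A : Fin k → E m, fiberCount ∅ A = fun _ => 0 := fun A => by
        ext1 z; simp [fiberCount]
      simp only [h0]
      refine ⟨fun A => aemeasurable_const, ?_, ?_⟩
      · simp
      · simp
    · exact (hV x hx).2 _ (hBm i) h
  have hsum : ∀ (A : Fin k → E m) z, fiberCount S A z = ∑' i, fiberCount (B i) A z := by
    intro A z
    have hz : MeasurableSet (coef (graph A) ⁻¹' {z}) :=
      (isClosed_singleton.preimage (coef (graph A)).continuous).measurableSet
    simp only [fiberCount]
    rw [← hBS, iUnion_inter, measure_iUnion _ fun i => (hBm i).inter hz]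
    exact fun i j hij => (hBd hij).mono inter_subset_left inter_subset_left
  have hint : ∀ A : Fin k → E m, ∫⁻ z, fiberCount S A z = ∑' i, ∫⁻ z, fiberCount (B i) A z := by
    intro A
    simp_rw [hsum]
    exact lintegral_tsum fun i => (hpart i).1 A
  refine ⟨fun A => ?_, ?_, ?_⟩
  · have : fiberCount S A = fun z => ∑' i, fiberCount (B i) A z := funext (hsum A)
    rw [this]
    exact AEMeasurable.tsum fun i => (hpart i).1 A
  · simp_rw [hint]
    exact Measurable.tsum fun i => (hpart i).2.1
  · simp_rw [hint, ← ENNReal.tsum_mul_right]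
    have h1 : ∀ i, AEMeasurable fun A : Fin k → E m => (∫⁻ z, fiberCount (B i) A z) *
        ENNReal.ofReal (nd A)⁻¹ ^ (k + (m + 1)) := fun i =>
      ((hpart i).2.1.mul (measurable_weight _)).aemeasurable
    rw [lintegral_tsum h1, tsum_congr fun i => (hpart i).2.2, ENNReal.tsum_mul_left, ← hBS,
      measure_iUnion hBd hBm]

end Crofton

/-! ### Disks in coordinates -/

section Disks

variable {k m : ℕ}

theorem coef_eq_zero_iff {V : Type*} [NormedAddCommGroup V] [InnerProductSpace ℝ V]
    (G : Fin k → V) (x : V) : coef G x = 0 ↔ ∀ j, inner ℝ (G j) x = 0 := by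
  constructor
  · intro h j
    rw [← coef_apply, h]; rfl
  · intro h
    ext j
    exact h j

theorem coef_graph_join (A : Fin k → E m) (p : E k × E m) :
    coef (graph A) (join p) = p.1 + coef A p.2 := by
  ext j
  rw [coef_apply, graph_apply, inner_join]
  simp [stdTuple, EuclideanSpace.inner_single_left]

theorem coef_graph_kap (A : Fin k → E m) (v : E m) : coef (graph A) (kap A v) = 0 := by
  rw [kap_apply, coef_graph_join, neg_add_cancel]

theorem exists_kap_eq {A : Fin k → E m} {x : E (k + m)} (hx : coef (graph A) x = 0) :
    ∃ v, kap A v = x := by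
  have h : join ((joinL k m).symm x) = x := (joinL k m).apply_symm_apply x
  rw [← h, coef_graph_join] at hx
  refine ⟨((joinL k m).symm x).2, ?_⟩
  rw [kap_apply, ← eq_neg_of_add_eq_zero_left hx]
  exact h

theorem plane_omega (A : Fin k → E m) :
    plane (omega A) = Submodule.span ℝ (range (graph A)) ∧
      plane (-omega A) = Submodule.span ℝ (range (graph A)) := by
  have h : ‖wedge (graph A)‖⁻¹ ≠ 0 := inv_ne_zero (norm_ne_zero_iff.2 (wedge_graph_ne_zero A))
  constructor
  · exact plane_smul_wedge (smul_ne_zero h (wedge_graph_ne_zero A))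
  · rw [omega, orient, ← neg_smul_kVec]
    exact plane_smul_wedge (smul_ne_zero (neg_ne_zero.2 h) (wedge_graph_ne_zero A))

theorem mem_orthogonal_span_range_iff {V : Type*} [NormedAddCommGroup V] [InnerProductSpace ℝ V]
    (G : Fin k → V) (x : V) : x ∈ (Submodule.span ℝ (range G))ᗮ ↔ coef G x = 0 := by
  rw [coef_eq_zero_iff, Submodule.mem_orthogonal]
  constructor
  · exact fun h j => h _ (Submodule.subset_span ⟨j, rfl⟩)
  · intro h u hu
    induction hu using Submodule.span_induction with
    | mem y hy => obtain ⟨j, rfl⟩ := hy; exact h j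
    | zero => simp
    | add y z _ _ hy hz => rw [inner_add_left, hy, hz, add_zero]
    | smul c y _ hy => rw [inner_smul_left, hy, mul_zero]

/-- The points of the disk with center `p` and radius `r` orthogonal to the graph of the map with
columns `A`. -/
def fiberDisk (t : E (k + m) × (Fin k → E m) × ℝ) : Set (E (k + m)) :=
  {x | coef (graph t.2.1) x = coef (graph t.2.1) t.1 ∧ ‖x - t.1‖ < t.2.2}

/-- The boundary of `fiberDisk t`. -/
def fiberSphere (t : E (k + m) × (Fin k → E m) × ℝ) : Set (E (k + m)) :=
  {x | coef (graph t.2.1) x = coef (graph t.2.1) t.1 ∧ ‖x - t.1‖ = t.2.2}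

/-- The coordinates of the disks which meet `M` in an odd number of points and whose boundary meets
`Ω`. -/
def oddCoords (M Ω : Set (E (k + m))) : Set (E (k + m) × (Fin k → E m) × ℝ) :=
  {t | 0 < t.2.2 ∧ (fiberDisk t ∩ M).Finite ∧ Odd (fiberDisk t ∩ M).ncard ∧
    (fiberSphere t ∩ Ω).Nonempty}

theorem exists_unit_normal (hm : 0 < m) (A : Fin k → E m) :
    ∃ u : E (k + m), coef (graph A) u = 0 ∧ ‖u‖ = 1 := by
  let v : E m := EuclideanSpace.single ⟨0, hm⟩ 1
  have hv : kap A v ≠ 0 := by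
    intro h
    have h1 : v = 0 := kap_injective A (h.trans (map_zero _).symm)
    simp [v] at h1
  refine ⟨‖kap A v‖⁻¹ • kap A v, by rw [map_smul, coef_graph_kap, smul_zero], ?_⟩
  rw [norm_smul, norm_inv, norm_norm, inv_mul_cancel₀ (norm_ne_zero_iff.2 hv)]

/-- The center belongs to the disk because `m > 0` provides a unit normal vector. -/
theorem disk_eq_fiberDisk (hm : 0 < m) {w : KVec (k + m) k} {A : Fin k → E m}
    (hw : plane w = Submodule.span ℝ (range (graph A))) (p : E (k + m)) {r : ℝ} (hr : 0 < r) :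
    disk p w r = fiberDisk (p, A, r) ∧ diskBoundary p w r = fiberSphere (p, A, r) := by
  have hu : unitNormals w = {u | coef (graph A) u = 0 ∧ ‖u‖ = 1} := by
    ext u
    rw [unitNormals, hw]
    exact and_congr_left fun _ => mem_orthogonal_span_range_iff _ _
  constructor
  · ext x
    simp only [disk, hu, fiberDisk]
    constructor
    · rintro ⟨u, ⟨hu0, hu1⟩, t, ⟨ht0, ht⟩, rfl⟩
      refine ⟨by rw [map_add, map_smul, hu0, smul_zero, add_zero], ?_⟩
      rw [add_sub_cancel_left, norm_smul, hu1, mul_one, Real.norm_of_nonneg ht0]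
      exact ht
    · rintro ⟨hx, hxr⟩
      by_cases hxp : x - p = 0
      · obtain ⟨u, hu⟩ := exists_unit_normal hm A
        exact ⟨u, hu, 0, ⟨le_rfl, hr⟩, by rw [zero_smul, add_zero, sub_eq_zero.1 hxp]⟩
      · have hn := norm_ne_zero_iff.2 hxp
        refine ⟨‖x - p‖⁻¹ • (x - p), ⟨?_, ?_⟩, ‖x - p‖, ⟨norm_nonneg _, hxr⟩, ?_⟩
        · rw [map_smul, map_sub, hx, sub_self, smul_zero]
        · rw [norm_smul, norm_inv, norm_norm, inv_mul_cancel₀ hn]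
        · rw [smul_inv_smul₀ hn, add_sub_cancel]
  · ext x
    simp only [diskBoundary, hu, fiberSphere]
    constructor
    · rintro ⟨u, ⟨hu0, hu1⟩, rfl⟩
      refine ⟨by rw [map_add, map_smul, hu0, smul_zero, add_zero], ?_⟩
      rw [add_sub_cancel_left, norm_smul, hu1, mul_one, Real.norm_of_nonneg hr.le]
    · rintro ⟨hx, hxr⟩
      refine ⟨r⁻¹ • (x - p), ⟨?_, ?_⟩, ?_⟩
      · rw [map_smul, map_sub, hx, sub_self, smul_zero]
      · change ‖x - p‖ = r at hxr
        rw [norm_smul, hxr, norm_inv, Real.norm_of_nonneg hr.le, inv_mul_cancel₀ hr.ne']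
      · rw [smul_inv_smul₀ hr.ne', add_sub_cancel]

theorem preimage_oddDisks (hm : 0 < m) (M Ω : Set (E (k + m))) :
    chartTriple ⁻¹' oddDisks (k + m) k M Ω = oddCoords M Ω ∧
      chartTripleNeg ⁻¹' oddDisks (k + m) k M Ω = oddCoords M Ω := by
  have key : ∀ (t : E (k + m) × (Fin k → E m) × ℝ) (w : KVec (k + m) k),
      w ∈ unitSimple (k + m) k → plane w = Submodule.span ℝ (range (graph t.2.1)) →
      (toTriple (t.1, w, t.2.2) ∈ oddDisks (k + m) k M Ω ↔ t ∈ oddCoords M Ω) := by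
    intro t w hw hp
    change (w ∈ unitSimple (k + m) k ∧ 0 < t.2.2 ∧ (disk t.1 w t.2.2 ∩ M).Finite ∧
      Odd (disk t.1 w t.2.2 ∩ M).ncard ∧ (diskBoundary t.1 w t.2.2 ∩ Ω).Nonempty) ↔ _
    constructor
    · rintro ⟨-, hr, h⟩
      obtain ⟨h1, h2⟩ := disk_eq_fiberDisk hm hp t.1 hr
      rw [h1, h2] at h
      exact ⟨hr, h⟩
    · rintro ⟨hr, h⟩
      obtain ⟨h1, h2⟩ := disk_eq_fiberDisk hm hp t.1 hr
      rw [h1, h2]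
      exact ⟨hw, hr, h⟩
  constructor <;> ext t
  · exact key t _ (omega_mem t.2.1) (plane_omega t.2.1).1
  · exact key t _ (neg_mem_unitSimple (omega_mem t.2.1)) (plane_omega t.2.1).2

/-- The factor `2` counts the two orientations of each plane. -/
theorem meas_eq (hm : 0 < m) (σ : ℝ) (M Ω : Set (E (k + m))) :
    meas (k + m) k σ M Ω =
      2 * ∫⁻ t in oddCoords M Ω, ENNReal.ofReal (t.2.2 ^ (-(m : ℝ) - σ)) ∂chartVolume k m := by
  rw [meas, setLIntegral_diskTriples fun d hd => hd.1, (preimage_oddDisks hm M Ω).1,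
    (preimage_oddDisks hm M Ω).2, two_mul]
  have h : ((k : ℝ) - ((k + m : ℕ) : ℝ) - σ) = -(m : ℝ) - σ := by push_cast; ring
  rw [h]
  rfl

/-! ### Measurability of the set of odd disks -/

theorem isClosed_exists_mem_compact {X Y : Type*} [TopologicalSpace X] [TopologicalSpace Y]
    {K : Set X} (hK : IsCompact K) {C : Set (X × Y)} (hC : IsClosed C) :
    IsClosed {y | ∃ x ∈ K, (x, y) ∈ C} := by
  have : CompactSpace K := isCompact_iff_compactSpace.1 hK
  have h : {y | ∃ x ∈ K, (x, y) ∈ C} =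
      Prod.snd '' ((fun p : K × Y => ((p.1 : X), p.2)) ⁻¹' C) := by
    ext y
    constructor
    · rintro ⟨x, hx, h⟩
      exact ⟨(⟨x, hx⟩, y), h, rfl⟩
    · rintro ⟨⟨x, y'⟩, h, rfl⟩
      exact ⟨x, x.2, h⟩
  rw [h]
  exact isClosedMap_snd_of_compactSpace _ (hC.preimage (by fun_prop))

theorem continuous_coef_graph_apply {T : Type*} [TopologicalSpace T] {f : T → Fin k → E m}
    {g : T → E (k + m)} (hf : Continuous f) (hg : Continuous g) :
    Continuous fun t => coef (graph (f t)) (g t) :=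
  ((continuous_coef.comp continuous_graph).comp hf).clm_apply hg

theorem exists_injective_iff_le_encard {X : Type*} (s : Set X) (j : ℕ) :
    (∃ x : Fin j → X, Function.Injective x ∧ ∀ i, x i ∈ s) ↔ (j : ℕ∞) ≤ s.encard := by
  constructor
  · rintro ⟨x, hx, hs⟩
    have h1 : (range x).encard = j := by
      rw [← image_univ, hx.injOn.encard_image, encard_univ]
      simp
    rw [← h1]
    exact encard_le_encard (range_subset_iff.2 hs)
  · intro h
    obtain ⟨t, hts, ht⟩ := exists_subset_encard_eq h
    have hfin : t.Finite := finite_of_encard_eq_coe ht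
    have hcard : hfin.toFinset.card = j := by
      rw [← ncard_eq_toFinset_card t hfin, ncard, ht]; rfl
    refine ⟨fun i => ((hfin.toFinset.equivFinOfCardEq hcard).symm i : X), ?_, fun i => ?_⟩
    · exact Subtype.val_injective.comp (Equiv.injective _)
    · exact hts (hfin.mem_toFinset.1 ((hfin.toFinset.equivFinOfCardEq hcard).symm i).2)

/-- A disk meets `S` in at least `j` points if and only if, for some `l`, the compact set `K l`
contains `j` points of the disk with distances at least `1 / (l + 1)` from each other and from the
boundary of the disk. For fixed `l`, this is a closed condition. -/
theorem measurableSet_le_encard {S : Set (E (k + m))} {K : ℕ → Set (E (k + m))}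
    (hK : ∀ l, IsCompact (K l)) (hKm : Monotone K) (hKS : ⋃ l, K l = S) (j : ℕ) :
    MeasurableSet {t : E (k + m) × (Fin k → E m) × ℝ | (j : ℕ∞) ≤ (fiberDisk t ∩ S).encard} := by
  let C : ℕ → Set ((Fin j → E (k + m)) × (E (k + m) × (Fin k → E m) × ℝ)) := fun l =>
    {q | (∀ i, coef (graph q.2.2.1) (q.1 i) = coef (graph q.2.2.1) q.2.1 ∧
      ‖q.1 i - q.2.1‖ + 1 / ((l : ℝ) + 1) ≤ q.2.2.2) ∧
      ∀ i i', i ≠ i' → 1 / ((l : ℝ) + 1) ≤ dist (q.1 i) (q.1 i')}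
  have hC : ∀ l, IsClosed (C l) := by
    intro l
    have a0 : Continuous fun q : (Fin j → E (k + m)) × (E (k + m) × (Fin k → E m) × ℝ) =>
        q.2.2.1 := by fun_prop
    have a1 : ∀ i, Continuous fun q : (Fin j → E (k + m)) × (E (k + m) × (Fin k → E m) × ℝ) =>
        q.1 i := fun i => by fun_prop
    have a2 : Continuous fun q : (Fin j → E (k + m)) × (E (k + m) × (Fin k → E m) × ℝ) =>
        q.2.1 := by fun_prop
    have h1 : ∀ i, IsClosed {q : (Fin j → E (k + m)) × (E (k + m) × (Fin k → E m) × ℝ) |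
        coef (graph q.2.2.1) (q.1 i) = coef (graph q.2.2.1) q.2.1} := fun i =>
      isClosed_eq (continuous_coef_graph_apply a0 (a1 i)) (continuous_coef_graph_apply a0 a2)
    have h2 : ∀ i, IsClosed {q : (Fin j → E (k + m)) × (E (k + m) × (Fin k → E m) × ℝ) |
        ‖q.1 i - q.2.1‖ + 1 / ((l : ℝ) + 1) ≤ q.2.2.2} := fun i =>
      isClosed_le (by fun_prop) (by fun_prop)
    have h3 : ∀ i i', IsClosed {q : (Fin j → E (k + m)) × (E (k + m) × (Fin k → E m) × ℝ) |
        1 / ((l : ℝ) + 1) ≤ dist (q.1 i) (q.1 i')} := fun i i' =>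
      isClosed_le (by fun_prop) (by fun_prop)
    simp only [C, ofPred_and, ofPred_forall]
    exact (isClosed_iInter fun i => (h1 i).inter (h2 i)).inter
      (isClosed_iInter fun i => isClosed_iInter fun i' => isClosed_iInter fun _ => h3 i i')
  have h : {t : E (k + m) × (Fin k → E m) × ℝ | (j : ℕ∞) ≤ (fiberDisk t ∩ S).encard} =
      ⋃ l, {t | ∃ x ∈ univ.pi fun _ : Fin j => K l, (x, t) ∈ C l} := by
    ext t
    change (j : ℕ∞) ≤ (fiberDisk t ∩ S).encard ↔ _
    rw [← exists_injective_iff_le_encard, mem_iUnion]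
    constructor
    · rintro ⟨x, hx, hxS⟩
      have hlim : Tendsto (fun l : ℕ => 1 / ((l : ℝ) + 1)) atTop (𝓝 0) :=
        tendsto_one_div_add_atTop_nhds_zero_nat
      have e1 : ∀ i, ∀ᶠ l in atTop, x i ∈ K l := by
        intro i
        obtain ⟨l₀, hl₀⟩ := mem_iUnion.1 (hKS ▸ (hxS i).2 : x i ∈ ⋃ l, K l)
        exact eventually_atTop.2 ⟨l₀, fun l hl => hKm hl hl₀⟩
      have e2 : ∀ i, ∀ᶠ l : ℕ in atTop, ‖x i - t.1‖ + 1 / ((l : ℝ) + 1) ≤ t.2.2 := by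
        intro i
        have := (hlim.eventually_lt_const (sub_pos.2 (hxS i).1.2))
        filter_upwards [this] with l hl
        linarith
      have e3 : ∀ i i', ∀ᶠ l : ℕ in atTop, i ≠ i' → 1 / ((l : ℝ) + 1) ≤ dist (x i) (x i') := by
        intro i i'
        by_cases hi : i = i'
        · exact Eventually.of_forall fun l h => absurd hi h
        · filter_upwards [hlim.eventually_lt_const (dist_pos.2 (hx.ne hi))] with l hl _
          exact hl.le
      obtain ⟨l, h1, h2, h3⟩ := ((eventually_all.2 e1).and ((eventually_all.2 e2).and
        (eventually_all.2 fun i => eventually_all.2 (e3 i)))).exists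
      exact ⟨l, x, fun i _ => h1 i, fun i => ⟨(hxS i).1.1, h2 i⟩, h3⟩
    · rintro ⟨l, x, hxK, hx, hx'⟩
      have hl : (0 : ℝ) < 1 / ((l : ℝ) + 1) := by positivity
      refine ⟨x, fun i i' hii => ?_, fun i => ⟨⟨(hx i).1, ?_⟩, ?_⟩⟩
      · by_contra hne
        have := hx' i i' hne
        simp only at this
        rw [hii, dist_self] at this
        linarith
      · have := (hx i).2
        simp only at this
        linarith
      · exact hKS ▸ mem_iUnion_of_mem l (hxK i trivial)
  rw [h]
  exact MeasurableSet.iUnion fun l =>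
    (isClosed_exists_mem_compact (isCompact_univ_pi fun _ => hK l) (hC l)).measurableSet

theorem finite_and_odd_iff {X : Type*} (s : Set X) : s.Finite ∧ Odd s.ncard ↔
    ∃ j : ℕ, Odd j ∧ (j : ℕ∞) ≤ s.encard ∧ ¬((j + 1 : ℕ) : ℕ∞) ≤ s.encard := by
  constructor
  · rintro ⟨h, ho⟩
    refine ⟨s.ncard, ho, h.cast_ncard_eq.le, ?_⟩
    rw [← h.cast_ncard_eq, Nat.cast_le]
    omega
  · rintro ⟨j, hj, h1, h2⟩
    have h3 : s.encard < ((j + 1 : ℕ) : ℕ∞) := not_le.1 h2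
    have hfin : s.Finite := finite_of_encard_le_coe h3.le
    rw [← hfin.cast_ncard_eq, Nat.cast_le] at h1
    rw [← hfin.cast_ncard_eq, Nat.cast_lt] at h3
    have : s.ncard = j := by omega
    exact ⟨hfin, this ▸ hj⟩

theorem isOpen_fiberSphere_inter {Ω : Set (E (k + m))} (hΩ : IsOpen Ω) :
    IsOpen {t : E (k + m) × (Fin k → E m) × ℝ | 0 < t.2.2 ∧ (fiberSphere t ∩ Ω).Nonempty} := by
  have h : {t : E (k + m) × (Fin k → E m) × ℝ | 0 < t.2.2 ∧ (fiberSphere t ∩ Ω).Nonempty} =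
      {t | 0 < t.2.2} ∩ ⋃ v ∈ {v : E m | v ≠ 0},
        {t | t.1 + (t.2.2 * ‖kap t.2.1 v‖⁻¹) • kap t.2.1 v ∈ Ω} := by
    ext t
    constructor
    · rintro ⟨hr, x, ⟨hx, hxr⟩, hxΩ⟩
      obtain ⟨v, hv⟩ := exists_kap_eq (A := t.2.1) (x := x - t.1) (by rw [map_sub, hx, sub_self])
      have hn : ‖kap t.2.1 v‖ = t.2.2 := by rw [hv, hxr]
      refine ⟨hr, mem_iUnion₂.2 ⟨v, fun h0 => ?_, ?_⟩⟩
      · rw [h0, map_zero, norm_zero] at hn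
        exact hr.ne hn
      · change t.1 + _ ∈ Ω
        rw [hn, mul_inv_cancel₀ hr.ne', one_smul, hv, add_sub_cancel]
        exact hxΩ
    · rintro ⟨hr, hx⟩
      obtain ⟨v, hv, hxΩ⟩ := mem_iUnion₂.1 hx
      have hr' : 0 < t.2.2 := hr
      have hn : ‖kap t.2.1 v‖ ≠ 0 := norm_ne_zero_iff.2 fun h0 =>
        hv (kap_injective _ (h0.trans (map_zero _).symm))
      refine ⟨hr, _, ⟨?_, ?_⟩, hxΩ⟩
      · rw [map_add, map_smul, coef_graph_kap, smul_zero, add_zero]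
      · rw [add_sub_cancel_left, norm_smul, norm_mul, norm_inv, norm_norm, mul_assoc,
          inv_mul_cancel₀ hn, mul_one, Real.norm_of_nonneg hr'.le]
  rw [h]
  refine (isOpen_lt continuous_const (by fun_prop)).inter (isOpen_biUnion fun v hv => ?_)
  refine hΩ.preimage ?_
  have h1 : Continuous fun t : E (k + m) × (Fin k → E m) × ℝ => kap t.2.1 v := by
    have h2 : Continuous fun A : Fin k → E m => kap A v :=
      continuous_join.comp (((continuous_coef.clm_apply continuous_const).neg).prodMk
        continuous_const)
    exact h2.comp continuous_snd.fst
  have h3 : ∀ t : E (k + m) × (Fin k → E m) × ℝ, ‖kap t.2.1 v‖ ≠ 0 := fun t =>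
    norm_ne_zero_iff.2 fun h0 => hv (kap_injective _ (h0.trans (map_zero _).symm))
  exact continuous_fst.add ((continuous_snd.snd.mul (h1.norm.inv₀ h3)).smul h1)

theorem measurableSet_oddCoords {S Ω : Set (E (k + m))} {K : ℕ → Set (E (k + m))}
    (hK : ∀ l, IsCompact (K l)) (hKm : Monotone K) (hKS : ⋃ l, K l = S) (hΩ : IsOpen Ω) :
    MeasurableSet (oddCoords S Ω) := by
  have h : oddCoords S Ω =
      {t | 0 < t.2.2 ∧ (fiberSphere t ∩ Ω).Nonempty} ∩ ⋃ j ∈ {j : ℕ | Odd j},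
        {t | (j : ℕ∞) ≤ (fiberDisk t ∩ S).encard} \
          {t | ((j + 1 : ℕ) : ℕ∞) ≤ (fiberDisk t ∩ S).encard} := by
    ext t
    constructor
    · rintro ⟨hr, h1, h2, h3⟩
      obtain ⟨j, hj, h4⟩ := (finite_and_odd_iff _).1 ⟨h1, h2⟩
      exact ⟨⟨hr, h3⟩, mem_iUnion₂.2 ⟨j, hj, h4⟩⟩
    · rintro ⟨⟨hr, h3⟩, h⟩
      obtain ⟨j, hj, h4⟩ := mem_iUnion₂.1 h
      obtain ⟨h1, h2⟩ := (finite_and_odd_iff _).2 ⟨j, hj, h4⟩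
      exact ⟨hr, h1, h2, h3⟩
  rw [h]
  refine (isOpen_fiberSphere_inter hΩ).measurableSet.inter
    (MeasurableSet.biUnion (to_countable _) fun j _ => ?_)
  exact (measurableSet_le_encard hK hKm hKS j).diff (measurableSet_le_encard hK hKm hKS (j + 1))

theorem exists_compact_exhaustion_interiorPart {X : Set (E (k + m))} (hX : IsCompact X) :
    ∃ K : ℕ → Set (E (k + m)), (∀ l, IsCompact (K l)) ∧ Monotone K ∧
      ⋃ l, K l = interiorPart k X := by
  obtain ⟨O, hO, h⟩ := exists_isOpen_interiorPart k X
  obtain ⟨F, hF, -, hFO, hFm⟩ := hO.exists_iUnion_isClosed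
  refine ⟨fun l => X ∩ F l, fun l => hX.inter_right (hF l), fun i j hij =>
    inter_subset_inter_right _ (hFm hij), ?_⟩
  rw [h, ← hFO, inter_iUnion]

end Disks

/-! ### Integration over the centers of parallel disks -/

section Slices

variable {k m : ℕ}

/-- The point over `z` with coordinate `v` along the orthogonal complement of the graph of the
map with columns `A`. -/
def fiberPoint (A : Fin k → E m) (z : E k) (v : E m) : E (k + m) := join (z, 0) + kap A v

theorem fiberPoint_eq (A : Fin k → E m) (z : E k) (v : E m) :
    fiberPoint A z v = join (z - coef A v, v) := by
  rw [fiberPoint, kap_apply, ← join_add]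
  simp [sub_eq_add_neg]

theorem coef_fiberPoint (A : Fin k → E m) (z : E k) (v : E m) :
    coef (graph A) (fiberPoint A z v) = z := by
  rw [fiberPoint_eq, coef_graph_join, sub_add_cancel]

theorem fiberPoint_sub (A : Fin k → E m) (z : E k) (v w : E m) :
    fiberPoint A z v - fiberPoint A z w = kap A (v - w) := by
  rw [fiberPoint, fiberPoint, map_sub, add_sub_add_left_eq_sub]

theorem fiberPoint_injective (A : Fin k → E m) (z : E k) :
    Function.Injective (fiberPoint A z) := fun _ _ h =>
  kap_injective A (add_left_cancel h)

theorem exists_fiberPoint_eq (A : Fin k → E m) (x : E (k + m)) :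
    ∃ v, fiberPoint A (coef (graph A) x) v = x := by
  have h : join ((joinL k m).symm x) = x := (joinL k m).apply_symm_apply x
  refine ⟨((joinL k m).symm x).2, ?_⟩
  rw [fiberPoint_eq]
  nth_rw 1 [← h]
  rw [coef_graph_join, add_sub_cancel_right]
  exact h

theorem continuous_fiberPoint (A : Fin k → E m) :
    Continuous fun q : E k × E m => fiberPoint A q.1 q.2 := by
  simp_rw [fiberPoint_eq]
  exact continuous_join.comp (by fun_prop)

theorem lintegral_shear {X Y : Type*} [AddGroup X] [MeasurableSpace X] [MeasurableAdd₂ X]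
    [MeasurableNeg X] [MeasurableSpace Y] (μ : Measure X) (ν : Measure Y) [SFinite μ] [SFinite ν]
    [μ.IsAddRightInvariant] {f : X × Y → ℝ≥0∞} (hf : Measurable f) {g : Y → X}
    (hg : Measurable g) : ∫⁻ q, f q ∂μ.prod ν = ∫⁻ x, ∫⁻ y, f (x - g y, y) ∂ν ∂μ := by
  have h1 : Measurable fun q : Y × X => f (q.2 - g q.1, q.1) :=
    hf.comp ((measurable_snd.sub (hg.comp measurable_fst)).prodMk measurable_fst)
  rw [lintegral_prod_symm' _ hf]
  have h2 : ∀ y, ∫⁻ x, f (x, y) ∂μ = ∫⁻ x, f (x - g y, y) ∂μ := fun y =>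
    (lintegral_sub_right_eq_self (fun x => f (x, y)) (g y)).symm
  simp_rw [h2]
  exact lintegral_lintegral_swap (f := fun (y : Y) (x : X) => f (x - g y, y)) h1.aemeasurable

/-- Fubini's theorem in the coordinates `fiberPoint`. -/
theorem lintegral_fiberPoint (A : Fin k → E m) {F : E (k + m) → ℝ≥0∞} (hF : Measurable F) :
    ∫⁻ p, F p = ∫⁻ z, ∫⁻ v, F (fiberPoint A z v) := by
  have h1 := lintegral_shear (volume : Measure (E k)) (volume : Measure (E m))
    (f := fun q => F (join q)) (hF.comp continuous_join.measurable) (g := coef A)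
    (coef A).continuous.measurable
  rw [← measurePreserving_join.lintegral_comp hF]
  simp_rw [fiberPoint_eq]
  exact h1

theorem volume_preimage_coef_graph (A : Fin k → E m) {N : Set (E k)} (hN : MeasurableSet N)
    (h0 : volume N = 0) : volume (coef (graph A) ⁻¹' N) = 0 := by
  have hm : MeasurableSet (coef (graph A) ⁻¹' N) := (coef (graph A)).continuous.measurable hN
  rw [← lintegral_indicator_one hm, lintegral_fiberPoint A (measurable_one.indicator hm)]
  have h1 : ∀ z v, (coef (graph A) ⁻¹' N).indicator (1 : E (k + m) → ℝ≥0∞) (fiberPoint A z v) =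
      N.indicator 1 z * 1 := by
    intro z v
    by_cases hz : z ∈ N
    · rw [indicator_of_mem hz, indicator_of_mem (by rw [mem_preimage, coef_fiberPoint]; exact hz)]
      simp
    · rw [indicator_of_notMem hz,
        indicator_of_notMem (by rw [mem_preimage, coef_fiberPoint]; exact hz), zero_mul]
  have h2 : ∀ᵐ z, z ∉ N := measure_eq_zero_iff_ae_notMem.1 h0
  rw [lintegral_congr_ae (g := fun _ => 0), lintegral_zero]
  filter_upwards [h2] with z hz
  simp [h1, indicator_of_notMem hz]

/-- The boundary points of a manifold do not affect almost all disks. -/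
theorem oddCoords_ae_eq {M : Set (E (k + m))} (hM : IsBoundedManifold k M) (Ω : Set (E (k + m))) :
    (oddCoords M Ω : Set (E (k + m) × (Fin k → E m) × ℝ)) =ᵐ[chartVolume k m]
      oddCoords (interiorPart k (closure M)) Ω := by
  let Z : Set (E (k + m)) := closure M \ interiorPart k (closure M)
  have hZ : IsCompact Z := by
    obtain ⟨O, hO, h⟩ := exists_isOpen_interiorPart k (closure M)
    have : Z = closure M ∩ Oᶜ := by
      simp only [Z, h]
      ext x
      simp only [Set.mem_sdiff, mem_inter_iff, mem_compl_iff, not_and]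
      exact ⟨fun hx => ⟨hx.1, hx.2 hx.1⟩, fun hx => ⟨hx.1, fun _ => hx.2⟩⟩
    rw [this]
    exact (isCompact_closure hM).inter_right hO.isClosed_compl
  let N : Set (E (k + m) × (Fin k → E m) × ℝ) :=
    {t | ∃ x ∈ Z, coef (graph t.2.1) x = coef (graph t.2.1) t.1}
  have hNm : MeasurableSet N := by
    have a0 : Continuous fun q : E (k + m) × (E (k + m) × (Fin k → E m) × ℝ) => q.2.2.1 := by
      fun_prop
    have a2 : Continuous fun q : E (k + m) × (E (k + m) × (Fin k → E m) × ℝ) => q.2.1 := by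
      fun_prop
    exact (isClosed_exists_mem_compact hZ (isClosed_eq (continuous_coef_graph_apply a0
      continuous_fst) (continuous_coef_graph_apply a0 a2))).measurableSet
  have hN0 : volume N = 0 := by
    rw [Measure.volume_eq_prod, Measure.prod_apply_symm hNm, lintegral_eq_zero_iff'
      (measurable_measure_prodMk_right hNm).aemeasurable]
    refine Eventually.of_forall fun y => ?_
    have h1 : (fun p => (p, y)) ⁻¹' N = coef (graph y.1) ⁻¹' (coef (graph y.1) '' Z) := by
      ext p
      rfl
    change volume ((fun p => (p, y)) ⁻¹' N) = 0
    rw [h1]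
    exact volume_preimage_coef_graph _ (hZ.image (coef (graph y.1)).continuous).measurableSet
      (volume_image_boundary hM _)
  have hN : chartVolume k m N = 0 := by
    rw [chartVolume_eq_withDensity]
    exact withDensity_absolutelyContinuous _ _ hN0
  filter_upwards [measure_eq_zero_iff_ae_notMem.1 hN] with t ht
  have h : fiberDisk t ∩ M = fiberDisk t ∩ interiorPart k (closure M) := by
    refine Subset.antisymm (fun x hx => ⟨hx.1, ?_⟩)
      (inter_subset_inter_right _ (interiorPart_subset_manifold hM))
    by_contra hx'
    exact ht ⟨x, ⟨subset_closure hx.2, hx'⟩, hx.1.1⟩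
  refine propext ?_
  change t ∈ oddCoords M Ω ↔ t ∈ oddCoords (interiorPart k (closure M)) Ω
  simp only [oddCoords, mem_ofPred_eq, h]

/-- The centers, along one fiber, of the disks which meet `S` in an odd number of points. -/
def oddFiber (S Ω : Set (E (k + m))) (A : Fin k → E m) (r : ℝ) (z : E k) : Set (E m) :=
  {v | (fiberPoint A z v, A, r) ∈ oddCoords S Ω}

/-- The coordinates of the points of `S` on one fiber. -/
def fiberSet (S : Set (E (k + m))) (A : Fin k → E m) (z : E k) : Set (E m) :=
  {b | fiberPoint A z b ∈ S}

theorem count_fiberSet (S : Set (E (k + m))) (A : Fin k → E m) (z : E k) :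
    Measure.count (fiberSet S A z) = fiberCount S A z := by
  rw [fiberCount, ← measure_count_image (f := fiberPoint A z) (fiberPoint_injective A z).injOn]
  congr 1
  ext x
  constructor
  · rintro ⟨b, hb, rfl⟩
    exact ⟨hb, coef_fiberPoint A z b⟩
  · rintro ⟨hx, hz⟩
    obtain ⟨v, hv⟩ := exists_fiberPoint_eq A x
    rw [show coef (graph A) x = z from hz] at hv
    exact ⟨v, by rw [fiberSet, mem_ofPred_eq, hv]; exact hx, hv⟩

/-- The ellipsoid of the parameters of the points of a disk. -/
def ellipsoid (A : Fin k → E m) (b : E m) (r : ℝ) : Set (E m) := {v | ‖kap A (v - b)‖ < r}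

theorem isOpen_ellipsoid (A : Fin k → E m) (b : E m) (r : ℝ) : IsOpen (ellipsoid A b r) :=
  isOpen_lt (by fun_prop) continuous_const

theorem volume_ellipsoid (A : Fin k → E m) (b : E m) {r : ℝ} (hr : 0 < r) :
    volume (ellipsoid A b r) =
      ENNReal.ofReal (r ^ m) * (volume (Metric.ball (0 : E m) 1) * ENNReal.ofReal (nd A)⁻¹) := by
  obtain ⟨T, hT, hdet⟩ := exists_polar_kap A
  have hn : ∀ v, ‖kap A v‖ = ‖T v‖ := by
    intro v
    rw [← sq_eq_sq₀ (norm_nonneg _) (norm_nonneg _), ← real_inner_self_eq_norm_sq,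
      ← real_inner_self_eq_norm_sq, hT]
  have h1 : ellipsoid A b r =
      (fun v => v + -b) ⁻¹' ((T : E m →ₗ[ℝ] E m) ⁻¹' Metric.ball 0 r) := by
    ext v
    rw [mem_preimage, mem_preimage, mem_ball_zero_iff, LinearEquiv.coe_coe, ← hn,
      ← sub_eq_add_neg]
    rfl
  rw [h1, measure_preimage_add_right, Measure.addHaar_preimage_linearMap _
    (LinearEquiv.isUnit_det' T).ne_zero, abs_inv, hdet, Measure.addHaar_ball_of_pos _ _ hr,
    finrank_euclideanSpace_fin]
  ring

theorem fiberDisk_inter (S : Set (E (k + m))) (A : Fin k → E m) (z : E k) (v : E m) (r : ℝ) :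
    fiberDisk (fiberPoint A z v, A, r) ∩ S =
      fiberPoint A z '' {b ∈ fiberSet S A z | v ∈ ellipsoid A b r} := by
  have hn : ∀ b, ‖fiberPoint A z b - fiberPoint A z v‖ = ‖kap A (v - b)‖ := fun b => by
    rw [norm_sub_rev, fiberPoint_sub]
  ext x
  constructor
  · rintro ⟨⟨hx, hxr⟩, hxS⟩
    obtain ⟨b, hb⟩ := exists_fiberPoint_eq A x
    rw [show coef (graph A) x = z from hx.trans (coef_fiberPoint A z v)] at hb
    refine ⟨b, ⟨?_, ?_⟩, hb⟩
    · rw [fiberSet, mem_ofPred_eq, hb]; exact hxS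
    · rw [ellipsoid, mem_ofPred_eq, ← hn, hb]; exact hxr
  · rintro ⟨b, ⟨hb, hv⟩, rfl⟩
    refine ⟨⟨?_, ?_⟩, hb⟩
    · rw [coef_fiberPoint]; exact (coef_fiberPoint A z v).symm
    · change ‖fiberPoint A z b - fiberPoint A z v‖ < r
      rw [hn]; exact hv

theorem oddFiber_subset (S Ω : Set (E (k + m))) (A : Fin k → E m) (r : ℝ) (z : E k) :
    oddFiber S Ω A r z ⊆ ⋃ b ∈ fiberSet S A z, ellipsoid A b r := by
  rintro v ⟨-, -, hodd, -⟩
  rw [fiberDisk_inter] at hodd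
  have hne : (fiberPoint A z '' {b ∈ fiberSet S A z | v ∈ ellipsoid A b r}).Nonempty := by
    by_contra h
    rw [not_nonempty_iff_eq_empty.1 h, ncard_empty] at hodd
    exact absurd hodd (by decide)
  obtain ⟨_, b, ⟨hb, hv⟩, -⟩ := hne
  exact mem_iUnion₂.2 ⟨b, hb, hv⟩

theorem volume_oddFiber_le (S Ω : Set (E (k + m))) (A : Fin k → E m) {r : ℝ} (hr : 0 < r)
    (z : E k) : volume (oddFiber S Ω A r z) ≤ fiberCount S A z *
      (ENNReal.ofReal (r ^ m) * (volume (Metric.ball (0 : E m) 1) * ENNReal.ofReal (nd A)⁻¹)) := by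
  refine (measure_mono (oddFiber_subset S Ω A r z)).trans ?_
  rw [← count_fiberSet]
  rcases (fiberSet S A z).finite_or_infinite with h | h
  · rw [Measure.count_apply_finite _ h]
    have h1 : ⋃ b ∈ fiberSet S A z, ellipsoid A b r = ⋃ b ∈ h.toFinset, ellipsoid A b r := by
      simp
    rw [h1]
    refine (measure_biUnion_finset_le _ _).trans ?_
    simp [volume_ellipsoid A _ hr]
  · rw [Measure.count_apply_infinite h, ENNReal.top_mul]
    · exact le_top
    · refine mul_ne_zero (by positivity) (mul_ne_zero ?_ ?_)
      · exact (Metric.measure_ball_pos volume 0 one_pos).ne'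
      · simpa using nd_pos A

/-- If a fiber contains finitely many points of `S`, then each disk of small radius in this fiber
contains at most one of them, and if it contains one, its boundary meets `Ω`. -/
theorem eventually_volume_oddFiber (hm : 0 < m) {S Ω : Set (E (k + m))} (hΩ : IsOpen Ω)
    (hSΩ : S ⊆ Ω) (A : Fin k → E m) (z : E k) (hfin : fiberCount S A z ≠ ⊤) :
    ∀ᶠ r in 𝓝[>] 0, volume (oddFiber S Ω A r z) = fiberCount S A z *
      (ENNReal.ofReal (r ^ m) * (volume (Metric.ball (0 : E m) 1) * ENNReal.ofReal (nd A)⁻¹)) := by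
  rw [← count_fiberSet] at hfin ⊢
  have hf : (fiberSet S A z).Finite := by
    by_contra h
    exact hfin (Measure.count_apply_infinite h)
  have hΩ' : ∀ b ∈ fiberSet S A z, ∀ᶠ r : ℝ in 𝓝[>] 0,
      Metric.ball (fiberPoint A z b) (2 * r) ⊆ Ω := by
    intro b hb
    obtain ⟨δ, hδ, hδΩ⟩ := Metric.isOpen_iff.1 hΩ _ (hSΩ hb)
    filter_upwards [Ioo_mem_nhdsGT (half_pos hδ)] with r hr
    exact (Metric.ball_subset_ball (by linarith [hr.2])).trans hδΩ
  have hsep : ∀ b ∈ fiberSet S A z, ∀ b' ∈ fiberSet S A z, ∀ᶠ r : ℝ in 𝓝[>] 0, b ≠ b' →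
      2 * r < ‖kap A (b - b')‖ := by
    intro b _ b' _
    by_cases hbb : b = b'
    · exact Eventually.of_forall fun r h => absurd hbb h
    · have hpos : 0 < ‖kap A (b - b')‖ := norm_pos_iff.2 fun h =>
        hbb (sub_eq_zero.1 (kap_injective A (h.trans (map_zero _).symm)))
      filter_upwards [Ioo_mem_nhdsGT (half_pos hpos)] with r hr _
      linarith [hr.2]
  filter_upwards [(eventually_all_finite hf).2 hΩ', (eventually_all_finite hf).2 fun b hb =>
    (eventually_all_finite hf).2 (hsep b hb), self_mem_nhdsWithin] with r h1 h2 hr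
  have hr : 0 < r := hr
  have hdisj : ∀ b ∈ fiberSet S A z, ∀ b' ∈ fiberSet S A z, ∀ v, v ∈ ellipsoid A b r →
      v ∈ ellipsoid A b' r → b = b' := by
    intro b hb b' hb' v hv hv'
    by_contra hne
    have h3 := h2 b hb b' hb' hne
    have h4 : kap A (b - b') = kap A (v - b') - kap A (v - b) := by
      rw [← map_sub, sub_sub_sub_cancel_left]
    have h5 := norm_sub_le (kap A (v - b')) (kap A (v - b))
    rw [← h4] at h5
    have h6 : ‖kap A (v - b)‖ < r := hv
    have h7 : ‖kap A (v - b')‖ < r := hv'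
    linarith
  have heq : oddFiber S Ω A r z = ⋃ b ∈ hf.toFinset, ellipsoid A b r := by
    refine Subset.antisymm ((oddFiber_subset S Ω A r z).trans (by simp)) fun v hv => ?_
    simp only [Finite.mem_toFinset, mem_iUnion, exists_prop] at hv
    obtain ⟨b, hb, hv⟩ := hv
    have hone : {b ∈ fiberSet S A z | v ∈ ellipsoid A b r} = {b} := by
      ext b'
      exact ⟨fun hb' => hdisj b' hb'.1 b hb v hb'.2 hv, fun hb' => by
        rw [mem_singleton_iff.1 hb']; exact ⟨hb, hv⟩⟩
    refine ⟨hr, ?_, ?_, ?_⟩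
    · rw [fiberDisk_inter, hone, image_singleton]
      exact finite_singleton _
    · rw [fiberDisk_inter, hone, image_singleton, ncard_singleton]
      exact odd_one
    · obtain ⟨u, hu, hu1⟩ := exists_unit_normal hm A
      refine ⟨fiberPoint A z v + r • u, ⟨?_, ?_⟩, h1 b hb ?_⟩
      · change coef (graph A) _ = coef (graph A) (fiberPoint A z v)
        rw [map_add, map_smul, hu, smul_zero, add_zero]
      · change ‖fiberPoint A z v + r • u - fiberPoint A z v‖ = r
        rw [add_sub_cancel_left, norm_smul, hu1, mul_one, Real.norm_of_nonneg hr.le]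
      · rw [mem_ball_iff_norm, add_sub_right_comm, fiberPoint_sub]
        refine (norm_add_le _ _).trans_lt ?_
        rw [norm_smul, hu1, mul_one, Real.norm_of_nonneg hr.le, two_mul]
        exact add_lt_add_left hv r
  rw [heq, measure_biUnion_finset _ fun b _ => (isOpen_ellipsoid A b r).measurableSet,
    Measure.count_apply_finite _ hf]
  · simp [volume_ellipsoid A _ hr]
  · intro b hb b' hb' hne
    refine Set.disjoint_left.2 fun v hv hv' => hne ?_
    exact hdisj b (hf.mem_toFinset.1 hb) b' (hf.mem_toFinset.1 hb') v hv hv'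

end Slices

/-! ### The density of odd disks of a given radius -/

section SliceVolume

variable {k m : ℕ}

/-- The measure of the set of planes and centers for which the disk of radius `r` is odd. -/
def sliceVolume (S Ω : Set (E (k + m))) (r : ℝ) : ℝ≥0∞ :=
  ∫⁻ A : Fin k → E m, ENNReal.ofReal (nd A)⁻¹ ^ (k + m) *
    volume {p : E (k + m) | (p, A, r) ∈ oddCoords S Ω}

/-- The measure of the set of odd disks of radius `r`, relative to the volume of the disks. -/
def sliceDensity (S Ω : Set (E (k + m))) (r : ℝ) : ℝ≥0∞ :=
  (ENNReal.ofReal (r ^ m))⁻¹ * sliceVolume S Ω r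

theorem volume_slice_eq {S Ω : Set (E (k + m))}
    (hO : MeasurableSet (oddCoords S Ω : Set (E (k + m) × (Fin k → E m) × ℝ)))
    (A : Fin k → E m) (r : ℝ) :
    volume {p : E (k + m) | (p, A, r) ∈ oddCoords S Ω} =
      ∫⁻ z, volume (oddFiber S Ω A r z) := by
  have hm : MeasurableSet {p : E (k + m) | (p, A, r) ∈ oddCoords S Ω} :=
    measurable_prodMk_right hO
  rw [← lintegral_indicator_one hm, lintegral_fiberPoint A (measurable_one.indicator hm)]
  refine lintegral_congr fun z => ?_
  have hz : MeasurableSet (oddFiber S Ω A r z) :=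
    ((continuous_fiberPoint A).measurable.comp measurable_prodMk_left) hm
  rw [← lintegral_indicator_one hz]
  rfl

theorem measurable_volume_oddFiber {S Ω : Set (E (k + m))}
    (hO : MeasurableSet (oddCoords S Ω : Set (E (k + m) × (Fin k → E m) × ℝ)))
    (A : Fin k → E m) (r : ℝ) : Measurable fun z => volume (oddFiber S Ω A r z) := by
  have hm : MeasurableSet {p : E (k + m) | (p, A, r) ∈ oddCoords S Ω} :=
    measurable_prodMk_right hO
  exact measurable_measure_prodMk_left ((continuous_fiberPoint A).measurable hm)

theorem measurable_volume_slice {S Ω : Set (E (k + m))}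
    (hO : MeasurableSet (oddCoords S Ω : Set (E (k + m) × (Fin k → E m) × ℝ))) :
    Measurable fun y : (Fin k → E m) × ℝ =>
      volume {p : E (k + m) | (p, y) ∈ oddCoords S Ω} :=
  measurable_measure_prodMk_right hO

/-- Integration over the centers and planes of all odd disks of the same radius. -/
theorem setLIntegral_oddCoords {S Ω : Set (E (k + m))}
    (hO : MeasurableSet (oddCoords S Ω : Set (E (k + m) × (Fin k → E m) × ℝ)))
    {f : ℝ → ℝ≥0∞} (hf : Measurable f) :
    ∫⁻ t in oddCoords S Ω, f t.2.2 ∂chartVolume k m =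
      ∫⁻ r in Ioi 0, f r * sliceVolume S Ω r := by
  let g : E (k + m) × (Fin k → E m) × ℝ → ℝ≥0∞ := (oddCoords S Ω).indicator fun t => f t.2.2
  have hg : Measurable g := (hf.comp (measurable_snd.comp measurable_snd)).indicator hO
  have hw : Measurable fun t : E (k + m) × (Fin k → E m) × ℝ =>
      ENNReal.ofReal (nd t.2.1)⁻¹ ^ (k + m) :=
    (measurable_weight (k + m)).comp (measurable_fst.comp measurable_snd)
  have h1 : ∫⁻ t in oddCoords S Ω, f t.2.2 ∂chartVolume k m =
      ∫⁻ t, ENNReal.ofReal (nd t.2.1)⁻¹ ^ (k + m) * g t := by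
    rw [← lintegral_indicator hO, chartVolume_eq_withDensity]
    exact lintegral_withDensity_eq_lintegral_mul _ hw hg
  have h2 : ∫⁻ t, ENNReal.ofReal (nd t.2.1)⁻¹ ^ (k + m) * g t =
      ∫⁻ y : (Fin k → E m) × ℝ, ∫⁻ p, ENNReal.ofReal (nd y.1)⁻¹ ^ (k + m) * g (p, y) := by
    rw [Measure.volume_eq_prod]
    exact lintegral_prod_symm' _ (hw.mul hg)
  have h3 : ∀ y : (Fin k → E m) × ℝ,
      ∫⁻ p, ENNReal.ofReal (nd y.1)⁻¹ ^ (k + m) * g (p, y) =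
      f y.2 * (ENNReal.ofReal (nd y.1)⁻¹ ^ (k + m) *
        volume {p : E (k + m) | (p, y) ∈ oddCoords S Ω}) := by
    intro y
    have hm : MeasurableSet {p : E (k + m) | (p, y) ∈ oddCoords S Ω} := measurable_prodMk_right hO
    rw [lintegral_const_mul' _ _ (by simp)]
    have h4 : ∀ p, g (p, y) =
        {p : E (k + m) | (p, y) ∈ oddCoords S Ω}.indicator (fun _ => f y.2) p := fun p => rfl
    simp_rw [h4]
    rw [lintegral_indicator_const hm]
    ring
  have h5 : Measurable fun y : (Fin k → E m) × ℝ => f y.2 *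
      (ENNReal.ofReal (nd y.1)⁻¹ ^ (k + m) *
        volume {p : E (k + m) | (p, y) ∈ oddCoords S Ω}) :=
    (hf.comp measurable_snd).mul (((measurable_weight (k + m)).comp measurable_fst).mul
      (measurable_volume_slice hO))
  have h6 : ∫⁻ y : (Fin k → E m) × ℝ, f y.2 * (ENNReal.ofReal (nd y.1)⁻¹ ^ (k + m) *
        volume {p : E (k + m) | (p, y) ∈ oddCoords S Ω}) =
      ∫⁻ r : ℝ, ∫⁻ A : Fin k → E m, f r * (ENNReal.ofReal (nd A)⁻¹ ^ (k + m) *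
        volume {p : E (k + m) | (p, A, r) ∈ oddCoords S Ω}) := by
    rw [Measure.volume_eq_prod]
    exact lintegral_prod_symm' _ h5
  rw [h1, h2]
  simp_rw [h3]
  rw [h6, ← lintegral_indicator measurableSet_Ioi]
  refine lintegral_congr fun r => ?_
  by_cases hr : 0 < r
  · rw [indicator_of_mem (mem_Ioi.2 hr), sliceVolume, lintegral_const_mul]
    exact (measurable_weight (k + m)).mul
      ((measurable_volume_slice hO).comp measurable_prodMk_right)
  · rw [indicator_of_notMem (show r ∉ Ioi (0 : ℝ) from hr)]
    have h7 : ∀ A : Fin k → E m, {p : E (k + m) | (p, A, r) ∈ oddCoords S Ω} = ∅ := fun A =>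
      eq_empty_of_forall_notMem fun p hp => hr hp.1
    simp [h7]

/-- The limit of `sliceDensity` at zero. -/
def limitDensity (S : Set (E (k + m))) : ℝ≥0∞ :=
  volume (Metric.ball (0 : E m) 1) * (chartConst k m * (μHE[k] : Measure (E (k + m))) S)

section

variable {M S Ω : Set (E (k + m))}

theorem fiberCount_bound_integral (hM : IsBoundedManifold k M) (hS : MeasurableSet S)
    (hSM : S ⊆ closure M) :
    ∫⁻ A : Fin k → E m, ENNReal.ofReal (nd A)⁻¹ ^ (k + m) * ((∫⁻ z, fiberCount S A z) *
      (volume (Metric.ball (0 : E m) 1) * ENNReal.ofReal (nd A)⁻¹)) = limitDensity S := by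
  rw [limitDensity, ← (lintegral_fiberCount hM hS hSM).2.2,
    ← lintegral_const_mul' _ _ measure_ball_lt_top.ne]
  refine lintegral_congr fun A => ?_
  ring

theorem lintegral_fiberCount_mul (A : Fin k → E m) :
    ∫⁻ z, fiberCount S A z * (volume (Metric.ball (0 : E m) 1) * ENNReal.ofReal (nd A)⁻¹) =
      (∫⁻ z, fiberCount S A z) *
        (volume (Metric.ball (0 : E m) 1) * ENNReal.ofReal (nd A)⁻¹) :=
  lintegral_mul_const' _ _ (ENNReal.mul_ne_top measure_ball_lt_top.ne ENNReal.ofReal_ne_top)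

theorem inv_mul_volume_oddFiber_le (A : Fin k → E m) {r : ℝ} (hr : 0 < r) (z : E k) :
    (ENNReal.ofReal (r ^ m))⁻¹ * volume (oddFiber S Ω A r z) ≤
      fiberCount S A z * (volume (Metric.ball (0 : E m) 1) * ENNReal.ofReal (nd A)⁻¹) := by
  have h0 : ENNReal.ofReal (r ^ m) ≠ 0 := by simpa using pow_pos hr m
  calc _ ≤ (ENNReal.ofReal (r ^ m))⁻¹ * _ := mul_le_mul_right (volume_oddFiber_le S Ω A hr z) _
    _ = (ENNReal.ofReal (r ^ m))⁻¹ * ENNReal.ofReal (r ^ m) * (fiberCount S A z *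
          (volume (Metric.ball (0 : E m) 1) * ENNReal.ofReal (nd A)⁻¹)) := by ring
    _ = _ := by rw [ENNReal.inv_mul_cancel h0 ENNReal.ofReal_ne_top, one_mul]

theorem sliceDensity_eq
    (hO : MeasurableSet (oddCoords S Ω : Set (E (k + m) × (Fin k → E m) × ℝ))) {r : ℝ}
    (hr : 0 < r) : sliceDensity S Ω r =
      ∫⁻ A : Fin k → E m, ENNReal.ofReal (nd A)⁻¹ ^ (k + m) *
        ∫⁻ z, (ENNReal.ofReal (r ^ m))⁻¹ * volume (oddFiber S Ω A r z) := by
  have h0 : ENNReal.ofReal (r ^ m) ≠ 0 := by simpa using pow_pos hr m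
  rw [sliceDensity, sliceVolume, ← lintegral_const_mul' _ _ (ENNReal.inv_ne_top.2 h0)]
  refine lintegral_congr fun A => ?_
  rw [volume_slice_eq hO, lintegral_const_mul' _ _ (ENNReal.inv_ne_top.2 h0)]
  ring

theorem sliceDensity_le
    (hO : MeasurableSet (oddCoords S Ω : Set (E (k + m) × (Fin k → E m) × ℝ)))
    (hM : IsBoundedManifold k M) (hS : MeasurableSet S) (hSM : S ⊆ closure M) {r : ℝ}
    (hr : 0 < r) : sliceDensity S Ω r ≤ limitDensity S := by
  rw [sliceDensity_eq hO hr, ← fiberCount_bound_integral hM hS hSM]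
  refine lintegral_mono fun A => ?_
  rw [← lintegral_fiberCount_mul]
  exact mul_le_mul_right (lintegral_mono fun z => inv_mul_volume_oddFiber_le A hr z) _

theorem limitDensity_ne_top (hM : IsBoundedManifold k M) (hSM : S ⊆ closure M) :
    limitDensity S ≠ ⊤ := by
  refine ENNReal.mul_ne_top measure_ball_lt_top.ne (ENNReal.mul_ne_top ?_
    ((measure_mono hSM).trans_lt (euclideanHausdorffMeasure_closure_lt_top hM)).ne)
  rw [chartConst_eq]
  exact ENNReal.ofReal_ne_top

/-- In almost all fibers, the volume of the centers of odd disks of small radius is the number of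
points of `S` times the volume of a disk. The limit is given by the integral-geometric formula. -/
theorem tendsto_sliceDensity (hm : 0 < m)
    (hO : MeasurableSet (oddCoords S Ω : Set (E (k + m) × (Fin k → E m) × ℝ)))
    (hM : IsBoundedManifold k M) (hS : MeasurableSet S) (hSM : S ⊆ closure M) (hΩ : IsOpen Ω)
    (hSΩ : S ⊆ Ω) : Tendsto (sliceDensity S Ω) (𝓝[>] 0) (𝓝 (limitDensity S)) := by
  obtain ⟨hfm, hfA, hfi⟩ := lintegral_fiberCount hM hS hSM
  have hpos : ∀ᶠ r : ℝ in 𝓝[>] 0, 0 < r := self_mem_nhdsWithin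
  have hc : ∀ A : Fin k → E m,
      volume (Metric.ball (0 : E m) 1) * ENNReal.ofReal (nd A)⁻¹ ≠ ⊤ := fun A =>
    ENNReal.mul_ne_top measure_ball_lt_top.ne ENNReal.ofReal_ne_top
  have hfin : ∀ᵐ A : Fin k → E m, ∫⁻ z, fiberCount S A z < ⊤ := by
    have h1 : ∫⁻ A : Fin k → E m, (∫⁻ z, fiberCount S A z) *
        ENNReal.ofReal (nd A)⁻¹ ^ (k + (m + 1)) ≠ ⊤ := by
      rw [hfi]
      refine ENNReal.mul_ne_top ?_
        ((measure_mono hSM).trans_lt (euclideanHausdorffMeasure_closure_lt_top hM)).ne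
      rw [chartConst_eq]
      exact ENNReal.ofReal_ne_top
    filter_upwards [ae_lt_top (hfA.mul (measurable_weight (k + (m + 1)))) h1] with A hA
    by_contra htop
    rw [not_lt, top_le_iff] at htop
    rw [Pi.mul_apply, htop, ENNReal.top_mul] at hA
    · exact lt_irrefl _ hA
    · exact pow_ne_zero _ (by simpa using nd_pos A)
  have hinner : ∀ A : Fin k → E m, ∫⁻ z, fiberCount S A z < ⊤ →
      Tendsto (fun r => ∫⁻ z, (ENNReal.ofReal (r ^ m))⁻¹ * volume (oddFiber S Ω A r z)) (𝓝[>] 0)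
        (𝓝 (∫⁻ z, fiberCount S A z *
          (volume (Metric.ball (0 : E m) 1) * ENNReal.ofReal (nd A)⁻¹))) := by
    intro A hA
    refine tendsto_lintegral_filter_of_dominated_convergence
      (fun z => fiberCount S A z *
        (volume (Metric.ball (0 : E m) 1) * ENNReal.ofReal (nd A)⁻¹)) ?_ ?_ ?_ ?_
    · exact Eventually.of_forall fun r => (measurable_volume_oddFiber hO A r).const_mul _
    · filter_upwards [hpos] with r hr
      exact Eventually.of_forall fun z => inv_mul_volume_oddFiber_le A hr z
    · rw [lintegral_fiberCount_mul]
      exact ENNReal.mul_ne_top hA.ne (hc A)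
    · filter_upwards [ae_lt_top' (hfm A) hA.ne] with z hz
      refine tendsto_const_nhds.congr' ?_
      filter_upwards [eventually_volume_oddFiber hm hΩ hSΩ A z hz.ne, hpos] with r hr hr0
      have h0 : ENNReal.ofReal (r ^ m) ≠ 0 := by simpa using pow_pos hr0 m
      rw [hr, ← one_mul (fiberCount S A z * _), ← ENNReal.inv_mul_cancel h0 ENNReal.ofReal_ne_top]
      ring
  rw [← fiberCount_bound_integral hM hS hSM]
  refine Tendsto.congr' (f₁ := fun r => ∫⁻ A : Fin k → E m,
    ENNReal.ofReal (nd A)⁻¹ ^ (k + m) *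
      ∫⁻ z, (ENNReal.ofReal (r ^ m))⁻¹ * volume (oddFiber S Ω A r z)) ?_ ?_
  · filter_upwards [hpos] with r hr
    exact (sliceDensity_eq hO hr).symm
  refine tendsto_lintegral_filter_of_dominated_convergence
    (fun A : Fin k → E m => ENNReal.ofReal (nd A)⁻¹ ^ (k + m) * ((∫⁻ z, fiberCount S A z) *
      (volume (Metric.ball (0 : E m) 1) * ENNReal.ofReal (nd A)⁻¹))) ?_ ?_ ?_ ?_
  · filter_upwards [hpos] with r hr
    have h0 : ENNReal.ofReal (r ^ m) ≠ 0 := by simpa using pow_pos hr m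
    simp_rw [lintegral_const_mul' _ _ (ENNReal.inv_ne_top.2 h0), ← volume_slice_eq hO]
    exact (measurable_weight (k + m)).mul
      (((measurable_volume_slice hO).comp measurable_prodMk_right).const_mul _)
  · filter_upwards [hpos] with r hr
    refine Eventually.of_forall fun A => ?_
    rw [← lintegral_fiberCount_mul]
    exact mul_le_mul_right (lintegral_mono fun z => inv_mul_volume_oddFiber_le A hr z) _
  · rw [fiberCount_bound_integral hM hS hSM]
    exact limitDensity_ne_top hM hSM
  · filter_upwards [hfin] with A hA
    rw [← lintegral_fiberCount_mul]
    exact ENNReal.Tendsto.const_mul (hinner A hA) (Or.inr (by simp))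

end

/-! ### Disks of large radius -/

theorem pow_sub_pow_le {a b : ℝ} (hb : 0 ≤ b) (ha : 0 < a) (m : ℕ) :
    a ^ m - b ^ m ≤ a ^ m * (m * ((a - b) / a)) := by
  have h1 := one_add_mul_le_pow (a := (b - a) / a) (by
    rw [le_div_iff₀ ha]; linarith) m
  have h2 : 1 + (b - a) / a = b / a := by field_simp; ring
  rw [h2, div_pow, le_div_iff₀ (pow_pos ha m)] at h1
  have h3 : (a - b) / a = -((b - a) / a) := by ring
  rw [h3]
  linarith

theorem volume_shell_le (hm : 0 < m) {R r : ℝ} (hR : 0 < R) (hr : R ≤ r) :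
    volume {v : E m | r - R ≤ ‖v‖ ∧ ‖v‖ ≤ r + R} ≤
      ENNReal.ofReal (r ^ m) * (volume (Metric.ball (0 : E m) 1) *
        ENNReal.ofReal (2 ^ m * (m * (2 * R))) * ENNReal.ofReal r⁻¹) := by
  have hr0 : 0 < r := hR.trans_le hr
  have hsub : {v : E m | r - R ≤ ‖v‖ ∧ ‖v‖ ≤ r + R} ⊆
      Metric.closedBall 0 (r + R) \ Metric.ball 0 (r - R) := fun v hv => by
    rw [Set.mem_sdiff, mem_closedBall_zero_iff, mem_ball_zero_iff, not_lt]
    exact ⟨hv.2, hv.1⟩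
  have hvol : volume (Metric.ball (0 : E m) (r - R)) =
      ENNReal.ofReal ((r - R) ^ m) * volume (Metric.ball (0 : E m) 1) := by
    have : Nonempty (Fin m) := ⟨⟨0, hm⟩⟩
    rw [Measure.addHaar_ball _ _ (by linarith), finrank_euclideanSpace_fin]
  have hvol' : volume (Metric.closedBall (0 : E m) (r + R)) =
      ENNReal.ofReal ((r + R) ^ m) * volume (Metric.ball (0 : E m) 1) := by
    rw [Measure.addHaar_closedBall _ _ (by linarith), finrank_euclideanSpace_fin]
  refine (measure_mono hsub).trans ?_
  rw [measure_sdiff (Metric.ball_subset_closedBall.trans (Metric.closedBall_subset_closedBall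
    (by linarith))) measurableSet_ball.nullMeasurableSet measure_ball_lt_top.ne, hvol, hvol',
    ← ENNReal.sub_mul (fun _ _ => measure_ball_lt_top.ne),
    ← ENNReal.ofReal_sub _ (pow_nonneg (by linarith) m)]
  have h1 : (r + R) ^ m - (r - R) ^ m ≤ r ^ m * (2 ^ m * (m * (2 * R)) * r⁻¹) := by
    -- The shell has thickness `2 * R` and volume of order `R * r ^ (m - 1)`.
    have h2 := pow_sub_pow_le (a := r + R) (b := r - R) (by linarith) (by linarith) m
    refine h2.trans ?_
    have h3 : (r + R) ^ m ≤ r ^ m * 2 ^ m := by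
      rw [← mul_pow]
      exact pow_le_pow_left₀ (by linarith) (by linarith) m
    have h4 : (r + R - (r - R)) / (r + R) ≤ 2 * R * r⁻¹ := by
      rw [← div_eq_mul_inv]
      have : r + R - (r - R) = 2 * R := by ring
      rw [this]
      exact div_le_div_of_nonneg_left (by linarith) hr0 (by linarith)
    calc (r + R) ^ m * (m * ((r + R - (r - R)) / (r + R)))
        ≤ (r ^ m * 2 ^ m) * (m * (2 * R * r⁻¹)) :=
          mul_le_mul h3 (by gcongr) (mul_nonneg (by positivity) (div_nonneg (by linarith)
            (by linarith))) (by positivity)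
      _ = _ := by ring
  calc _ ≤ ENNReal.ofReal (r ^ m * (2 ^ m * (m * (2 * R)) * r⁻¹)) *
        volume (Metric.ball (0 : E m) 1) := mul_le_mul_left (ENNReal.ofReal_le_ofReal h1) _
    _ = _ := by
      rw [ENNReal.ofReal_mul (pow_nonneg hr0.le m), ENNReal.ofReal_mul (by positivity)]
      ring

theorem coef_graph_isometry {A : Fin k → E m} {Q : E (k + m) ≃ₗᵢ[ℝ] E (k + m)}
    {T : E k ≃ₗ[ℝ] E k} (h : ∀ u, lin (graph A) u = Q (stdIncl k m (T u))) {x : E (k + m)}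
    (hx : coef (graph A) x = 0) : coef (graph (0 : Fin k → E m)) (Q.symm x) = 0 := by
  refine ext_inner_right ℝ fun u => ?_
  rw [inner_coef_left, inner_zero_left, ← stdIncl_apply, ← T.apply_symm_apply u,
    ← Q.inner_map_map, Q.apply_symm_apply, ← h, ← inner_coef_left, hx, inner_zero_left]

/-- In coordinates adapted to the plane, the center of a disk whose boundary meets the ball of
radius `R` has a component of length at most `R` in the plane and one of length about `r` orthogonal
to it. -/
theorem volume_slice_le_of_large {S Ω : Set (E (k + m))} {R r : ℝ} (hR : 0 < R)
    (hΩ : Ω ⊆ Metric.closedBall 0 R) (hr : R ≤ r) (A : Fin k → E m) :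
    volume {p : E (k + m) | (p, A, r) ∈ oddCoords S Ω} ≤
      volume (Metric.closedBall (0 : E k) R) * volume {v : E m | r - R ≤ ‖v‖ ∧ ‖v‖ ≤ r + R} := by
  obtain ⟨Q, T, hQ, -⟩ := exists_isometry_comp_stdIncl
    (L := (lin (graph A) : E k →ₗ[ℝ] E (k + m))) (lin_graph_injective A)
  have hsub : {p : E (k + m) | (p, A, r) ∈ oddCoords S Ω} ⊆ Q.symm ⁻¹' (join ''
      (Metric.closedBall (0 : E k) R ×ˢ {v : E m | r - R ≤ ‖v‖ ∧ ‖v‖ ≤ r + R})) := by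
    rintro p ⟨-, -, -, x, ⟨hx, hxr⟩, hxΩ⟩
    change coef (graph A) x = coef (graph A) p at hx
    change ‖x - p‖ = r at hxr
    have h1 : coef (graph (0 : Fin k → E m)) (Q.symm (x - p)) = 0 :=
      coef_graph_isometry hQ (by rw [map_sub, hx, sub_self])
    have h2 : ‖Q.symm x‖ ≤ R := by
      rw [LinearIsometryEquiv.norm_map]
      exact mem_closedBall_zero_iff.1 (hΩ hxΩ)
    have h3 : ‖Q.symm x - Q.symm p‖ = r := by
      rw [← map_sub, LinearIsometryEquiv.norm_map, hxr]
    rw [map_sub] at h1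
    obtain ⟨⟨a, b⟩, hab⟩ := (joinL k m).surjective (Q.symm x)
    obtain ⟨⟨c, d⟩, hcd⟩ := (joinL k m).surjective (Q.symm p)
    rw [joinL_apply] at hab hcd
    have h0 : ∀ y : E m, coef (0 : Fin k → E m) y = 0 := fun y => by
      rw [coef_eq_zero_iff]; simp
    rw [← hab, ← hcd, map_sub, coef_graph_join, coef_graph_join] at h1
    simp only [h0, add_zero] at h1
    have hac : a = c := sub_eq_zero.1 h1
    have h4 := norm_join_sq (a, b)
    rw [hab] at h4
    have h5 := norm_join_sq ((a, b) - (c, d))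
    rw [join_sub, hab, hcd, h3] at h5
    simp only [Prod.mk_sub_mk, hac, sub_self, norm_zero] at h4 h5
    have hr0 : 0 ≤ r := hR.le.trans hr
    have hbd : ‖b - d‖ = r := by
      refine ((sq_eq_sq₀ hr0 (norm_nonneg _)).1 ?_).symm
      linarith
    have hsq : ‖Q.symm x‖ ^ 2 ≤ R ^ 2 := pow_le_pow_left₀ (norm_nonneg _) h2 2
    have hc : ‖c‖ ≤ R := abs_le_of_sq_le_sq' (by nlinarith [sq_nonneg ‖b‖]) hR.le |>.2
    have hb : ‖b‖ ≤ R := abs_le_of_sq_le_sq' (by nlinarith [sq_nonneg ‖c‖]) hR.le |>.2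
    refine ⟨(c, d), ⟨mem_closedBall_zero_iff.2 hc, ?_, ?_⟩, hcd⟩
    · have := norm_sub_le b d
      change r - R ≤ ‖d‖
      linarith
    · have := norm_sub_norm_le d b
      rw [norm_sub_rev d b] at this
      change ‖d‖ ≤ r + R
      linarith
  refine (measure_mono hsub).trans ?_
  have h1 : volume (Q.symm ⁻¹' (join ''
      (Metric.closedBall (0 : E k) R ×ˢ {v : E m | r - R ≤ ‖v‖ ∧ ‖v‖ ≤ r + R}))) =
      volume (join '' (Metric.closedBall (0 : E k) R ×ˢ
        {v : E m | r - R ≤ ‖v‖ ∧ ‖v‖ ≤ r + R})) :=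
    Q.symm.measurePreserving.measure_preimage_emb
      Q.symm.toHomeomorph.measurableEmbedding _
  have h2 := measurePreserving_join.measure_preimage_emb measurableEmbedding_join
    (join '' (Metric.closedBall (0 : E k) R ×ˢ {v : E m | r - R ≤ ‖v‖ ∧ ‖v‖ ≤ r + R}))
  rw [preimage_image_eq _ measurableEmbedding_join.injective] at h2
  rw [h1, ← h2, Measure.volume_eq_prod, Measure.prod_prod]

/-- The boundary of a large disk is unlikely to meet a bounded set. -/
theorem exists_sliceDensity_le_of_large (hm : 0 < m) {Ω : Set (E (k + m))}
    (hΩ : Bornology.IsBounded Ω) (S : Set (E (k + m))) :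
    ∃ C : ℝ≥0∞, C ≠ ⊤ ∧ ∃ R : ℝ, 0 < R ∧ ∀ r, R ≤ r →
      sliceDensity S Ω r ≤ C * ENNReal.ofReal r⁻¹ := by
  obtain ⟨R, hR, hΩR⟩ : ∃ R : ℝ, 0 < R ∧ Ω ⊆ Metric.closedBall 0 R := by
    obtain ⟨R, hR⟩ := hΩ.subset_closedBall 0
    exact ⟨max R 1, by positivity, hR.trans (Metric.closedBall_subset_closedBall (le_max_left _ _))⟩
  let c : ℝ≥0∞ := volume (Metric.closedBall (0 : E k) R) *
    (volume (Metric.ball (0 : E m) 1) * ENNReal.ofReal (2 ^ m * (m * (2 * R))))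
  have hc : c ≠ ⊤ := ENNReal.mul_ne_top measure_closedBall_lt_top.ne
    (ENNReal.mul_ne_top measure_ball_lt_top.ne ENNReal.ofReal_ne_top)
  have hρ : ∫⁻ A : Fin k → E m, ENNReal.ofReal (nd A)⁻¹ ^ (k + m) ≠ ⊤ := by
    have h := chartMeasure_univ_lt_top (k := k) (m := m)
    rw [chartMeasure, withDensity_apply _ .univ, Measure.restrict_univ] at h
    exact h.ne
  refine ⟨c * ∫⁻ A : Fin k → E m, ENNReal.ofReal (nd A)⁻¹ ^ (k + m), ENNReal.mul_ne_top hc hρ,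
    R, hR, fun r hr => ?_⟩
  have hr0 : 0 < r := hR.trans_le hr
  have h0 : ENNReal.ofReal (r ^ m) ≠ 0 := by simpa using pow_pos hr0 m
  have h1 : sliceVolume S Ω r ≤ ENNReal.ofReal (r ^ m) * (c * (∫⁻ A : Fin k → E m,
      ENNReal.ofReal (nd A)⁻¹ ^ (k + m)) * ENNReal.ofReal r⁻¹) := by
    calc sliceVolume S Ω r ≤ ∫⁻ A : Fin k → E m, ENNReal.ofReal (nd A)⁻¹ ^ (k + m) *
          (ENNReal.ofReal (r ^ m) * (c * ENNReal.ofReal r⁻¹)) := by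
          refine lintegral_mono fun A => mul_le_mul_right ?_ _
          refine (volume_slice_le_of_large hR hΩR hr A).trans ?_
          calc _ ≤ volume (Metric.closedBall (0 : E k) R) * _ :=
                mul_le_mul_right (volume_shell_le hm hR hr) _
            _ = _ := by simp only [c]; ring
      _ = (∫⁻ A : Fin k → E m, ENNReal.ofReal (nd A)⁻¹ ^ (k + m)) *
          (ENNReal.ofReal (r ^ m) * (c * ENNReal.ofReal r⁻¹)) :=
          lintegral_mul_const' _ _ (ENNReal.mul_ne_top ENNReal.ofReal_ne_top
            (ENNReal.mul_ne_top hc ENNReal.ofReal_ne_top))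
      _ = _ := by ring
  calc sliceDensity S Ω r ≤ (ENNReal.ofReal (r ^ m))⁻¹ * _ := mul_le_mul_right h1 _
    _ = _ := by rw [← mul_assoc, ENNReal.inv_mul_cancel h0 ENNReal.ofReal_ne_top, one_mul]

end SliceVolume

/-! ### The limit of weighted radial integrals -/

section Radial

theorem lintegral_Ioc_rpow {δ σ : ℝ} (hδ : 0 < δ) (hσ : σ < 1) :
    ∫⁻ r in Ioc 0 δ, ENNReal.ofReal (r ^ (-σ)) = ENNReal.ofReal (δ ^ (1 - σ) / (1 - σ)) := by
  have hi : IntervalIntegrable (fun r : ℝ => r ^ (-σ)) volume 0 δ :=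
    intervalIntegral.intervalIntegrable_rpow' (by linarith)
  rw [← ofReal_integral_eq_lintegral_ofReal
    ((intervalIntegrable_iff_integrableOn_Ioc_of_le hδ.le).1 hi),
    ← intervalIntegral.integral_of_le hδ.le, integral_rpow (Or.inl (by linarith)),
    Real.zero_rpow (by linarith), sub_zero, neg_add_eq_sub]
  filter_upwards [ae_restrict_mem measurableSet_Ioc] with r hr
  exact Real.rpow_nonneg hr.1.le _

theorem lintegral_Ioi_rpow {R σ : ℝ} (hR : 0 < R) (hσ : 0 < σ) :
    ∫⁻ r in Ioi R, ENNReal.ofReal (r ^ (-σ - 1)) = ENNReal.ofReal (R ^ (-σ) / σ) := by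
  rw [← ofReal_integral_eq_lintegral_ofReal
    (integrableOn_Ioi_rpow_of_lt (by linarith) hR), integral_Ioi_rpow_of_lt (by linarith) hR]
  · congr 1
    rw [sub_add_cancel, neg_div_neg_eq]
  · filter_upwards [ae_restrict_mem measurableSet_Ioi] with r hr
    exact Real.rpow_nonneg (hR.trans hr).le _

variable {h : ℝ → ℝ≥0∞} {a C : ℝ≥0∞} {R σ : ℝ}

/-- The weight `r ^ (-σ)` is integrable at zero since `σ < 1`, and the decay of `h` makes the
integral converge at infinity since `0 < σ`. -/
theorem lintegral_rpow_mul_le (ha : ∀ r, 0 < r → h r ≤ a) (hat : a ≠ ⊤) (hC : C ≠ ⊤) (hR : 0 < R)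
    (hb : ∀ r, R ≤ r → h r ≤ C * ENNReal.ofReal r⁻¹) (hσ : σ ∈ Ioo (0 : ℝ) 1) :
    ∫⁻ r in Ioi 0, ENNReal.ofReal (r ^ (-σ)) * h r ≤
      ENNReal.ofReal (R ^ (1 - σ) / (1 - σ)) * a + ENNReal.ofReal (R ^ (-σ) / σ) * C := by
  rw [← Ioc_union_Ioi_eq_Ioi hR.le]
  refine (lintegral_union_le _ _ _).trans (add_le_add ?_ ?_)
  · rw [← lintegral_Ioc_rpow hR hσ.2, ← lintegral_mul_const' _ _ hat]
    exact setLIntegral_mono' measurableSet_Ioc fun r hr => mul_le_mul_right (ha r hr.1) _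
  · rw [← lintegral_Ioi_rpow hR hσ.1, ← lintegral_mul_const' _ _ hC]
    refine setLIntegral_mono' measurableSet_Ioi fun r hr => ?_
    have hr0 : 0 < r := hR.trans hr
    refine (mul_le_mul_right (hb r (le_of_lt hr)) _).trans (le_of_eq ?_)
    rw [Real.rpow_sub_one hr0.ne', div_eq_mul_inv, ENNReal.ofReal_mul (by positivity)]
    ring

/-- As `σ` tends to `1`, the measures `(1 - σ) r ^ (-σ) dr` concentrate at zero. -/
theorem tendsto_lintegral_rpow_mul (ha : ∀ r, 0 < r → h r ≤ a) (hat : a ≠ ⊤)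
    (hl : Tendsto h (𝓝[>] 0) (𝓝 a)) (hC : C ≠ ⊤) (hR : 0 < R)
    (hb : ∀ r, R ≤ r → h r ≤ C * ENNReal.ofReal r⁻¹) :
    Tendsto (fun σ : ℝ => ENNReal.ofReal (1 - σ) *
      ∫⁻ r in Ioi 0, ENNReal.ofReal (r ^ (-σ)) * h r) (𝓝[<] 1) (𝓝 a) := by
  have hσ : ∀ᶠ σ : ℝ in 𝓝[<] 1, σ ∈ Ioo (0 : ℝ) 1 := Ioo_mem_nhdsLT one_pos
  have hpow : ∀ {δ : ℝ}, 0 < δ →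
      Tendsto (fun σ : ℝ => ENNReal.ofReal (δ ^ (1 - σ))) (𝓝[<] 1) (𝓝 1) := by
    intro δ hδ
    have h1 : Continuous fun σ : ℝ => ENNReal.ofReal (δ ^ (1 - σ)) :=
      ENNReal.continuous_ofReal.comp
        (continuous_const.rpow (continuous_const.sub continuous_id) fun _ => Or.inl hδ.ne')
    have h2 := h1.tendsto 1
    rw [sub_self, Real.rpow_zero, ENNReal.ofReal_one] at h2
    exact h2.mono_left nhdsWithin_le_nhds
  have hup : Tendsto (fun σ : ℝ => ENNReal.ofReal (R ^ (1 - σ)) * a +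
      ENNReal.ofReal ((1 - σ) * (R ^ (-σ) / σ)) * C) (𝓝[<] 1) (𝓝 a) := by
    have h1 : Tendsto (fun σ : ℝ => ENNReal.ofReal (R ^ (1 - σ)) * a) (𝓝[<] 1) (𝓝 (1 * a)) :=
      ENNReal.Tendsto.mul_const (hpow hR) (Or.inr hat)
    have h2 : Tendsto (fun σ : ℝ => ENNReal.ofReal ((1 - σ) * (R ^ (-σ) / σ)) * C) (𝓝[<] 1)
        (𝓝 (ENNReal.ofReal ((1 - 1) * (R ^ (-1 : ℝ) / 1)) * C)) := by
      refine ENNReal.Tendsto.mul_const (ENNReal.tendsto_ofReal ?_) (Or.inr hC)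
      refine Tendsto.mono_left ?_ nhdsWithin_le_nhds
      refine (tendsto_const_nhds.sub tendsto_id).mul (Tendsto.div ?_ tendsto_id one_ne_zero)
      exact tendsto_const_nhds.rpow tendsto_id.neg (Or.inl hR.ne')
    simpa using h1.add h2
  refine tendsto_order.2 ⟨fun b hba => ?_, fun b hab => ?_⟩
  · obtain ⟨c, hbc, hca⟩ := exists_between hba
    obtain ⟨δ, hδ, hδh⟩ := mem_nhdsGT_iff_exists_Ioc_subset.1 (hl.eventually (lt_mem_nhds hca))
    have hδ : 0 < δ := hδ
    have h1 : Tendsto (fun σ : ℝ => ENNReal.ofReal (δ ^ (1 - σ)) * c) (𝓝[<] 1) (𝓝 (1 * c)) :=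
      ENNReal.Tendsto.mul_const (hpow hδ) (Or.inr hca.ne_top)
    rw [one_mul] at h1
    filter_upwards [h1.eventually (lt_mem_nhds hbc), hσ] with σ h2 hσ
    refine h2.trans_le ?_
    have hσ' : 0 < 1 - σ := sub_pos.2 hσ.2
    calc ENNReal.ofReal (δ ^ (1 - σ)) * c
        = ENNReal.ofReal (1 - σ) * ∫⁻ r in Ioc 0 δ, ENNReal.ofReal (r ^ (-σ)) * c := by
          rw [lintegral_mul_const' _ _ hca.ne_top, lintegral_Ioc_rpow hδ hσ.2, ← mul_assoc,
            ← ENNReal.ofReal_mul hσ'.le, mul_div_cancel₀ _ hσ'.ne']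
      _ ≤ ENNReal.ofReal (1 - σ) * ∫⁻ r in Ioc 0 δ, ENNReal.ofReal (r ^ (-σ)) * h r :=
          mul_le_mul_right (setLIntegral_mono' measurableSet_Ioc fun r hr =>
            mul_le_mul_right (show c < h r from hδh hr).le _) _
      _ ≤ _ := mul_le_mul_right (lintegral_mono_set Ioc_subset_Ioi_self) _
  · filter_upwards [hup.eventually (gt_mem_nhds hab), hσ] with σ h2 hσ
    refine lt_of_le_of_lt ?_ h2
    have hσ' : 0 < 1 - σ := sub_pos.2 hσ.2
    refine (mul_le_mul_right (lintegral_rpow_mul_le ha hat hC hR hb hσ) _).trans (le_of_eq ?_)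
    rw [mul_add, ← mul_assoc, ← mul_assoc, ← ENNReal.ofReal_mul hσ'.le,
      ← ENNReal.ofReal_mul hσ'.le, mul_div_cancel₀ _ hσ'.ne']

end Radial

/-! ### The constant -/

section LimitConstant

/-- Numerators and denominators telescope to those of `chartConst_eq`, up to the first and last
factors. -/
theorem prod_Icc_gamma_eq (k m : ℕ) (hm : 0 < m) :
    ∏ i ∈ Finset.Icc 1 (k + 1), Real.Gamma ((i : ℝ) / 2) /
        (Real.pi ^ i * Real.Gamma ((((k + m : ℕ) : ℝ) - i + 1) / 2)) =
      √Real.pi * Real.Gamma (((m : ℝ) + k + 1) / 2) /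
        (Real.pi ^ (((k : ℝ) + 1) * (k + 2) / 2) * Real.Gamma ((m : ℝ) / 2) *
          Real.Gamma (((m : ℝ) + 1) / 2)) *
        ∏ i ∈ Finset.range k,
          (Real.Gamma (((i : ℝ) + 2) / 2) / Real.Gamma (((m : ℝ) + i + 2) / 2)) := by
  have hπ : ∀ j : ℕ, ∏ i ∈ Finset.range j, Real.pi ^ (i + 1) =
      Real.pi ^ ((j : ℝ) * (j + 1) / 2) := by
    intro j
    induction j with
    | zero => simp
    | succ j ih =>
      rw [Finset.prod_range_succ, ih, ← Real.rpow_natCast, ← Real.rpow_add Real.pi_pos]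
      congr 1
      push_cast
      ring
  have hden : ∀ j : ℕ, (∏ i ∈ Finset.range (j + 1), Real.Gamma (((m : ℝ) + i) / 2)) *
      Real.Gamma (((m : ℝ) + j + 1) / 2) = Real.Gamma ((m : ℝ) / 2) *
        Real.Gamma (((m : ℝ) + 1) / 2) *
          ∏ i ∈ Finset.range j, Real.Gamma (((m : ℝ) + i + 2) / 2) := by
    intro j
    induction j with
    | zero => simp
    | succ j ih =>
      have h : ((m : ℝ) + ((j + 1 : ℕ) : ℝ)) = (m : ℝ) + j + 1 := by push_cast; ring
      rw [Finset.prod_range_succ, h, ih, Finset.prod_range_succ _ j, mul_assoc, mul_assoc,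
        mul_assoc, add_assoc _ 1 1, one_add_one_eq_two]
  -- The order of the factors is reversed by `i ↦ k - i`.
  have hrefl : ∏ i ∈ Finset.range (k + 1), Real.Gamma ((((k + m : ℕ) : ℝ) - (i + 1 : ℕ) + 1) / 2) =
      ∏ i ∈ Finset.range (k + 1), Real.Gamma (((m : ℝ) + i) / 2) := by
    rw [← Finset.prod_range_reflect]
    refine Finset.prod_congr rfl fun i hi => ?_
    have : i ≤ k := Nat.lt_succ_iff.1 (Finset.mem_range.1 hi)
    rw [show k + 1 - 1 - i = k - i by omega]
    push_cast [Nat.cast_sub this]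
    congr 2
    ring
  have hnum : ∏ i ∈ Finset.range (k + 1), Real.Gamma (((i + 1 : ℕ) : ℝ) / 2) =
      √Real.pi * ∏ i ∈ Finset.range k, Real.Gamma (((i : ℝ) + 2) / 2) := by
    rw [Finset.prod_range_succ', mul_comm]
    congr 1
    · rw [← Real.Gamma_one_half_eq]; simp
    · refine Finset.prod_congr rfl fun i _ => ?_
      push_cast
      congr 2
      ring
  have hIcc : Finset.Icc 1 (k + 1) = Finset.Ico 1 (k + 1 + 1) := rfl
  rw [hIcc, Finset.prod_Ico_eq_prod_range, Finset.prod_div_distrib, Finset.prod_mul_distrib,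
    Finset.prod_div_distrib]
  simp only [Nat.add_sub_cancel, add_comm 1]
  rw [hrefl, hnum, hπ]
  have hG : ∀ x : ℝ, 0 < x → Real.Gamma x ≠ 0 := fun x hx => (Real.Gamma_pos_of_pos hx).ne'
  have hm' : (0 : ℝ) < m := Nat.cast_pos.2 hm
  have g1 := hG ((m : ℝ) / 2) (by positivity)
  have g2 := hG (((m : ℝ) + 1) / 2) (by positivity)
  have g3 := hG (((m : ℝ) + k + 1) / 2) (by positivity)
  have g4 : ∏ i ∈ Finset.range k, Real.Gamma (((m : ℝ) + i + 2) / 2) ≠ 0 :=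
    Finset.prod_ne_zero_iff.2 fun i _ => hG _ (by positivity)
  have h1 : ∏ i ∈ Finset.range (k + 1), Real.Gamma (((m : ℝ) + i) / 2) =
      Real.Gamma ((m : ℝ) / 2) * Real.Gamma (((m : ℝ) + 1) / 2) *
        (∏ i ∈ Finset.range k, Real.Gamma (((m : ℝ) + i + 2) / 2)) /
          Real.Gamma (((m : ℝ) + k + 1) / 2) := by
    rw [eq_div_iff g3, hden]
  rw [h1]
  have h2 : (((k + 1 : ℕ) : ℝ) * (((k + 1 : ℕ) : ℝ) + 1) / 2) = ((k : ℝ) + 1) * (k + 2) / 2 := by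
    push_cast; ring
  rw [h2]
  have h3 : Real.pi ^ (((k : ℝ) + 1) * (k + 2) / 2) ≠ 0 := (Real.rpow_pos_of_pos Real.pi_pos _).ne'
  field_simp

/-- The two orientations, the volume of the unit disk, and the integral-geometric constant. -/
theorem two_mul_volume_ball_mul_chartConst (k m : ℕ) (hm : 0 < m) :
    2 * (volume (Metric.ball (0 : E m) 1) * chartConst k m) =
      ENNReal.ofReal
        (4 * Real.pi ^ ((((k + m : ℕ) : ℝ) + 2) * ((k : ℝ) + 1) / 2) *
            Real.Gamma ((((k + m : ℕ) : ℝ) - k + 1) / 2)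
          / (√Real.pi * Real.Gamma ((((k + m : ℕ) : ℝ) + 1) / 2) * (((k + m : ℕ) : ℝ) - k))
          * ∏ i ∈ Finset.Icc 1 (k + 1), Real.Gamma ((i : ℝ) / 2)
              / (Real.pi ^ i * Real.Gamma ((((k + m : ℕ) : ℝ) - i + 1) / 2))) := by
  have hne : Nonempty (Fin m) := ⟨⟨0, hm⟩⟩
  have hm' : (0 : ℝ) < m := Nat.cast_pos.2 hm
  have hG : ∀ x : ℝ, 0 < x → 0 < Real.Gamma x := fun x hx => Real.Gamma_pos_of_pos hx
  rw [prod_Icc_gamma_eq k m hm, chartConst_eq, EuclideanSpace.volume_ball, Fintype.card_fin,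
    ENNReal.ofReal_one, one_pow, one_mul, ← ENNReal.ofReal_ofNat 2,
    ← ENNReal.ofReal_mul (by have := hG ((m : ℝ) / 2 + 1) (by positivity); positivity),
    ← ENNReal.ofReal_mul (by norm_num)]
  congr 1
  have hp : ∏ i ∈ Finset.range k, (Real.pi ^ ((m : ℝ) / 2) * Real.Gamma (((i : ℝ) + 2) / 2) /
      Real.Gamma (((m : ℝ) + i + 2) / 2)) = Real.pi ^ ((m : ℝ) * k / 2) *
        ∏ i ∈ Finset.range k,
          (Real.Gamma (((i : ℝ) + 2) / 2) / Real.Gamma (((m : ℝ) + i + 2) / 2)) := by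
    simp only [mul_div_assoc]
    rw [Finset.prod_mul_distrib, Finset.prod_const, Finset.card_range, ← Real.rpow_natCast,
      ← Real.rpow_mul Real.pi_pos.le]
    congr 2
    ring
  have hs : √Real.pi ^ m = Real.pi ^ ((m : ℝ) / 2) := by
    rw [Real.sqrt_eq_rpow, ← Real.rpow_natCast, ← Real.rpow_mul Real.pi_pos.le]
    congr 1
    ring
  have hpow : Real.pi ^ ((((k + m : ℕ) : ℝ) + 2) * ((k : ℝ) + 1) / 2) =
      Real.pi ^ ((m : ℝ) / 2) * Real.pi ^ ((m : ℝ) * k / 2) *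
        Real.pi ^ (((k : ℝ) + 1) * (k + 2) / 2) := by
    rw [← Real.rpow_add Real.pi_pos, ← Real.rpow_add Real.pi_pos]
    congr 1
    push_cast
    ring
  have e1 : ((((k + m : ℕ) : ℝ) - k + 1) / 2) = ((m : ℝ) + 1) / 2 := by push_cast; ring
  have e2 : (((k + m : ℕ) : ℝ) - k) = m := by push_cast; ring
  have e3 : ((((k + m : ℕ) : ℝ) + 1) / 2) = ((m : ℝ) + k + 1) / 2 := by push_cast; ring
  rw [hp, hs, hpow, e1, e2, e3, Real.Gamma_add_one (by positivity)]
  have g1 := (hG ((m : ℝ) / 2) (by positivity)).ne'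
  have g2 := (hG (((m : ℝ) + 1) / 2) (by positivity)).ne'
  have g3 := (hG (((m : ℝ) + k + 1) / 2) (by positivity)).ne'
  have h3 : Real.pi ^ (((k : ℝ) + 1) * (k + 2) / 2) ≠ 0 := (Real.rpow_pos_of_pos Real.pi_pos _).ne'
  have h4 : √Real.pi ≠ 0 := (Real.sqrt_pos.2 Real.pi_pos).ne'
  generalize ∏ i ∈ Finset.range k,
    (Real.Gamma (((i : ℝ) + 2) / 2) / Real.Gamma (((m : ℝ) + i + 2) / 2)) = P
  field_simp
  ring

end LimitConstant

/-! ### The fractional measure of a manifold -/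

section Manifold

variable {k m : ℕ} {M Ω : Set (E (k + m))}

/-- The fractional measure is a weighted radial integral of the density of odd disks. -/
theorem meas_eq_lintegral_sliceDensity (hm : 0 < m) (hM : IsBoundedManifold k M) (hΩ : IsOpen Ω)
    (σ : ℝ) : meas (k + m) k σ M Ω = 2 * ∫⁻ r in Ioi 0, ENNReal.ofReal (r ^ (-σ)) *
      sliceDensity (interiorPart k (closure M)) Ω r := by
  obtain ⟨K, hK, hKm, hKS⟩ := exists_compact_exhaustion_interiorPart (isCompact_closure hM)
  have hO := measurableSet_oddCoords hK hKm hKS hΩ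
  have hf : Measurable fun r : ℝ => ENNReal.ofReal (r ^ (-(m : ℝ) - σ)) :=
    (measurable_id.pow_const _).ennreal_ofReal
  rw [meas_eq hm, setLIntegral_congr (oddCoords_ae_eq hM Ω), setLIntegral_oddCoords hO hf]
  congr 1
  refine setLIntegral_congr_fun measurableSet_Ioi fun r hr => ?_
  have hr : 0 < r := hr
  change _ = ENNReal.ofReal (r ^ (-σ)) * (_ * _)
  rw [← mul_assoc, ← ENNReal.ofReal_inv_of_pos (pow_pos hr m),
    ← ENNReal.ofReal_mul (Real.rpow_nonneg hr.le _), ← Real.rpow_natCast, ← Real.rpow_neg hr.le,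
    ← Real.rpow_add hr, neg_add_eq_sub, neg_sub_left, neg_add']

theorem meas_lt_top_and_tendsto (hm : 0 < m) (hM : IsBoundedManifold k M) (hΩ : IsOpen Ω)
    (hΩb : Bornology.IsBounded Ω) (hMΩ : M ⊆ Ω) :
    (∀ σ ∈ Ioo (0 : ℝ) 1, meas (k + m) k σ M Ω < ⊤) ∧
    Tendsto (fun σ : ℝ => ENNReal.ofReal (1 - σ) * meas (k + m) k σ M Ω) (𝓝[<] 1)
      (𝓝 (2 * (volume (Metric.ball (0 : E m) 1) * chartConst k m) *
        (μHE[k] : Measure (E (k + m))) M)) := by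
  obtain ⟨K, hK, hKm, hKS⟩ := exists_compact_exhaustion_interiorPart (isCompact_closure hM)
  have hO := measurableSet_oddCoords hK hKm hKS hΩ
  have hS : MeasurableSet (interiorPart k (closure M)) :=
    measurableSet_interiorPart isClosed_closure
  have hSM : interiorPart k (closure M) ⊆ closure M := interiorPart_subset k _
  have hle : ∀ r : ℝ, 0 < r → sliceDensity (interiorPart k (closure M)) Ω r ≤
      limitDensity (interiorPart k (closure M)) := fun r hr => sliceDensity_le hO hM hS hSM hr
  have htop := limitDensity_ne_top hM hSM
  obtain ⟨C, hC, R, hR, hb⟩ :=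
    exists_sliceDensity_le_of_large hm hΩb (interiorPart k (closure M))
  refine ⟨fun σ hσ => ?_, ?_⟩
  · rw [meas_eq_lintegral_sliceDensity hm hM hΩ]
    exact ENNReal.mul_lt_top (by simp) ((lintegral_rpow_mul_le hle htop hC hR hb hσ).trans_lt
      (ENNReal.add_lt_top.2 ⟨ENNReal.mul_lt_top (by simp) htop.lt_top,
        ENNReal.mul_lt_top (by simp) hC.lt_top⟩))
  · have h := ENNReal.Tendsto.const_mul (a := 2) (tendsto_lintegral_rpow_mul hle htop
      (tendsto_sliceDensity hm hO hM hS hSM hΩ ((interiorPart_subset_manifold hM).trans hMΩ))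
      hC hR hb) (Or.inr (by simp))
    rw [limitDensity, euclideanHausdorffMeasure_interiorPart hM, ← mul_assoc (volume _),
      ← mul_assoc 2] at h
    refine h.congr fun σ => ?_
    rw [meas_eq_lintegral_sliceDensity hm hM hΩ]
    ring

end Manifold

end FracMeas

end

theorem theorem4p1 (n k : ℕ) (hkn : k < n) (M Ω : Set (FracMeas.E n))
    (hM : FracMeas.IsBoundedManifold k M)
    (hΩ : IsOpen Ω) (hΩb : Bornology.IsBounded Ω) (hMΩ : M ⊆ Ω) :
    (μHE[k] : Measure (FracMeas.E n)) M < ⊤ ∧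
    (∀ σ ∈ Ioo (0 : ℝ) 1, FracMeas.meas n k σ M Ω < ⊤) ∧
    Tendsto (fun σ : ℝ => ENNReal.ofReal (1 - σ) * FracMeas.meas n k σ M Ω) (𝓝[<] 1)
      (𝓝 (ENNReal.ofReal
          (4 * Real.pi ^ (((n : ℝ) + 2) * ((k : ℝ) + 1) / 2) * Real.Gamma (((n : ℝ) - k + 1) / 2)
            / (√Real.pi * Real.Gamma (((n : ℝ) + 1) / 2) * ((n : ℝ) - k))
            * ∏ i ∈ Finset.Icc 1 (k + 1),
                Real.Gamma ((i : ℝ) / 2)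
                  / (Real.pi ^ i * Real.Gamma (((n : ℝ) - i + 1) / 2)))
        * (μHE[k] : Measure (FracMeas.E n)) M)) := by
  obtain ⟨m, rfl⟩ := Nat.exists_eq_add_of_le hkn.le
  have hm : 0 < m := by omega
  obtain ⟨h1, h2⟩ := FracMeas.meas_lt_top_and_tendsto hm hM hΩ hΩb hMΩ
  rw [FracMeas.two_mul_volume_ball_mul_chartConst k m hm] at h2
  exact ⟨(measure_mono subset_closure).trans_lt
    (FracMeas.euclideanHausdorffMeasure_closure_lt_top hM), h1, h2⟩
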